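/- Let $F/K$ be a finite Galois extension of number fields with Galois group $G$, let $d=[K:\mathbb{Q}]$, let $S_\infty$ be the $G$-set of Archimedean places of $F$, and let $\mu_F$ be the group of roots of unity in $F$. Let $\mathrm{Id}_F$ be the (discrete) group of fractional ideals of $\mathcal{O}_F$, let $F_{\mathbb{R}}=F\otimes_{\mathbb{Q}}\mathbb{R}=\prod_{w\in S_\infty}F_w$, and let $\mathrm{Id}_F\times_{\mathbb{R}_{>0}}F_{\mathbb{R}}^\times$ be the fibre product with respect to the ideal norm and the absolute value of the $\mathbb{R}$-algebra norm. The oriented Arakelov class group $\widetilde{\mathrm{Pic}}^0_F$ is the cokernel of $F^\times\to \mathrm{Id}_F\times_{\mathbb{R}_{>0}}F_{\mathbb{R}}^\times$, $\alpha\mapsto(\alpha\mathcal{O}_F,\alpha)$, and the Arakelov class group $\mathrm{Pic}^0_F$ is the quotient of $\widetilde{\mathrm{Pic}}^0_F$ by the image of $\{1\}\times\prod_{w\in S_\infty} c(F_w^\times)$, where $c(F_w^\times)$ is the maximal compact subgroup of $F_w^\times$. Let $\widetilde{\mathrm{Ar}}_F$ and $\mathrm{Ar}_F$ be the Pontryagin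 duals of $\widetilde{\mathrm{Pic}}^0_F$ and $\mathrm{Pic}^0_F$, with $g\in G$ acting by $(g\chi)(a)=\chi(g^{-1}a)$. Let $\mathrm{G}_0(\mathbb{Z}[G])$ be the Grothendieck group of the category of finitely generated $\mathbb{Z}[G]$-modules, and let $\sigma$ be its automorphism characterised by $\sigma[M]=[\mathrm{Hom}_{\mathbb{Z}}(M,\mathbb{Z})]$ for every $\mathbb{Z}$-free finitely generated $\mathbb{Z}[G]$-module $M$, where $(gf)(m)=f(g^{-1}m)$. Then the $\mathbb{Z}[G]$-modules $\widetilde{\mathrm{Ar}}_F$ and $\mathrm{Ar}_F$ are finitely generated, and the following two equalities in $\mathrm{G}_0(\mathbb{Z}[G])$ are equivalent: (a) $[\widetilde{\mathrm{Ar}}_F]=d\cdot[\mathbb{Z}[G]]-[\mathbb{Z}]$; (b) $[\mathrm{Ar}_F]=[\mathbb{Z}[S_\infty]]-[\mathbb{Z}]-\sigma[\mu_F]$. Moreover, unconditionally, in each of (a) and (b) the difference between the left hand side and the right hand side lies in the torsion subgroup $\mathrm{G}_0(\mathbb{Z}[G])_{\mathrm{tors}}$. -/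

import Mathlib

universe u v

noncomputable section

namespace Arakelov

/-! ### Grothendieck groups of modules -/

section Grothendieck

open Function

variable {Λ : Type u} [Ring Λ]

/-- The relators `[L] + [N] - [M]`, one for each short exact sequence `0 → L → M → N → 0`
of modules having property `P`. -/
def exactRelators (P : CategoryTheory.ObjectProperty (ModuleCat.{u} Λ)) :
    Set (FreeAbelianGroup P.FullSubcategory) :=
  {x | ∃ (L M N : P.FullSubcategory) (f : L.obj →ₗ[Λ] M.obj) (g : M.obj →ₗ[Λ] N.obj),
    Injective f ∧ Exact f g ∧ Surjective g ∧
      x = FreeAbelianGroup.of L + FreeAbelianGroup.of N - FreeAbelianGroup.of M}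

/-- The Grothendieck group of the category of `Λ`-modules with property `P`: generators are the
modules, relations come from short exact sequences. -/
def GrothendieckGroup (P : CategoryTheory.ObjectProperty (ModuleCat.{u} Λ)) : Type (u + 1) :=
  FreeAbelianGroup P.FullSubcategory ⧸ AddSubgroup.closure (exactRelators P)

instance instAddCommGroupGrothendieckGroup (P : CategoryTheory.ObjectProperty (ModuleCat.{u} Λ)) :
    AddCommGroup (GrothendieckGroup P) :=
  inferInstanceAs (AddCommGroup (_ ⧸ AddSubgroup.closure (exactRelators P)))

namespace GrothendieckGroup

variable {P : CategoryTheory.ObjectProperty (ModuleCat.{u} Λ)}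

/-- The class `[M]`. -/
def mk (M : P.FullSubcategory) : GrothendieckGroup P :=
  QuotientAddGroup.mk (FreeAbelianGroup.of M)

theorem mk_add_mk {L M N : P.FullSubcategory} (f : L.obj →ₗ[Λ] M.obj) (g : M.obj →ₗ[Λ] N.obj)
    (hf : Injective f) (hfg : Exact f g) (hg : Surjective g) : mk L + mk N = mk M := by
  rw [← sub_eq_zero]
  exact (QuotientAddGroup.eq_zero_iff _).2
    (AddSubgroup.subset_closure ⟨L, M, N, f, g, hf, hfg, hg, rfl⟩)

/-- The homomorphism out of the Grothendieck group defined by an additive function. -/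
def lift {A : Type*} [AddCommGroup A] (φ : P.FullSubcategory → A)
    (h : ∀ (L M N : P.FullSubcategory) (f : L.obj →ₗ[Λ] M.obj) (g : M.obj →ₗ[Λ] N.obj),
      Injective f → Exact f g → Surjective g → φ L + φ N = φ M) :
    GrothendieckGroup P →+ A :=
  QuotientAddGroup.lift _ (FreeAbelianGroup.lift φ) <| by
    rw [AddSubgroup.closure_le]
    rintro x ⟨L, M, N, f, g, hf, hfg, hg, rfl⟩
    simp [h L M N f g hf hfg hg]

@[simp]
theorem lift_mk {A : Type*} [AddCommGroup A] (φ : P.FullSubcategory → A) (h)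
    (M : P.FullSubcategory) : lift φ h (mk M) = φ M :=
  FreeAbelianGroup.lift_apply_of φ M

theorem hom_ext {A : Type*} [AddCommGroup A] {φ ψ : GrothendieckGroup P →+ A}
    (h : ∀ M, φ (mk M) = ψ (mk M)) : φ = ψ := by
  ext x
  induction x using QuotientAddGroup.induction_on with
  | H x =>
    have : φ.comp (QuotientAddGroup.mk' _) = ψ.comp (QuotientAddGroup.mk' _) :=
      FreeAbelianGroup.lift_ext _ _ h
    exact DFunLike.congr_fun this x

end GrothendieckGroup

variable (Λ) in
/-- `G₀(Λ)`: the Grothendieck group of the category of finitely generated `Λ`-modules. -/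
abbrev G0 : Type (u + 1) := GrothendieckGroup (ModuleCat.isFG.{u} Λ)

variable (Λ) in
/-- The class `[M]` in `G₀(Λ)` of a finitely generated `Λ`-module `M`. -/
def G0.cls (M : Type u) [AddCommGroup M] [Module Λ M] [hM : Module.Finite Λ M] : G0 Λ :=
  GrothendieckGroup.mk ⟨ModuleCat.of Λ M, hM⟩

variable (Λ) in
/-- A `Λ`-lattice: a finitely generated `Λ`-module that is projective over `ℤ`. -/
def isLattice : CategoryTheory.ObjectProperty (ModuleCat.{u} Λ) :=
  fun M => Module.Finite Λ M ∧ Module.Projective ℤ M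

variable (Λ) in
/-- The Grothendieck group of the category of `Λ`-lattices. -/
abbrev G0Lat : Type (u + 1) := GrothendieckGroup (isLattice.{u} Λ)

variable (Λ) in
/-- The class `[M]` of a `Λ`-lattice in the Grothendieck group of lattices. -/
def G0Lat.cls (M : Type u) [AddCommGroup M] [Module Λ M] [h₁ : Module.Finite Λ M]
    [h₂ : Module.Projective ℤ M] : G0Lat Λ :=
  GrothendieckGroup.mk ⟨ModuleCat.of Λ M, h₁, h₂⟩

theorem G0.cls_add {L M N : Type u} [AddCommGroup L] [Module Λ L] [Module.Finite Λ L]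
    [AddCommGroup M] [Module Λ M] [Module.Finite Λ M]
    [AddCommGroup N] [Module Λ N] [Module.Finite Λ N] (f : L →ₗ[Λ] M) (g : M →ₗ[Λ] N)
    (hf : Injective f) (hfg : Exact f g) (hg : Surjective g) :
    G0.cls Λ L + G0.cls Λ N = G0.cls Λ M :=
  GrothendieckGroup.mk_add_mk (L := ⟨ModuleCat.of Λ L, _⟩) (M := ⟨ModuleCat.of Λ M, _⟩)
    (N := ⟨ModuleCat.of Λ N, _⟩) f g hf hfg hg

theorem G0Lat.cls_add {L M N : Type u}
    [AddCommGroup L] [Module Λ L] [Module.Finite Λ L] [Module.Projective ℤ L]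
    [AddCommGroup M] [Module Λ M] [Module.Finite Λ M] [Module.Projective ℤ M]
    [AddCommGroup N] [Module Λ N] [Module.Finite Λ N] [Module.Projective ℤ N]
    (f : L →ₗ[Λ] M) (g : M →ₗ[Λ] N)
    (hf : Injective f) (hfg : Exact f g) (hg : Surjective g) :
    G0Lat.cls Λ L + G0Lat.cls Λ N = G0Lat.cls Λ M :=
  GrothendieckGroup.mk_add_mk (L := ⟨ModuleCat.of Λ L, _⟩) (M := ⟨ModuleCat.of Λ M, _⟩)
    (N := ⟨ModuleCat.of Λ N, _⟩) f g hf hfg hg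

theorem G0Lat.cls_punit : G0Lat.cls Λ PUnit.{u + 1} = 0 := by
  have := G0Lat.cls_add (Λ := Λ) (LinearMap.id : PUnit.{u + 1} →ₗ[Λ] PUnit.{u + 1})
    (0 : PUnit.{u + 1} →ₗ[Λ] PUnit.{u + 1}) injective_id
    (fun y => ⟨fun _ => ⟨y, rfl⟩, fun _ => rfl⟩) (fun y => ⟨y, rfl⟩)
  simpa using this

variable (Λ) in
/-- The homomorphism induced by the inclusion of lattices into finitely generated modules. -/
def latticeInclusion : G0Lat Λ →+ G0 Λ :=
  GrothendieckGroup.lift (fun M => GrothendieckGroup.mk ⟨M.obj, M.property.1⟩)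
    fun _ _ _ f g hf hfg hg => GrothendieckGroup.mk_add_mk f g hf hfg hg

/-! For a `ℤ`-order `Λ` this homomorphism is bijective. -/

section Order

theorem finite_int [Module.Finite ℤ Λ] (M : Type u) [AddCommGroup M] [Module Λ M]
    [Module.Finite Λ M] : Module.Finite ℤ M := Module.Finite.trans Λ M

theorem finite_submodule [Module.Finite ℤ Λ] {M : Type u} [AddCommGroup M] [Module Λ M]
    [Module.Finite Λ M] (N : Submodule Λ M) : Module.Finite Λ N := by
  have := finite_int (Λ := Λ) M
  have : IsNoetherian ℤ M := isNoetherian_of_isNoetherianRing_of_finite ℤ M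
  have : IsNoetherian Λ M := isNoetherian_of_tower ℤ this
  infer_instance

theorem projective_submodule [Module.Finite ℤ Λ] {M : Type u} [AddCommGroup M] [Module Λ M]
    [Module.Finite Λ M] [Module.Projective ℤ M] (N : Submodule Λ M) : Module.Projective ℤ N := by
  have := finite_int (Λ := Λ) M
  have : Module.Projective ℤ (N.restrictScalars ℤ) := inferInstance
  exact this

/-- The object of the category of lattices given by a lattice. -/
abbrev latticeOf (M : Type u) [AddCommGroup M] [Module Λ M] [h₁ : Module.Finite Λ M]
    [h₂ : Module.Projective ℤ M] : (isLattice.{u} Λ).FullSubcategory :=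
  ⟨ModuleCat.of Λ M, h₁, h₂⟩

/-- The class `[P] - [ker p]` of a homomorphism `p : P → M` from a lattice. -/
def presClass [Module.Finite ℤ Λ] {M P : Type u} [AddCommGroup M] [Module Λ M]
    [AddCommGroup P] [Module Λ P] [Module.Finite Λ P] [Module.Projective ℤ P]
    (p : P →ₗ[Λ] M) : G0Lat Λ :=
  letI := finite_submodule (LinearMap.ker p)
  letI := projective_submodule (LinearMap.ker p)
  G0Lat.cls Λ P - G0Lat.cls Λ (LinearMap.ker p)

theorem presClass_eq_sub [Module.Finite ℤ Λ] {K M P : Type u} [AddCommGroup M] [Module Λ M]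
    [AddCommGroup P] [Module Λ P] [Module.Finite Λ P] [Module.Projective ℤ P]
    [AddCommGroup K] [Module Λ K] [Module.Finite Λ K] [Module.Projective ℤ K]
    (p : P →ₗ[Λ] M) (i : K →ₗ[Λ] P) (hi : Injective i) (h : Exact i p) :
    presClass p = G0Lat.cls Λ P - G0Lat.cls Λ K := by
  let _ := finite_submodule (LinearMap.ker p)
  let _ := projective_submodule (LinearMap.ker p)
  let e : K →ₗ[Λ] LinearMap.ker p := i.codRestrict _ fun x => (h _).2 ⟨x, rfl⟩
  have he : Injective e := fun x y hxy => hi (congrArg Subtype.val hxy)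
  have hs : Surjective e := fun ⟨y, hy⟩ => by
    obtain ⟨x, rfl⟩ := (h y).1 hy
    exact ⟨x, rfl⟩
  have h1 : G0Lat.cls Λ K + G0Lat.cls Λ PUnit.{u + 1} = G0Lat.cls Λ (LinearMap.ker p) :=
    G0Lat.cls_add e (0 : _ →ₗ[Λ] PUnit.{u + 1}) he
      (fun y => ⟨fun _ => hs y, fun _ => rfl⟩) (fun y => ⟨0, rfl⟩)
  rw [G0Lat.cls_punit, add_zero] at h1
  rw [presClass, h1]

theorem presClass_eq [Module.Finite ℤ Λ] {M P Q : Type u} [AddCommGroup M] [Module Λ M]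
    [AddCommGroup P] [Module Λ P] [Module.Finite Λ P] [Module.Projective ℤ P]
    [AddCommGroup Q] [Module Λ Q] [Module.Finite Λ Q] [Module.Projective ℤ Q]
    (p : P →ₗ[Λ] M) (hp : Surjective p) (q : Q →ₗ[Λ] M) (hq : Surjective q) :
    presClass p = presClass q := by
  let R : Submodule Λ (P × Q) :=
    LinearMap.ker (p.comp (LinearMap.fst Λ P Q) - q.comp (LinearMap.snd Λ P Q))
  have hR : ∀ x : P × Q, x ∈ R ↔ p x.1 = q x.2 := fun x => by simp [R, sub_eq_zero]
  have : Module.Projective ℤ (P × Q) := inferInstance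
  let _ := finite_submodule R
  let _ := projective_submodule R
  let _ := finite_submodule (LinearMap.ker p)
  let _ := projective_submodule (LinearMap.ker p)
  let _ := finite_submodule (LinearMap.ker q)
  let _ := projective_submodule (LinearMap.ker q)
  have e1 : G0Lat.cls Λ (LinearMap.ker q) + G0Lat.cls Λ P = G0Lat.cls Λ R := by
    refine G0Lat.cls_add
      (((LinearMap.inr Λ P Q).comp (LinearMap.ker q).subtype).codRestrict R fun x => ?_)
      ((LinearMap.fst Λ P Q).comp R.subtype) ?_ ?_ ?_
    · exact (hR _).2 (by simp)
    · intro x y hxy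
      have := congrArg (fun z : R => z.1.2) hxy
      exact Subtype.ext this
    · rintro ⟨⟨a, b⟩, hab⟩
      have hab' : p a = q b := (hR _).1 hab
      constructor
      · intro h
        have h' : a = 0 := h
        subst h'
        exact ⟨⟨b, by simpa using hab'.symm⟩, rfl⟩
      · rintro ⟨c, hc⟩
        exact (congrArg (fun z : R => z.1.1) hc).symm
    · intro a
      obtain ⟨b, hb⟩ := hq (p a)
      exact ⟨⟨(a, b), (hR _).2 hb.symm⟩, rfl⟩
  have e2 : G0Lat.cls Λ (LinearMap.ker p) + G0Lat.cls Λ Q = G0Lat.cls Λ R := by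
    refine G0Lat.cls_add
      (((LinearMap.inl Λ P Q).comp (LinearMap.ker p).subtype).codRestrict R fun x => ?_)
      ((LinearMap.snd Λ P Q).comp R.subtype) ?_ ?_ ?_
    · exact (hR _).2 (by simp)
    · intro x y hxy
      have := congrArg (fun z : R => z.1.1) hxy
      exact Subtype.ext this
    · rintro ⟨⟨a, b⟩, hab⟩
      have hab' : p a = q b := (hR _).1 hab
      constructor
      · intro h
        have h' : b = 0 := h
        subst h'
        exact ⟨⟨a, by simpa using hab'⟩, rfl⟩
      · rintro ⟨c, hc⟩
        exact (congrArg (fun z : R => z.1.2) hc).symm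
    · intro b
      obtain ⟨a, ha⟩ := hp (q b)
      exact ⟨⟨(a, b), (hR _).2 ha⟩, rfl⟩
  rw [presClass, presClass, sub_eq_sub_iff_add_eq_add, add_comm, e1, ← e2, add_comm]

theorem exists_cover [Module.Finite ℤ Λ] [Module.Free ℤ Λ] (M : Type u) [AddCommGroup M]
    [Module Λ M] [Module.Finite Λ M] :
    ∃ (n : ℕ) (p : (Fin n → Λ) →ₗ[Λ] M), Surjective p :=
  Module.Finite.exists_fin' Λ M

/-- The class in the Grothendieck group of lattices of a finitely generated module `M`, namely
`[Λⁿ] - [ker p]` for any surjection `p : Λⁿ → M`. -/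
def resolutionClass [Module.Finite ℤ Λ] [Module.Free ℤ Λ] (M : Type u) [AddCommGroup M]
    [Module Λ M] [Module.Finite Λ M] : G0Lat Λ :=
  presClass (exists_cover (Λ := Λ) M).choose_spec.choose

theorem resolutionClass_eq [Module.Finite ℤ Λ] [Module.Free ℤ Λ] {M P : Type u}
    [AddCommGroup M] [Module Λ M] [Module.Finite Λ M]
    [AddCommGroup P] [Module Λ P] [Module.Finite Λ P] [Module.Projective ℤ P]
    (p : P →ₗ[Λ] M) (hp : Surjective p) : resolutionClass M = presClass p :=
  presClass_eq _ (exists_cover (Λ := Λ) M).choose_spec.choose_spec p hp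

theorem resolutionClass_add [Module.Finite ℤ Λ] [Module.Free ℤ Λ] {L M N : Type u}
    [AddCommGroup L] [Module Λ L] [Module.Finite Λ L]
    [AddCommGroup M] [Module Λ M] [Module.Finite Λ M]
    [AddCommGroup N] [Module Λ N] [Module.Finite Λ N] (f : L →ₗ[Λ] M) (g : M →ₗ[Λ] N)
    (hf : Injective f) (hfg : Exact f g) (hg : Surjective g) :
    resolutionClass (Λ := Λ) L + resolutionClass (Λ := Λ) N = resolutionClass (Λ := Λ) M := by
  obtain ⟨n, p, hp⟩ := exists_cover (Λ := Λ) M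
  let K' : Submodule Λ (Fin n → Λ) := LinearMap.ker (g.comp p)
  let _ := finite_submodule K'
  let _ := projective_submodule K'
  let _ := finite_submodule (LinearMap.ker p)
  let _ := projective_submodule (LinearMap.ker p)
  have hK : ∀ x : K', p x.1 ∈ LinearMap.range f := fun x => (hfg _).1 x.2
  let e : L ≃ₗ[Λ] LinearMap.range f := LinearEquiv.ofInjective f hf
  let q : K' →ₗ[Λ] L := e.symm.toLinearMap.comp
    ((p.comp K'.subtype).codRestrict (LinearMap.range f) hK)
  have hq : ∀ x : K', f (q x) = p x.1 := fun x => by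
    have h1 : ((e (q x) : LinearMap.range f) : M) = p x.1 := by
      simp only [q, LinearMap.comp_apply, LinearEquiv.coe_coe, LinearEquiv.apply_symm_apply]
      rfl
    rw [← h1]
    rfl
  have hqs : Surjective q := fun l => by
    obtain ⟨x, hx⟩ := hp (f l)
    refine ⟨⟨x, ?_⟩, hf ?_⟩
    · change g (p x) = 0
      rw [hx]
      exact (hfg _).2 ⟨l, rfl⟩
    · rw [hq, hx]
  have hle : LinearMap.ker p ≤ K' := fun x hx => by
    change g (p x) = 0
    rw [LinearMap.mem_ker.1 hx, map_zero]
  rw [resolutionClass_eq q hqs, resolutionClass_eq (g.comp p) (hg.comp hp),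
    resolutionClass_eq p hp,
    presClass_eq_sub q (Submodule.inclusion hle) (Submodule.inclusion_injective hle) ?_,
    presClass, presClass]
  · abel
  · intro x
    rw [← hf.eq_iff, hq, map_zero]
    constructor
    · exact fun h => ⟨⟨x.1, h⟩, rfl⟩
    · rintro ⟨y, rfl⟩
      exact y.2

variable (Λ) in
/-- The canonical isomorphism between the Grothendieck group of lattices over a `ℤ`-order `Λ`
and `G₀(Λ)`, induced by the inclusion of lattices into finitely generated modules. -/
def latticeEquiv [Module.Finite ℤ Λ] [Module.Free ℤ Λ] : G0Lat Λ ≃+ G0 Λ :=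
  AddMonoidHom.toAddEquiv (latticeInclusion Λ)
    (GrothendieckGroup.lift (fun M => haveI : Module.Finite Λ M.obj := M.property
        resolutionClass (Λ := Λ) M.obj)
      fun L M N f g hf hfg hg =>
        haveI : Module.Finite Λ L.obj := L.property
        haveI : Module.Finite Λ M.obj := M.property
        haveI : Module.Finite Λ N.obj := N.property
        resolutionClass_add f g hf hfg hg)
    (by
      refine GrothendieckGroup.hom_ext fun M => ?_
      let _ : Module.Finite Λ M.obj := M.property.1
      let _ : Module.Projective ℤ M.obj := M.property.2
      have h1 := presClass_eq_sub (Λ := Λ) (LinearMap.id : M.obj →ₗ[Λ] M.obj)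
        (0 : PUnit.{u + 1} →ₗ[Λ] M.obj) (fun _ _ _ => rfl)
        (fun y => ⟨fun h => ⟨0, h.symm⟩, fun ⟨_, h⟩ => h.symm⟩)
      have h2 := resolutionClass_eq (Λ := Λ) (LinearMap.id : M.obj →ₗ[Λ] M.obj) surjective_id
      rw [h1, G0Lat.cls_punit, sub_zero] at h2
      exact h2)
    (by
      refine GrothendieckGroup.hom_ext fun M => ?_
      let _ : Module.Finite Λ M.obj := M.property
      obtain ⟨n, p, hp⟩ := exists_cover (Λ := Λ) M.obj
      let _ := finite_submodule (LinearMap.ker p)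
      let _ := projective_submodule (LinearMap.ker p)
      have h2 := resolutionClass_eq p hp
      have h3 : latticeInclusion Λ (resolutionClass (Λ := Λ) M.obj) = G0.cls Λ M.obj := by
        rw [h2, presClass, map_sub, sub_eq_iff_eq_add, add_comm]
        exact (G0.cls_add (LinearMap.ker p).subtype p Subtype.val_injective
          (LinearMap.exact_subtype_ker_map p) hp).symm
      exact h3)

end Order

end Grothendieck

/-! ### Modules over integral group rings -/

section GroupRing

open Function

variable (G : Type u) [Group G]

/-- The action of `G` on a `ℤ[G]`-module, as a representation. -/
def groupRep (M : Type u) [AddCommGroup M] [Module (MonoidAlgebra ℤ G) M] :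
    Representation ℤ G M :=
  (addMonoidEndRingEquivInt M : AddMonoid.End M →* Module.End ℤ M).comp
    ((Module.toAddMonoidEnd (MonoidAlgebra ℤ G) M : MonoidAlgebra ℤ G →* AddMonoid.End M).comp
      (MonoidAlgebra.of ℤ G))

@[simp]
theorem groupRep_apply (M : Type u) [AddCommGroup M] [Module (MonoidAlgebra ℤ G) M]
    (g : G) (m : M) : groupRep G M g m = MonoidAlgebra.of ℤ G g • m := rfl

/-- The dual `M* = Hom(M, ℤ)` of a `ℤ[G]`-module, with `g ∈ G` acting by
`(g • f)(m) = f (g⁻¹ • m)`. -/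
abbrev DualModule (M : Type u) [AddCommGroup M] [Module (MonoidAlgebra ℤ G) M] : Type u :=
  (groupRep G M).dual.asModule


theorem finite_of_finite_int {M : Type u} [AddCommGroup M] [Module (MonoidAlgebra ℤ G) M]
    (h : Module.Finite ℤ M) : Module.Finite (MonoidAlgebra ℤ G) M :=
  Module.Finite.of_restrictScalars_finite ℤ (MonoidAlgebra ℤ G) M

instance finite_groupRing [Finite G] : Module.Finite ℤ (MonoidAlgebra ℤ G) := inferInstance
instance free_groupRing [Finite G] : Module.Free ℤ (MonoidAlgebra ℤ G) := inferInstance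

variable {G}

theorem groupRep_dual_smul {M : Type u} [AddCommGroup M] [Module (MonoidAlgebra ℤ G) M]
    (g : G) (φ : DualModule G M) (m : M) :
    (groupRep G M).dual.asModuleEquiv (MonoidAlgebra.single g (1 : ℤ) • φ) m =
      (groupRep G M).dual.asModuleEquiv φ (MonoidAlgebra.of ℤ G g⁻¹ • m) := by
  simp
  rfl

/-- The transpose `M* → L*` of a homomorphism `L → M`. -/
def dualMap {L M : Type u} [AddCommGroup L] [Module (MonoidAlgebra ℤ G) L]
    [AddCommGroup M] [Module (MonoidAlgebra ℤ G) M] (f : L →ₗ[MonoidAlgebra ℤ G] M) :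
    DualModule G M →ₗ[MonoidAlgebra ℤ G] DualModule G L :=
  MonoidAlgebra.equivariantOfLinearOfComm
    (((groupRep G L).dual.asModuleEquiv.symm.toLinearMap.comp
      (Module.Dual.transpose (R := ℤ) f.toAddMonoidHom.toIntLinearMap)).comp
        (groupRep G M).dual.asModuleEquiv.toLinearMap) (fun g v => by
      apply (groupRep G L).dual.asModuleEquiv.injective
      ext x
      rw [groupRep_dual_smul]
      simp only [LinearMap.comp_apply, LinearEquiv.coe_coe, LinearEquiv.apply_symm_apply,
        Module.Dual.transpose_apply]
      rw [groupRep_dual_smul]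
      exact congrArg _ (f.map_smul _ _).symm)

theorem dualMap_apply {L M : Type u} [AddCommGroup L] [Module (MonoidAlgebra ℤ G) L]
    [AddCommGroup M] [Module (MonoidAlgebra ℤ G) M] (f : L →ₗ[MonoidAlgebra ℤ G] M)
    (φ : DualModule G M) (x : L) :
    (groupRep G L).dual.asModuleEquiv (dualMap f φ) x =
      (groupRep G M).dual.asModuleEquiv φ (f x) := rfl

theorem finite_dual [Finite G] (M : Type u) [AddCommGroup M] [Module (MonoidAlgebra ℤ G) M]
    [Module.Finite (MonoidAlgebra ℤ G) M] [Module.Projective ℤ M] :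
    Module.Finite ℤ (DualModule G M) := by
  have := finite_int (Λ := MonoidAlgebra ℤ G) M
  have : Module.Finite ℤ (Module.Dual ℤ M) := inferInstance
  exact Module.Finite.equiv (groupRep G M).dual.asModuleEquiv.symm

theorem projective_dual [Finite G] (M : Type u) [AddCommGroup M] [Module (MonoidAlgebra ℤ G) M]
    [Module.Finite (MonoidAlgebra ℤ G) M] [Module.Projective ℤ M] :
    Module.Projective ℤ (DualModule G M) := by
  have := finite_int (Λ := MonoidAlgebra ℤ G) M
  have : Module.Projective ℤ (Module.Dual ℤ M) := inferInstance
  exact Module.Projective.of_equiv (groupRep G M).dual.asModuleEquiv.symm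

variable (G) in
/-- The class `[M*]` of the dual of a `ℤ[G]`-lattice `M`. -/
def dualClass [Finite G] (M : Type u) [AddCommGroup M] [Module (MonoidAlgebra ℤ G) M]
    [Module.Finite (MonoidAlgebra ℤ G) M] [Module.Projective ℤ M] :
    G0Lat (MonoidAlgebra ℤ G) :=
  haveI := finite_of_finite_int G (finite_dual (G := G) M)
  haveI := projective_dual (G := G) M
  G0Lat.cls (MonoidAlgebra ℤ G) (DualModule G M)

theorem dualClass_add [Finite G] {L M N : Type u}
    [AddCommGroup L] [Module (MonoidAlgebra ℤ G) L] [Module.Finite (MonoidAlgebra ℤ G) L]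
    [Module.Projective ℤ L]
    [AddCommGroup M] [Module (MonoidAlgebra ℤ G) M] [Module.Finite (MonoidAlgebra ℤ G) M]
    [Module.Projective ℤ M]
    [AddCommGroup N] [Module (MonoidAlgebra ℤ G) N] [Module.Finite (MonoidAlgebra ℤ G) N]
    [Module.Projective ℤ N]
    (f : L →ₗ[MonoidAlgebra ℤ G] M) (g : M →ₗ[MonoidAlgebra ℤ G] N)
    (hf : Injective f) (hfg : Exact f g) (hg : Surjective g) :
    dualClass G L + dualClass G N = dualClass G M := by
  let _ := finite_of_finite_int G (finite_dual (G := G) L)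
  let _ := projective_dual (G := G) L
  let _ := finite_of_finite_int G (finite_dual (G := G) M)
  let _ := projective_dual (G := G) M
  let _ := finite_of_finite_int G (finite_dual (G := G) N)
  let _ := projective_dual (G := G) N
  let f' : L →ₗ[ℤ] M := f.toAddMonoidHom.toIntLinearMap
  let g' : M →ₗ[ℤ] N := g.toAddMonoidHom.toIntLinearMap
  obtain ⟨s, hs⟩ := Module.projective_lifting_property g' LinearMap.id hg
  have hs' : ∀ n, g (s n) = n := fun n => LinearMap.congr_fun hs n
  rw [add_comm]
  refine G0Lat.cls_add (dualMap g) (dualMap f) ?_ ?_ ?_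
  · intro φ ψ h
    apply (groupRep G N).dual.asModuleEquiv.injective
    ext x
    obtain ⟨y, rfl⟩ := hg x
    rw [← dualMap_apply, h, dualMap_apply]
  · intro φ
    constructor
    · intro h
      have h0 : ∀ x, (groupRep G M).dual.asModuleEquiv φ (f x) = 0 := fun x => by
        rw [← dualMap_apply, h]
        rfl
      refine ⟨(groupRep G N).dual.asModuleEquiv.symm
        (((groupRep G M).dual.asModuleEquiv φ).comp s), ?_⟩
      apply (groupRep G M).dual.asModuleEquiv.injective
      ext x
      rw [dualMap_apply, LinearEquiv.apply_symm_apply, LinearMap.comp_apply, ← sub_eq_zero,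
        ← map_sub]
      obtain ⟨y, hy⟩ := (hfg (s (g x) - x)).1 (by rw [map_sub, hs', sub_self])
      rw [← hy, h0]
    · rintro ⟨ψ, rfl⟩
      apply (groupRep G L).dual.asModuleEquiv.injective
      ext x
      rw [dualMap_apply, dualMap_apply, (hfg _).2 ⟨x, rfl⟩, map_zero, map_zero]
      rfl
  · intro φ
    have hr : ∀ m, m - s (g m) ∈ LinearMap.range f' := fun m => by
      obtain ⟨y, hy⟩ := (hfg (m - s (g m))).1 (by rw [map_sub, hs', sub_self])
      exact ⟨y, hy⟩
    let e : L ≃ₗ[ℤ] LinearMap.range f' := LinearEquiv.ofInjective f' hf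
    let r : M →ₗ[ℤ] L := e.symm.toLinearMap.comp
      ((LinearMap.id - s.comp g').codRestrict (LinearMap.range f') hr)
    have hrf : ∀ x, r (f x) = x := fun x => by
      apply e.injective
      apply Subtype.ext
      simp only [r, LinearMap.comp_apply, LinearEquiv.coe_coe, LinearEquiv.apply_symm_apply]
      change f x - s (g (f x)) = f x
      rw [(hfg _).2 ⟨x, rfl⟩, map_zero, sub_zero]
    refine ⟨(groupRep G M).dual.asModuleEquiv.symm
      (((groupRep G L).dual.asModuleEquiv φ).comp r), ?_⟩
    apply (groupRep G L).dual.asModuleEquiv.injective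
    ext x
    rw [dualMap_apply, LinearEquiv.apply_symm_apply, LinearMap.comp_apply, hrf]

variable (G) in
/-- The endomorphism `[M] ↦ [M*]` of the Grothendieck group of `ℤ[G]`-lattices. -/
def dualLat [Finite G] : G0Lat (MonoidAlgebra ℤ G) →+ G0Lat (MonoidAlgebra ℤ G) :=
  GrothendieckGroup.lift
    (fun M =>
      haveI : Module.Finite (MonoidAlgebra ℤ G) M.obj := M.property.1
      haveI : Module.Projective ℤ M.obj := M.property.2
      dualClass G M.obj)
    fun L M N f g hf hfg hg =>
      haveI : Module.Finite (MonoidAlgebra ℤ G) L.obj := L.property.1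
      haveI : Module.Projective ℤ L.obj := L.property.2
      haveI : Module.Finite (MonoidAlgebra ℤ G) M.obj := M.property.1
      haveI : Module.Projective ℤ M.obj := M.property.2
      haveI : Module.Finite (MonoidAlgebra ℤ G) N.obj := N.property.1
      haveI : Module.Projective ℤ N.obj := N.property.2
      dualClass_add f g hf hfg hg

variable (G) in
/-- The endomorphism `σ` of `G₀(ℤ[G])` characterised by `σ[M] = [M*]` for every `ℤ[G]`-lattice
`M`. -/
def sigma [Finite G] : G0 (MonoidAlgebra ℤ G) →+ G0 (MonoidAlgebra ℤ G) :=
  ((latticeEquiv (MonoidAlgebra ℤ G)).toAddMonoidHom.comp (dualLat G)).comp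
    (latticeEquiv (MonoidAlgebra ℤ G)).symm.toAddMonoidHom

theorem sigma_cls [Finite G] (M : Type u) [AddCommGroup M] [Module (MonoidAlgebra ℤ G) M]
    [Module.Finite (MonoidAlgebra ℤ G) M] [Module.Projective ℤ M]
    [Module.Finite (MonoidAlgebra ℤ G) (DualModule G M)] :
    sigma G (G0.cls (MonoidAlgebra ℤ G) M) = G0.cls (MonoidAlgebra ℤ G) (DualModule G M) := by
  have h : (latticeEquiv (MonoidAlgebra ℤ G)).symm (G0.cls (MonoidAlgebra ℤ G) M) =
      G0Lat.cls (MonoidAlgebra ℤ G) M := by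
    rw [AddEquiv.symm_apply_eq]
    rfl
  change latticeEquiv (MonoidAlgebra ℤ G) (dualLat G
    ((latticeEquiv (MonoidAlgebra ℤ G)).symm (G0.cls (MonoidAlgebra ℤ G) M))) = _
  rw [h]
  rfl

end GroupRing
/-! ### Galois modules attached to number fields -/

section Arithmetic

open NumberField TensorProduct
open scoped nonZeroDivisors

/-! #### Quotients by stable subgroups and Pontryagin duals -/

/-- If `G` acts on a commutative group `A` and preserves a subgroup `H`, it acts on `A ⧸ H`. -/
abbrev quotientAction {G A : Type*} [Group G] [CommGroup A] [MulDistribMulAction G A]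
    (H : Subgroup A) (hH : ∀ (g : G), ∀ h ∈ H, g • h ∈ H) : MulDistribMulAction G (A ⧸ H) where
  smul g := QuotientGroup.map H H (MulDistribMulAction.toMonoidHom A g) (hH g)
  one_smul x := by
    induction x using QuotientGroup.induction_on with
    | H x => exact congrArg _ (one_smul G x)
  mul_smul g₁ g₂ x := by
    induction x using QuotientGroup.induction_on with
    | H x => exact congrArg _ (mul_smul g₁ g₂ x)
  smul_mul g x y := map_mul (QuotientGroup.map H H (MulDistribMulAction.toMonoidHom A g) (hH g)) x y
  smul_one g := map_one (QuotientGroup.map H H (MulDistribMulAction.toMonoidHom A g) (hH g))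

theorem quotientAction_continuous {G A : Type*} [Group G] [CommGroup A] [TopologicalSpace A]
    [MulDistribMulAction G A] [ContinuousConstSMul G A]
    (H : Subgroup A) (hH : ∀ (g : G), ∀ h ∈ H, g • h ∈ H) :
    letI := quotientAction H hH
    ContinuousConstSMul G (A ⧸ H) := by
  let _ := quotientAction H hH
  exact ⟨fun g => Continuous.quotient_map' (continuous_const_smul g)
    (fun _ _ h => Quotient.eq''.1 (congrArg (g • ·) (Quotient.eq''.2 h : (_ : A ⧸ H) = _)))⟩

/-- If `G` acts on a commutative group `A` and preserves a subgroup `H`, it acts on `H`. -/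
abbrev subgroupAction {G A : Type*} [Group G] [CommGroup A] [MulDistribMulAction G A]
    (H : Subgroup A) (hH : ∀ (g : G), ∀ h ∈ H, g • h ∈ H) : MulDistribMulAction G H where
  smul g h := ⟨g • (h : A), hH g h h.2⟩
  one_smul x := Subtype.ext (one_smul G (x : A))
  mul_smul g₁ g₂ x := Subtype.ext (mul_smul g₁ g₂ (x : A))
  smul_mul g x y := Subtype.ext (smul_mul' g (x : A) (y : A))
  smul_one g := Subtype.ext (smul_one g)

theorem subgroupAction_continuous {G A : Type*} [Group G] [CommGroup A] [TopologicalSpace A]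
    [MulDistribMulAction G A] [ContinuousConstSMul G A]
    (H : Subgroup A) (hH : ∀ (g : G), ∀ h ∈ H, g • h ∈ H) :
    letI := subgroupAction H hH
    ContinuousConstSMul G H := by
  let _ := subgroupAction H hH
  exact ⟨fun g => ((continuous_const_smul g).comp continuous_subtype_val).subtype_mk _⟩

/-- If `G` acts on `A` by continuous automorphisms, it acts on the Pontryagin dual of `A`
by `(g • χ)(a) = χ (g⁻¹ • a)`. -/
instance pontryaginAction {G A : Type*} [Group G] [CommGroup A] [TopologicalSpace A]
    [MulDistribMulAction G A] [ContinuousConstSMul G A] :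
    MulDistribMulAction G (PontryaginDual A) where
  smul g χ := PontryaginDual.map
    { toMonoidHom := MulDistribMulAction.toMonoidHom A g⁻¹
      continuous_toFun := continuous_const_smul g⁻¹ } χ
  one_smul χ := PontryaginDual.ext fun a => by
    change χ ((1 : G)⁻¹ • a) = χ a
    rw [inv_one, one_smul]
  mul_smul g₁ g₂ χ := PontryaginDual.ext fun a => by
    change χ ((g₁ * g₂)⁻¹ • a) = χ (g₂⁻¹ • g₁⁻¹ • a)
    rw [mul_inv_rev, mul_smul]
  smul_mul g χ ψ := PontryaginDual.ext fun a => rfl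
  smul_one g := PontryaginDual.ext fun a => rfl

@[simp]
theorem pontryaginAction_apply {G A : Type*} [Group G] [CommGroup A] [TopologicalSpace A]
    [MulDistribMulAction G A] [ContinuousConstSMul G A] (g : G) (χ : PontryaginDual A) (a : A) :
    (g • χ) a = χ (g⁻¹ • a) := rfl

variable (K : Type v) (F : Type u) [Field K] [Field F] [NumberField F]
  [Algebra K F]

/-! #### Fractional ideals -/

/-- The group `Id_F` of (nonzero) fractional ideals of the ring of integers of `F`. -/
abbrev IdealGroup : Type u := (FractionalIdeal (𝓞 F)⁰ F)ˣ

/-- `Id_F` is discrete. -/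
instance idealGroupTopology : TopologicalSpace (IdealGroup F) := ⊥

instance idealGroupDiscrete : DiscreteTopology (IdealGroup F) := ⟨rfl⟩

theorem le_comap_mapRingHom {F : Type u} [Field F] (g : F →+* F) :
    (𝓞 F)⁰ ≤ Submonoid.comap (RingOfIntegers.mapRingHom g) (𝓞 F)⁰ := by
  refine nonZeroDivisors_le_comap_nonZeroDivisors_of_injective _ fun x y h => ?_
  apply RingOfIntegers.ext
  apply g.injective
  exact congrArg (fun z : 𝓞 F => (z : F)) h

variable {F}

/-- The fractional ideal generated by the image of a fractional ideal under `g : F → F`. -/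
def mapFractionalIdeal (g : F →+* F) :
    FractionalIdeal (𝓞 F)⁰ F →+* FractionalIdeal (𝓞 F)⁰ F :=
  FractionalIdeal.extendedHom' F (le_comap_mapRingHom g)

theorem isLocalization_map_eq (g : F →+* F) :
    (IsLocalization.map (S := F) F (RingOfIntegers.mapRingHom g)
      (le_comap_mapRingHom g) : F →+* F) = g :=
  IsLocalization.ringHom_ext (𝓞 F)⁰ (by ext x; simp)

theorem mapFractionalIdeal_coe (g : F →+* F) (I : FractionalIdeal (𝓞 F)⁰ F) :
    ((mapFractionalIdeal g I : FractionalIdeal (𝓞 F)⁰ F) : Submodule (𝓞 F) F) =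
      Submodule.span (𝓞 F) (g '' I) := by
  simp [mapFractionalIdeal, isLocalization_map_eq]

theorem mapFractionalIdeal_id (I : FractionalIdeal (𝓞 F)⁰ F) :
    mapFractionalIdeal (RingHom.id F) I = I := by
  apply FractionalIdeal.coeToSubmodule_injective
  beta_reduce
  rw [mapFractionalIdeal_coe]
  simp only [RingHom.id_apply, Set.image_id']
  exact Submodule.span_eq _

theorem mapFractionalIdeal_comp (g h : F →+* F) (I : FractionalIdeal (𝓞 F)⁰ F) :
    mapFractionalIdeal (g.comp h) I = mapFractionalIdeal g (mapFractionalIdeal h I) :=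
  (FractionalIdeal.extended_extended (A := 𝓞 F) (K := F) F (le_comap_mapRingHom h) I
    (le_comap_mapRingHom g)).symm

theorem mapFractionalIdeal_spanSingleton (g : F →+* F) (x : F) :
    mapFractionalIdeal g (FractionalIdeal.spanSingleton (𝓞 F)⁰ x) =
      FractionalIdeal.spanSingleton (𝓞 F)⁰ (g x) := by
  refine (FractionalIdeal.extended_spanSingleton F (le_comap_mapRingHom g) x).trans ?_
  rw [isLocalization_map_eq]

theorem absNorm_map (g : F ≃ₐ[K] F) (I : FractionalIdeal (𝓞 F)⁰ F) :
    FractionalIdeal.absNorm (mapFractionalIdeal (g : F →+* F) I) = FractionalIdeal.absNorm I := by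
  have h := FractionalIdeal.den_mul_self_eq_num' (𝓞 F)⁰ F I
  have h1 := congrArg FractionalIdeal.absNorm h
  have h2 := congrArg (fun J => FractionalIdeal.absNorm (mapFractionalIdeal (g : F →+* F) J)) h
  have e : mapFractionalIdeal (g : F →+* F) (I.num : FractionalIdeal (𝓞 F)⁰ F) =
      (I.num.map (RingOfIntegers.mapRingHom (g : F →+* F)) : FractionalIdeal (𝓞 F)⁰ F) :=
    FractionalIdeal.extended_coeIdeal_eq_map F (le_comap_mapRingHom _) I.num
  have e2 : Ideal.absNorm (I.num.map (RingOfIntegers.mapRingHom (g : F →+* F))) =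
      Ideal.absNorm I.num := by
    rw [Ideal.absNorm_apply, Ideal.absNorm_apply, Submodule.cardQuot_apply,
      Submodule.cardQuot_apply]
    exact (Nat.card_congr (Ideal.quotientEquiv I.num _
      (RingOfIntegers.mapRingEquiv (g : F ≃+* F)) rfl).toEquiv).symm
  have e3 : Algebra.norm ℚ (g (algebraMap (𝓞 F) F I.den)) =
      Algebra.norm ℚ (algebraMap (𝓞 F) F I.den) :=
    Algebra.norm_eq_of_algEquiv (g : F ≃+* F).toRatAlgEquiv _
  simp only [map_mul, e, FractionalIdeal.coeIdeal_absNorm, e2, mapFractionalIdeal_spanSingleton,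
    FractionalIdeal.absNorm_span_singleton, RingHom.coe_coe, e3] at h1 h2
  refine mul_left_cancel₀ ?_ (h2.trans h1.symm)
  simp [Algebra.norm_eq_zero_iff]

instance idealGroupAction : MulDistribMulAction Gal(F/K) (IdealGroup F) where
  smul g := Units.map (mapFractionalIdeal (g : F →+* F) :
    FractionalIdeal (𝓞 F)⁰ F →* FractionalIdeal (𝓞 F)⁰ F)
  one_smul I := Units.ext (mapFractionalIdeal_id (I : FractionalIdeal (𝓞 F)⁰ F))
  mul_smul g h I := Units.ext
    (mapFractionalIdeal_comp (g : F →+* F) (h : F →+* F) (I : FractionalIdeal (𝓞 F)⁰ F))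
  smul_mul g I J := map_mul (Units.map (mapFractionalIdeal (g : F →+* F) :
    FractionalIdeal (𝓞 F)⁰ F →* FractionalIdeal (𝓞 F)⁰ F)) I J
  smul_one g := map_one (Units.map (mapFractionalIdeal (g : F →+* F) :
    FractionalIdeal (𝓞 F)⁰ F →* FractionalIdeal (𝓞 F)⁰ F))

/-- The action of `g` on a fractional ideal `I` is `g • I = {g x | x ∈ I}`. -/
theorem mem_smul_idealGroup (g : Gal(F/K)) (I : IdealGroup F) (x : F) :
    x ∈ ((g • I : IdealGroup F) : FractionalIdeal (𝓞 F)⁰ F) ↔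
      ∃ y ∈ (I : FractionalIdeal (𝓞 F)⁰ F), g y = x := by
  change x ∈ ((mapFractionalIdeal (g : F →+* F) I : FractionalIdeal (𝓞 F)⁰ F) :
    Submodule (𝓞 F) F) ↔ _
  rw [mapFractionalIdeal_coe]
  constructor
  · intro hx
    induction hx using Submodule.span_induction with
    | mem x h => exact h
    | zero =>
      exact ⟨0, Submodule.zero_mem (I : FractionalIdeal (𝓞 F)⁰ F).coeToSubmodule, map_zero g⟩
    | add x y _ _ hx hy =>
      obtain ⟨a, ha, rfl⟩ := hx
      obtain ⟨b, hb, rfl⟩ := hy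
      exact ⟨a + b, Submodule.add_mem (I : FractionalIdeal (𝓞 F)⁰ F).coeToSubmodule ha hb,
        map_add g a b⟩
    | smul r x _ hx =>
      obtain ⟨a, ha, rfl⟩ := hx
      refine ⟨(RingOfIntegers.mapRingEquiv (g : F ≃+* F)).symm r • a,
        Submodule.smul_mem (I : FractionalIdeal (𝓞 F)⁰ F).coeToSubmodule _ ha, ?_⟩
      rw [Algebra.smul_def, map_mul, Algebra.smul_def]
      congr 1
      exact g.apply_symm_apply (r : F)
  · rintro ⟨y, hy, rfl⟩
    exact Submodule.subset_span ⟨y, hy, rfl⟩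

/-! #### The algebra `F_ℝ` -/

variable (F) in
/-- The étale `ℝ`-algebra `F_ℝ = ℝ ⊗ F`. -/
def FR : Type u := ℝ ⊗[ℚ] F

instance commRingFR : CommRing (FR F) := inferInstanceAs (CommRing (ℝ ⊗[ℚ] F))
instance algebraFR : Algebra ℝ (FR F) := inferInstanceAs (Algebra ℝ (ℝ ⊗[ℚ] F))

/-- The topology of `F_ℝ` as a finite-dimensional real vector space. -/
instance topologyFR : TopologicalSpace (FR F) := moduleTopology ℝ (FR F)

instance isModuleTopologyFR : IsModuleTopology ℝ (FR F) := ⟨rfl⟩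

instance continuousAddFR : ContinuousAdd (FR F) := IsModuleTopology.toContinuousAdd ℝ (FR F)

variable (F) in
/-- The canonical embedding `F → F_ℝ`. -/
def toFR : F →+* FR F := (Algebra.TensorProduct.includeRight : F →ₐ[ℚ] ℝ ⊗[ℚ] F).toRingHom

/-- The automorphism of `F_ℝ = ℝ ⊗ F` induced by an automorphism of `F`. -/
def mapFR (g : F ≃ₐ[K] F) : FR F ≃ₐ[ℝ] FR F :=
  (Algebra.TensorProduct.congr (AlgEquiv.refl : ℝ ≃ₐ[ℝ] ℝ) (g : F ≃+* F).toRatAlgEquiv :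
    ℝ ⊗[ℚ] F ≃ₐ[ℝ] ℝ ⊗[ℚ] F)

theorem mapFR_toFR (g : F ≃ₐ[K] F) (x : F) : mapFR K g (toFR F x) = toFR F (g x) := by
  change Algebra.TensorProduct.congr (AlgEquiv.refl : ℝ ≃ₐ[ℝ] ℝ) (g : F ≃+* F).toRatAlgEquiv
    ((1 : ℝ) ⊗ₜ[ℚ] x) = 1 ⊗ₜ g x
  simp

theorem FR_hom_ext {f g : FR F →ₐ[ℝ] FR F} (h : ∀ x, f (toFR F x) = g (toFR F x)) : f = g := by
  have : ∀ f g : ℝ ⊗[ℚ] F →ₐ[ℝ] ℝ ⊗[ℚ] F, (∀ x : F, f (1 ⊗ₜ x) = g (1 ⊗ₜ x)) → f = g :=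
    fun f g h => Algebra.TensorProduct.ext (by ext) (AlgHom.ext h)
  exact this f g h

theorem mapFR_one (x : FR F) : mapFR K (1 : F ≃ₐ[K] F) x = x := by
  have : (mapFR K (1 : F ≃ₐ[K] F) : FR F →ₐ[ℝ] FR F) = AlgHom.id ℝ (FR F) :=
    FR_hom_ext fun x => mapFR_toFR K 1 x
  exact DFunLike.congr_fun this x

theorem mapFR_mul (g h : F ≃ₐ[K] F) (x : FR F) : mapFR K (g * h) x = mapFR K g (mapFR K h x) := by
  have : (mapFR K (g * h) : FR F →ₐ[ℝ] FR F) =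
      (mapFR K g : FR F →ₐ[ℝ] FR F).comp (mapFR K h : FR F →ₐ[ℝ] FR F) :=
    FR_hom_ext fun x => by
      change mapFR K (g * h) (toFR F x) = mapFR K g (mapFR K h (toFR F x))
      rw [mapFR_toFR, mapFR_toFR, mapFR_toFR]
      rfl
  exact DFunLike.congr_fun this x

instance unitsFRAction : MulDistribMulAction Gal(F/K) (FR F)ˣ where
  smul g := Units.map (mapFR K g : FR F →* FR F)
  one_smul u := Units.ext (mapFR_one K (u : FR F))
  mul_smul g h u := Units.ext (mapFR_mul K g h (u : FR F))
  smul_mul g u v := map_mul (Units.map (mapFR K g : FR F →* FR F)) u v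
  smul_one g := map_one (Units.map (mapFR K g : FR F →* FR F))

instance unitsFRContinuous : ContinuousConstSMul Gal(F/K) (FR F)ˣ where
  continuous_const_smul g := Continuous.units_map (mapFR K g : FR F →* FR F)
    (IsModuleTopology.continuous_of_linearMap (mapFR K g).toLinearMap)

variable (F) in
/-- The maximal compact subgroup of `F_ℝˣ = ∏_w F_wˣ`: the elements all of whose components
`u_w` have absolute value `1` (so `u_w = ±1` for `w` real, and `u_w` is in the circle group for `w`
complex). -/
def compactUnits : Subgroup (FR F)ˣ where
  carrier := {u | ∀ φ : FR F →ₐ[ℝ] ℂ, ‖φ (u : FR F)‖ = 1}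
  one_mem' φ := by simp
  mul_mem' {u v} hu hv φ := by simp [hu φ, hv φ]
  inv_mem' {u} hu φ := by
    have h : φ (u⁻¹ : (FR F)ˣ) * φ u = 1 := by rw [← map_mul, Units.inv_mul, map_one]
    simpa only [norm_mul, hu φ, mul_one, norm_one] using congrArg norm h

/-! #### Arakelov class groups -/

variable (F) in
/-- The fibre product of `Id_F` and `F_ℝˣ` over `ℝ_{>0}` with respect to the ideal norm and the
absolute value of the algebra norm. -/
def fibreProduct : Subgroup (IdealGroup F × (FR F)ˣ) where
  carrier := {x | ((FractionalIdeal.absNorm (x.1 : FractionalIdeal (𝓞 F)⁰ F) : ℚ) : ℝ) =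
    |Algebra.norm ℝ (x.2 : FR F)|}
  one_mem' := by simp
  mul_mem' {x y} hx hy := by
    simp only [Set.mem_ofPred_eq] at hx hy
    simp [hx, hy, abs_mul]
  inv_mem' {x} hx := by
    simp only [Set.mem_ofPred_eq] at hx ⊢
    have h1 : FractionalIdeal.absNorm (x.1 : FractionalIdeal (𝓞 F)⁰ F) *
        FractionalIdeal.absNorm ((x.1⁻¹ : IdealGroup F) : FractionalIdeal (𝓞 F)⁰ F) = 1 := by
      rw [← map_mul, Units.mul_inv, map_one]
    have h2 : Algebra.norm ℝ (x.2 : FR F) * Algebra.norm ℝ ((x.2⁻¹ : (FR F)ˣ) : FR F) = 1 := by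
      rw [← map_mul, Units.mul_inv, map_one]
    have h1' := congrArg (fun q : ℚ => (q : ℝ)) h1
    have h2' := congrArg abs h2
    simp only [Rat.cast_mul, Rat.cast_one, hx] at h1'
    rw [abs_mul, abs_one] at h2'
    exact mul_left_cancel₀ (left_ne_zero_of_mul_eq_one h2') (h1'.trans h2'.symm)

theorem fibreProduct_stable (g : Gal(F/K)) (x : IdealGroup F × (FR F)ˣ)
    (hx : x ∈ fibreProduct F) : g • x ∈ fibreProduct F := by
  change ((FractionalIdeal.absNorm (mapFractionalIdeal (g : F →+* F) x.1) : ℚ) : ℝ) =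
    |Algebra.norm ℝ (mapFR K g (x.2 : FR F))|
  rw [absNorm_map, Algebra.norm_eq_of_algEquiv]
  exact hx

instance fibreProductAction : MulDistribMulAction Gal(F/K) (fibreProduct F) :=
  subgroupAction (fibreProduct F) (fibreProduct_stable K)

instance prodContinuous : ContinuousConstSMul Gal(F/K) (IdealGroup F × (FR F)ˣ) where
  continuous_const_smul g := Continuous.prodMap (f := fun I : IdealGroup F => g • I)
    (g := fun u : (FR F)ˣ => g • u) continuous_of_discreteTopology (continuous_const_smul g)

instance fibreProductContinuous : ContinuousConstSMul Gal(F/K) (fibreProduct F) :=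
  subgroupAction_continuous (fibreProduct F) (fibreProduct_stable K)

theorem norm_toFR (x : F) : Algebra.norm ℝ (toFR F x) = algebraMap ℚ ℝ (Algebra.norm ℚ x) := by
  rw [Algebra.norm_apply ℚ, ← LinearMap.det_baseChange]
  change LinearMap.det (Algebra.lmul ℝ (ℝ ⊗[ℚ] F) ((1 : ℝ) ⊗ₜ[ℚ] x)) = _
  rw [Algebra.baseChange_lmul]

theorem absNorm_eq_abs_norm (α : Fˣ) :
    (toPrincipalIdeal (𝓞 F) F α, Units.map (toFR F : F →* FR F) α) ∈ fibreProduct F := by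
  change ((FractionalIdeal.absNorm (toPrincipalIdeal (𝓞 F) F α : FractionalIdeal (𝓞 F)⁰ F) : ℚ) :
    ℝ) = |Algebra.norm ℝ (toFR F α)|
  have h : Algebra.norm ℝ (toFR F α) = algebraMap ℚ ℝ (Algebra.norm ℚ (α : F)) :=
    norm_toFR (α : F)
  rw [coe_toPrincipalIdeal, FractionalIdeal.absNorm_span_singleton, h]
  simp

variable (F) in
/-- The homomorphism `Fˣ → Id_F ×_{ℝ_{>0}} F_ℝˣ`, `α ↦ (α 𝓞_F, α)`. -/
def principal : Fˣ →* fibreProduct F :=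
  ((toPrincipalIdeal (𝓞 F) F).prod (Units.map (toFR F : F →* FR F))).codRestrict (fibreProduct F)
    absNorm_eq_abs_norm

theorem principal_stable (g : Gal(F/K)) (x : fibreProduct F)
    (hx : x ∈ (principal F).range) : g • x ∈ (principal F).range := by
  obtain ⟨α, rfl⟩ := hx
  refine ⟨g • α, Subtype.ext (Prod.ext (Units.ext ?_) (Units.ext ?_))⟩
  · change ((toPrincipalIdeal (𝓞 F) F (g • α) : IdealGroup F) : FractionalIdeal (𝓞 F)⁰ F) =
      mapFractionalIdeal (g : F →+* F) (toPrincipalIdeal (𝓞 F) F α : IdealGroup F)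
    rw [coe_toPrincipalIdeal, coe_toPrincipalIdeal, mapFractionalIdeal_spanSingleton]
    rfl
  · exact (mapFR_toFR K g α).symm

variable (F) in
/-- The oriented Arakelov class group of `F`: the cokernel of
`Fˣ → Id_F ×_{ℝ_{>0}} F_ℝˣ`, with the quotient topology. -/
def PicTilde : Type u := fibreProduct F ⧸ (principal F).range

instance commGroupPicTilde : CommGroup (PicTilde F) := inferInstanceAs (CommGroup (_ ⧸ (principal F).range))

instance topologyPicTilde : TopologicalSpace (PicTilde F) :=
  inferInstanceAs (TopologicalSpace (_ ⧸ (principal F).range))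

instance picTildeAction : MulDistribMulAction Gal(F/K) (PicTilde F) :=
  quotientAction (principal F).range (principal_stable K)

instance picTildeContinuous : ContinuousConstSMul Gal(F/K) (PicTilde F) :=
  quotientAction_continuous (principal F).range (principal_stable K)

variable (F) in
/-- The image of `{1} × (maximal compact subgroup of F_ℝˣ)` in the oriented Arakelov class
group. -/
def compactImage : Subgroup (PicTilde F) :=
  (((⊥ : Subgroup (IdealGroup F)).prod (compactUnits F)).subgroupOf (fibreProduct F)).map
    (QuotientGroup.mk' (principal F).range)

theorem compactImage_stable (g : Gal(F/K)) (x : PicTilde F) (hx : x ∈ compactImage F) :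
    g • x ∈ compactImage F := by
  obtain ⟨y, ⟨h1, h2⟩, rfl⟩ := hx
  refine ⟨g • y, ⟨?_, fun φ => h2 (φ.comp (mapFR K g : FR F →ₐ[ℝ] FR F))⟩, rfl⟩
  have h1' : (y : IdealGroup F × (FR F)ˣ).1 = 1 := h1
  change g • (y : IdealGroup F × (FR F)ˣ).1 = 1
  rw [h1', smul_one]

variable (F) in
/-- The Arakelov class group of `F`: the quotient of the oriented Arakelov class group by the
image of the maximal compact subgroup of `F_ℝˣ`, with the quotient topology. -/
def Pic0 : Type u := PicTilde F ⧸ compactImage F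

instance commGroupPic0 : CommGroup (Pic0 F) := inferInstanceAs (CommGroup (_ ⧸ compactImage F))

instance topologyPic0 : TopologicalSpace (Pic0 F) := inferInstanceAs (TopologicalSpace (_ ⧸ compactImage F))

instance pic0Action : MulDistribMulAction Gal(F/K) (Pic0 F) :=
  quotientAction (compactImage F) (compactImage_stable K)

instance pic0Continuous : ContinuousConstSMul Gal(F/K) (Pic0 F) :=
  quotientAction_continuous (compactImage F) (compactImage_stable K)

/-! #### The Galois modules -/

variable (F)

/-- The group ring `ℤ[G]` of `G = Gal(F/K)`. -/
abbrev GalRing : Type u := MonoidAlgebra ℤ Gal(F/K)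

/-- The `ℤ[G]`-module `Ãr_F`, the Pontryagin dual of the oriented Arakelov class group. -/
abbrev ArTilde : Type u :=
  (Representation.ofMulDistribMulAction Gal(F/K) (PontryaginDual (PicTilde F))).asModule

/-- The `ℤ[G]`-module `Ar_F`, the Pontryagin dual of the Arakelov class group. -/
abbrev Ar : Type u :=
  (Representation.ofMulDistribMulAction Gal(F/K) (PontryaginDual (Pic0 F))).asModule

/-- The trivial `ℤ[G]`-module `ℤ`. -/
abbrev TrivialModule : Type u := (Representation.trivial ℤ Gal(F/K) (ULift.{u} ℤ)).asModule

/-- The permutation `ℤ[G]`-module `ℤ[S_∞]` on the set of Archimedean places of `F`. -/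
abbrev PlacesModule : Type u :=
  (Representation.ofMulAction ℤ Gal(F/K) (InfinitePlace F)).asModule

theorem torsion_stable (K : Type v) (F : Type u) [Field K] [Field F] [Algebra K F]
    (g : Gal(F/K)) (x : Fˣ) (hx : x ∈ CommGroup.torsion Fˣ) :
    g • x ∈ CommGroup.torsion Fˣ :=
  (MulDistribMulAction.toMonoidHom Fˣ g).isOfFinOrder hx

instance rootsOfUnityAction : MulDistribMulAction Gal(F/K) (CommGroup.torsion Fˣ) :=
  subgroupAction (CommGroup.torsion Fˣ) (torsion_stable K F)

/-- The `ℤ[G]`-module `μ_F` of roots of unity in `F`. -/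
abbrev RootsOfUnityModule : Type u :=
  (Representation.ofMulDistribMulAction Gal(F/K) (CommGroup.torsion Fˣ)).asModule

instance finite_rootsOfUnity : Finite (CommGroup.torsion Fˣ) := by
  refine Finite.of_surjective
    (fun x : NumberField.Units.torsion F =>
      (⟨Units.map (algebraMap (𝓞 F) F : 𝓞 F →* F) x,
        (Units.map (algebraMap (𝓞 F) F : 𝓞 F →* F)).isOfFinOrder x.2⟩ :
        CommGroup.torsion Fˣ)) ?_
  rintro ⟨x, hx⟩
  obtain ⟨n, hn, hxn⟩ := isOfFinOrder_iff_pow_eq_one.1 hx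
  have hint : ∀ y : Fˣ, y ^ n = 1 → IsIntegral ℤ (y : F) := fun y hy =>
    IsIntegral.of_pow hn (by rw [← Units.val_pow_eq_pow_val, hy]; exact isIntegral_one)
  let y : (𝓞 F)ˣ :=
    { val := ⟨x, hint x hxn⟩
      inv := ⟨(x⁻¹ : Fˣ), hint x⁻¹ (by rw [inv_pow, hxn, inv_one])⟩
      val_inv := RingOfIntegers.ext (Units.mul_inv x)
      inv_val := RingOfIntegers.ext (Units.inv_mul x) }
  have hy : y ∈ NumberField.Units.torsion F :=
    isOfFinOrder_iff_pow_eq_one.2 ⟨n, hn, Units.ext (RingOfIntegers.ext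
      (congrArg (fun z : Fˣ => (z : F)) hxn))⟩
  exact ⟨⟨y, hy⟩, Subtype.ext (Units.ext rfl)⟩

instance finite_trivialModule : Module.Finite (GalRing K F) (TrivialModule K F) :=
  finite_of_finite_int _ (inferInstanceAs (Module.Finite ℤ (ULift.{u} ℤ)))

instance finite_placesModule : Module.Finite (GalRing K F) (PlacesModule K F) :=
  finite_of_finite_int _ (inferInstanceAs (Module.Finite ℤ (MonoidAlgebra ℤ (InfinitePlace F))))

instance finite_rootsOfUnityModule : Module.Finite (GalRing K F) (RootsOfUnityModule K F) :=
  finite_of_finite_int _ (inferInstanceAs (Module.Finite ℤ (Additive (CommGroup.torsion Fˣ))))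

end Arithmetic

end Arakelov

end

universe w

noncomputable section

namespace Arakelov

open Function

/-! ### Additivity of classes in the Grothendieck groups -/

section Tools

variable {Λ : Type u} [Ring Λ]

/-! The equivalence of (a) and (b) holds because the two differences are the same element of
G₀(ℤ[G]) (`cls_arTilde_sub`). Dualising the passage from the oriented class group to the Arakelov
class group gives an exact sequence 0 → Ar → Ãr → C → μ^∨ → 0, where C is the dual of the maximal
compact subgroup of F_ℝˣ and μ^∨ is the group of circle-valued characters of μ_F (`cls_arTilde`).
Exactness at C is the substantial point: a character of the compact units that is trivial on roots
of unity is a product of phases, hence makes sense on all of F_ℝˣ. By Dirichlet's unit theorem it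
can be corrected by a character exp(iℓ(log|u|)) so as to become trivial on all global units, and it
then extends to the oriented class group because the circle is divisible.

The module C is generated by the phases at the embeddings F → ℂ, and its relations come from the
places: 0 → ℤ[S_∞] → ℤ[Hom(F,ℂ)] → C → 0. The middle term is free of rank d, because G acts simply
transitively on the extensions of each embedding of K (`cls_compactDual`). Finally σ[μ_F] = -[μ^∨],
since dualising a lattice resolution of a finite module M turns M into Ext¹(M,ℤ) ≅ Hom(M,ℝ/ℤ), with
a shift of degree (`sigma_cls_of_finite`). Substituting these relations identifies the two
differences.

For the torsion statement it is enough to treat Ar. On units of norm ±1 a character of Pic⁰ is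
exp(iℓ(log|u|)) for a linear functional ℓ. Together with one extra copy of ℤ, which fills up the
direction transverse to the trace-zero hyperplane, this maps Ar × ℤ into the dual of ℝ^{S_∞}. The
kernel is finite because the class group is finite. The image is the lattice dual to the logarithms
of fundamental units and the degree vector, up to 2π, so it has the same character as ℤ[S_∞]. This
also proves finite generation.

It remains to see that finite modules have torsion class (`cls_mem_torsion_of_finite`), from which
lattices with equal characters differ by torsion (`cls_sub_cls_mem_torsion`). By dévissage the
finite module M may be assumed to be killed by a prime p. Then [Hom(X,M)] depends only on the
character of the lattice X (`homClass_eq_zero`), so Artin induction for the trivial character writes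
|G|[M] as a combination of classes [Hom(ℤ[G/C],M)] with C cyclic. These are coinduced from C. Over a
cyclic group a finite simple module is a residue field of some ℤ[ζ_m], whose class is torsion
because the class group of ℤ[ζ_m] is finite. -/

theorem G0.cls_subsingleton (M : Type u) [AddCommGroup M] [Module Λ M] [Module.Finite Λ M]
    [Subsingleton M] : G0.cls Λ M = 0 := by
  have := G0.cls_add (LinearMap.id : M →ₗ[Λ] M) (LinearMap.id : M →ₗ[Λ] M) injective_id
    (fun y => ⟨fun _ => ⟨y, rfl⟩, fun _ => Subsingleton.elim _ _⟩) surjective_id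
  simpa using this

theorem G0.cls_congr {M N : Type u} [AddCommGroup M] [Module Λ M] [Module.Finite Λ M]
    [AddCommGroup N] [Module Λ N] [Module.Finite Λ N] (e : M ≃ₗ[Λ] N) :
    G0.cls Λ M = G0.cls Λ N := by
  have h0 := G0.cls_subsingleton (Λ := Λ) PUnit.{u + 1}
  have := G0.cls_add (e : M →ₗ[Λ] N) (0 : N →ₗ[Λ] PUnit.{u + 1}) e.injective
    (fun y => ⟨fun _ => e.surjective y, fun _ => rfl⟩) (fun y => ⟨0, rfl⟩)
  rwa [h0, add_zero] at this

theorem G0.cls_submodule {M : Type u} [AddCommGroup M] [Module Λ M] [Module.Finite Λ M]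
    (N : Submodule Λ M) [Module.Finite Λ N] :
    G0.cls Λ N + G0.cls Λ (M ⧸ N) = G0.cls Λ M :=
  G0.cls_add N.subtype N.mkQ N.injective_subtype
    (LinearMap.exact_subtype_mkQ N) N.mkQ_surjective

theorem G0.cls_ker_range {M N : Type u} [AddCommGroup M] [Module Λ M] [Module.Finite Λ M]
    [AddCommGroup N] [Module Λ N] (f : M →ₗ[Λ] N) [Module.Finite Λ (LinearMap.ker f)]
    [Module.Finite Λ (LinearMap.range f)] :
    G0.cls Λ (LinearMap.ker f) + G0.cls Λ (LinearMap.range f) = G0.cls Λ M := by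
  rw [← G0.cls_submodule (LinearMap.ker f), G0.cls_congr f.quotKerEquivRange]

theorem G0.cls_prod (M N : Type u) [AddCommGroup M] [Module Λ M] [Module.Finite Λ M]
    [AddCommGroup N] [Module Λ N] [Module.Finite Λ N] :
    G0.cls Λ (M × N) = G0.cls Λ M + G0.cls Λ N :=
  (G0.cls_add (LinearMap.inl Λ M N) (LinearMap.snd Λ M N) LinearMap.inl_injective
    Function.Exact.inl_snd LinearMap.snd_surjective).symm

theorem G0.cls_pi_fin (M : Type u) [AddCommGroup M] [Module Λ M] [Module.Finite Λ M] (n : ℕ) :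
    G0.cls Λ (Fin n → M) = n • G0.cls Λ M := by
  induction n with
  | zero => rw [G0.cls_subsingleton, zero_smul]
  | succ n ih =>
    rw [← G0.cls_congr (Fin.consLinearEquiv Λ fun _ : Fin (n + 1) => M), G0.cls_prod, ih, succ_nsmul,
      add_comm]

theorem G0.cls_pi (ι : Type*) [Finite ι] (M : Type u) [AddCommGroup M] [Module Λ M]
    [Module.Finite Λ M] (L : Type u) [AddCommGroup L] [Module Λ L] [Module.Finite Λ L]
    (e : L ≃ₗ[Λ] (ι → M)) :
    G0.cls Λ L = Nat.card ι • G0.cls Λ M := by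
  rw [← G0.cls_pi_fin]
  exact G0.cls_congr (e.trans (LinearEquiv.funCongrLeft Λ M (Finite.equivFin ι).symm))

theorem G0Lat.cls_prod (M N : Type u) [AddCommGroup M] [Module Λ M] [Module.Finite Λ M]
    [Module.Projective ℤ M] [AddCommGroup N] [Module Λ N] [Module.Finite Λ N]
    [Module.Projective ℤ N] :
    G0Lat.cls Λ (M × N) = G0Lat.cls Λ M + G0Lat.cls Λ N :=
  (G0Lat.cls_add (LinearMap.inl Λ M N) (LinearMap.snd Λ M N) LinearMap.inl_injective
    Function.Exact.inl_snd LinearMap.snd_surjective).symm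

/-- Direct sums gather the positive generators into one lattice and the negative ones into another.
Identities in the group can thus be tested on pairs of actual lattices. -/
theorem G0Lat.exists_eq_sub (x : G0Lat Λ) : ∃ (M N : Type u) (_ : AddCommGroup M)
    (_ : Module Λ M) (_ : Module.Finite Λ M) (_ : Module.Projective ℤ M) (_ : AddCommGroup N)
    (_ : Module Λ N) (_ : Module.Finite Λ N) (_ : Module.Projective ℤ N),
    x = G0Lat.cls Λ M - G0Lat.cls Λ N := by
  induction x using QuotientAddGroup.induction_on with
  | H x =>
    induction x using FreeAbelianGroup.induction_on with
    | zero => exact ⟨PUnit, PUnit, _, _, inferInstance, inferInstance, _, _, inferInstance,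
        inferInstance, by rw [sub_self]; rfl⟩
    | of M => exact ⟨M.obj, PUnit, _, _, M.property.1, M.property.2, _, _, inferInstance,
        inferInstance, by rw [G0Lat.cls_punit, sub_zero]; rfl⟩
    | neg M _ => exact ⟨PUnit, M.obj, _, _, inferInstance, inferInstance, _, _, M.property.1,
        M.property.2, by rw [G0Lat.cls_punit, zero_sub]; rfl⟩
    | add x y hx hy =>
      obtain ⟨M, N, _, _, _, _, _, _, _, _, h⟩ := hx
      obtain ⟨M', N', _, _, _, _, _, _, _, _, h'⟩ := hy
      refine ⟨M × M', N × N', _, _, inferInstance, inferInstance, _, _, inferInstance,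
        inferInstance, ?_⟩
      rw [G0Lat.cls_prod, G0Lat.cls_prod, add_sub_add_comm, ← h, ← h']
      rfl

end Tools

/-! ### Equivariant maps over ℤ[G] -/

section GroupRing

variable {G : Type u} [Group G]

/-- An additive map commuting with the action of `G` is `ℤ[G]`-linear. -/
def equivariantHom {M : Type v} {N : Type w} [AddCommGroup M] [Module (MonoidAlgebra ℤ G) M] [AddCommGroup N]
    [Module (MonoidAlgebra ℤ G) N] (f : M →+ N)
    (h : ∀ (g : G) (m : M), f (MonoidAlgebra.single g (1 : ℤ) • m) = MonoidAlgebra.single g (1 : ℤ) • f m) :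
    M →ₗ[MonoidAlgebra ℤ G] N :=
  MonoidAlgebra.equivariantOfLinearOfComm f.toIntLinearMap h

theorem asModule_smul {V : Type v} [AddCommGroup V] (ρ : Representation ℤ G V) (g : G)
    (x : ρ.asModule) :
    MonoidAlgebra.single g (1 : ℤ) • x = ρ.asModuleEquiv.symm (ρ g (ρ.asModuleEquiv x)) := by
  rw [Representation.single_smul, one_smul]
  rfl

end GroupRing

/-! ### Traces of endomorphisms of free ℤ-modules -/

section Traces

open scoped TensorProduct

/-- An endomorphism `T` with `T ^ 2 = n T` has nonzero trace unless it vanishes. -/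
theorem trace_ne_zero_of_mul_self {H : Type*} [AddCommGroup H] [Module.Free ℤ H] [Module.Finite ℤ H]
    (T : Module.End ℤ H) (n : ℤ) (hn : n ≠ 0) (h : T * T = n • T) (hT : T ≠ 0) :
    LinearMap.trace ℤ H T ≠ 0 := by
  intro h0
  apply hT
  let b := Module.Free.chooseBasis ℤ H
  -- Over ℚ the operator T/n is idempotent, and the trace of an idempotent in characteristic zero is
  -- its rank.
  let e : Module.End ℚ (TensorProduct ℤ ℚ H) := (n : ℚ)⁻¹ • T.baseChange ℚ
  have hn' : (n : ℚ) ≠ 0 := by exact_mod_cast hn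
  have he : IsIdempotentElem e := by
    have h1 : T.baseChange ℚ * T.baseChange ℚ = (n : ℚ) • T.baseChange ℚ := by
      rw [← LinearMap.baseChange_mul, h, LinearMap.baseChange_smul]
      exact (Int.cast_smul_eq_zsmul ℚ n (T.baseChange ℚ)).symm
    change ((n : ℚ)⁻¹ • T.baseChange ℚ) * ((n : ℚ)⁻¹ • T.baseChange ℚ) = (n : ℚ)⁻¹ • T.baseChange ℚ
    rw [smul_mul_smul_comm, h1, smul_smul, mul_assoc, inv_mul_cancel₀ hn', mul_one]
  have h2 : LinearMap.trace ℚ _ e = 0 := by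
    simp only [e, map_smul, LinearMap.trace_baseChange, h0, map_zero, smul_zero]
  have h3 : T.baseChange ℚ = 0 := by
    have := (LinearMap.IsIdempotentElem.trace_eq_zero_iff he).1 h2
    exact (smul_eq_zero.1 this).resolve_left (inv_ne_zero hn')
  -- The integral matrix of T has the same entries as that of its base change, so it vanishes too.
  apply (LinearMap.toMatrix b b).injective
  ext i j
  have h4 := LinearMap.toMatrix_baseChange ℚ T b b
  rw [h3, map_zero] at h4
  have := congrFun (congrFun h4 i) j
  simp only [Matrix.zero_apply, Matrix.map_apply] at this
  simpa using this.symm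

/-- Under X* ⊗ Y ≅ Hom(X, Y) the operator φ ↦ bφa corresponds to aᵗ ⊗ b, and traces are
multiplicative on tensor products and invariant under transposition. -/
theorem trace_comp_left_right {X Y : Type*} [AddCommGroup X] [Module.Free ℤ X]
    [Module.Finite ℤ X] [AddCommGroup Y] [Module.Free ℤ Y] [Module.Finite ℤ Y]
    (a : X →ₗ[ℤ] X) (b : Y →ₗ[ℤ] Y) (T : (X →ₗ[ℤ] Y) →ₗ[ℤ] (X →ₗ[ℤ] Y))
    (hT : ∀ φ, T φ = b ∘ₗ φ ∘ₗ a) :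
    LinearMap.trace ℤ _ T = LinearMap.trace ℤ X a * LinearMap.trace ℤ Y b := by
  have h : T = (dualTensorHomEquiv ℤ X Y).conj
      (TensorProduct.map (Module.Dual.transpose (R := ℤ) a) b) := by
    rw [← LinearEquiv.symm_apply_eq]
    apply TensorProduct.ext'
    intro φ y
    change (dualTensorHomEquiv ℤ X Y).symm (T (dualTensorHomEquiv ℤ X Y (φ ⊗ₜ[ℤ] y))) = _
    rw [LinearEquiv.symm_apply_eq, hT]
    ext x
    simp [Module.Dual.transpose_apply]
  rw [h, LinearMap.trace_conj', LinearMap.trace_tensorProduct', LinearMap.trace_transpose']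

/-- The sequence splits over ℤ, though not compatibly with the endomorphisms. A section s of g and a
retraction r of f decompose b into two terms, whose traces are found by cyclicity. -/
theorem trace_exact {L M N : Type*} [AddCommGroup L] [Module.Free ℤ L] [Module.Finite ℤ L]
    [AddCommGroup M] [Module.Free ℤ M] [Module.Finite ℤ M] [AddCommGroup N] [Module.Free ℤ N]
    [Module.Finite ℤ N] (f : L →ₗ[ℤ] M) (g : M →ₗ[ℤ] N) (hf : Injective f) (hfg : Exact f g)
    (hg : Surjective g) (a : Module.End ℤ L) (b : Module.End ℤ M) (c : Module.End ℤ N)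
    (hab : ∀ x, b (f x) = f (a x)) (hbc : ∀ x, g (b x) = c (g x)) :
    LinearMap.trace ℤ L a + LinearMap.trace ℤ N c = LinearMap.trace ℤ M b := by
  obtain ⟨s, hs⟩ := Module.projective_lifting_property g LinearMap.id hg
  have hs' : ∀ n, g (s n) = n := fun n => LinearMap.congr_fun hs n
  have hr : ∀ m, m - s (g m) ∈ LinearMap.range f := fun m => by
    obtain ⟨y, hy⟩ := (hfg (m - s (g m))).1 (by rw [map_sub, hs', sub_self])
    exact ⟨y, hy⟩
  let e : L ≃ₗ[ℤ] LinearMap.range f := LinearEquiv.ofInjective f hf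
  let r : M →ₗ[ℤ] L := e.symm.toLinearMap.comp
    ((LinearMap.id - s.comp g).codRestrict (LinearMap.range f) hr)
  have hr : ∀ m, f (r m) = m - s (g m) := fun m => by
    have h1 : ((e (r m) : LinearMap.range f) : M) = m - s (g m) := by
      simp only [r, LinearMap.comp_apply, LinearEquiv.coe_coe, LinearEquiv.apply_symm_apply]
      rfl
    rw [← h1]
    rfl
  have hrf : ∀ x, r (f x) = x := fun x => hf (by
    rw [hr, (hfg _).2 ⟨x, rfl⟩, map_zero, sub_zero])
  -- Obtained by applying b to m = f(r m) + s(g m) and using bf = fa.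
  have hb : b = f ∘ₗ (a ∘ₗ r) + (b ∘ₗ s) ∘ₗ g := by
    ext m
    have : m = f (r m) + s (g m) := by rw [hr, sub_add_cancel]
    nth_rewrite 1 [this]
    rw [map_add, hab]
    rfl
  have h1 : (a ∘ₗ r) ∘ₗ f = a := by ext x; simp [hrf]
  have h2 : g ∘ₗ (b ∘ₗ s) = c := by ext x; simp [hbc, hs']
  rw [hb, map_add, LinearMap.trace_comp_comm', h1, LinearMap.trace_comp_comm', h2]

end Traces

/-! ### Characters of lattices and isogenies -/

section Characters

variable {G : Type u} [Group G]

theorem free_of_projective (X : Type*) [AddCommGroup X] [Module.Finite ℤ X]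
    [Module.Projective ℤ X] : Module.Free ℤ X := inferInstance

/-- The character of a `ℤ[G]`-module. -/
def chi (X : Type u) [AddCommGroup X] [Module (MonoidAlgebra ℤ G) X] (g : G) : ℤ :=
  LinearMap.trace ℤ X (groupRep G X g)

theorem chi_exact [Finite G] {L M N : Type u}
    [AddCommGroup L] [Module (MonoidAlgebra ℤ G) L] [Module.Finite (MonoidAlgebra ℤ G) L]
    [Module.Projective ℤ L]
    [AddCommGroup M] [Module (MonoidAlgebra ℤ G) M] [Module.Finite (MonoidAlgebra ℤ G) M]
    [Module.Projective ℤ M]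
    [AddCommGroup N] [Module (MonoidAlgebra ℤ G) N] [Module.Finite (MonoidAlgebra ℤ G) N]
    [Module.Projective ℤ N]
    (f : L →ₗ[MonoidAlgebra ℤ G] M) (g : M →ₗ[MonoidAlgebra ℤ G] N)
    (hf : Injective f) (hfg : Exact f g) (hg : Surjective g) (x : G) :
    chi L x + chi N x = chi M x := by
  have := finite_int (Λ := MonoidAlgebra ℤ G) L
  have := finite_int (Λ := MonoidAlgebra ℤ G) M
  have := finite_int (Λ := MonoidAlgebra ℤ G) N
  have := free_of_projective L
  have := free_of_projective M
  have := free_of_projective N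
  exact trace_exact f.toAddMonoidHom.toIntLinearMap g.toAddMonoidHom.toIntLinearMap hf hfg hg _ _ _
    (fun y => (f.map_smul _ y).symm) (fun y => g.map_smul _ y)

/-- The character, as a homomorphism on the Grothendieck group of lattices. -/
def chiHom [Finite G] (x : G) : G0Lat (MonoidAlgebra ℤ G) →+ ℤ :=
  GrothendieckGroup.lift (fun M => chi M.obj x) fun L M N f g hf hfg hg =>
      haveI : Module.Finite (MonoidAlgebra ℤ G) L.obj := L.property.1
      haveI : Module.Projective ℤ L.obj := L.property.2
      haveI : Module.Finite (MonoidAlgebra ℤ G) M.obj := M.property.1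
      haveI : Module.Projective ℤ M.obj := M.property.2
      haveI : Module.Finite (MonoidAlgebra ℤ G) N.obj := N.property.1
      haveI : Module.Projective ℤ N.obj := N.property.2
      chi_exact f g hf hfg hg x

theorem chiHom_cls [Finite G] (x : G) (M : Type u) [AddCommGroup M] [Module (MonoidAlgebra ℤ G) M]
    [Module.Finite (MonoidAlgebra ℤ G) M] [Module.Projective ℤ M] :
    chiHom x (G0Lat.cls (MonoidAlgebra ℤ G) M) = chi M x :=
  GrothendieckGroup.lift_mk _ _ _

/-- Two modules are isogenous if there are maps between them in both directions whose composites
are multiplication by the same nonzero integer. -/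
def Isogenous {Λ : Type u} [Ring Λ] (X Y : Type u) [AddCommGroup X] [Module Λ X] [AddCommGroup Y]
    [Module Λ Y] : Prop :=
  ∃ (f : X →ₗ[Λ] Y) (h : Y →ₗ[Λ] X) (n : ℕ), n ≠ 0 ∧ (∀ x, h (f x) = n • x) ∧ ∀ y, f (h y) = n • y

/-- Since nY ⊆ f(X) and f is injective, the map f⁻¹ ∘ n is defined on Y. -/
theorem exists_reverse {Λ : Type u} [Ring Λ] {X Y : Type u} [AddCommGroup X] [Module Λ X]
    [AddCommGroup Y] [Module Λ Y] (f : X →ₗ[Λ] Y) (hf : Injective f) (n : ℕ)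
    (hn : ∀ y, n • y ∈ LinearMap.range f) :
    ∃ h : Y →ₗ[Λ] X, (∀ x, h (f x) = n • x) ∧ ∀ y, f (h y) = n • y := by
  let e : X ≃ₗ[Λ] LinearMap.range f := LinearEquiv.ofInjective f hf
  let m : Y →ₗ[Λ] Y := n • LinearMap.id
  let h : Y →ₗ[Λ] X := e.symm.toLinearMap.comp (m.codRestrict (LinearMap.range f) hn)
  have h1 : ∀ y, f (h y) = n • y := fun y => by
    have h1 : ((e (h y) : LinearMap.range f) : Y) = n • y := by
      simp only [h, LinearMap.comp_apply, LinearEquiv.coe_coe, LinearEquiv.apply_symm_apply]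
      rfl
    rw [← h1]
    rfl
  exact ⟨h, fun x => hf (by rw [h1, map_nsmul]), h1⟩

theorem isogenous_of_finite_quotient {Λ : Type u} [Ring Λ] {X Y : Type u} [AddCommGroup X]
    [Module Λ X] [AddCommGroup Y] [Module Λ Y] (f : X →ₗ[Λ] Y) (hf : Injective f)
    [Finite (Y ⧸ LinearMap.range f)] : Isogenous (Λ := Λ) X Y := by
  obtain ⟨h, h1, h2⟩ := exists_reverse f hf (Nat.card (Y ⧸ LinearMap.range f)) fun y => by
    rw [← Submodule.Quotient.mk_eq_zero, Submodule.Quotient.mk_smul]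
    exact card_nsmul_eq_zero'
  exact ⟨f, h, _, Nat.card_pos.ne', h1, h2⟩

/-- By cyclicity tr(h ∘ f ∘ x) = tr(f ∘ x ∘ h). The left side is nχ_X(x) and the right side is
nχ_Y(x), and n ≠ 0. -/
theorem chi_eq_of_isogenous [Finite G] {X Y : Type u}
    [AddCommGroup X] [Module (MonoidAlgebra ℤ G) X] [Module.Finite (MonoidAlgebra ℤ G) X]
    [Module.Projective ℤ X]
    [AddCommGroup Y] [Module (MonoidAlgebra ℤ G) Y] [Module.Finite (MonoidAlgebra ℤ G) Y]
    [Module.Projective ℤ Y] (hXY : Isogenous (Λ := MonoidAlgebra ℤ G) X Y) (x : G) :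
    chi X x = chi Y x := by
  have := finite_int (Λ := MonoidAlgebra ℤ G) X
  have := finite_int (Λ := MonoidAlgebra ℤ G) Y
  have := free_of_projective X
  have := free_of_projective Y
  obtain ⟨f, h, n, hn, hf, hh⟩ := hXY
  let f' : X →ₗ[ℤ] Y := f.toAddMonoidHom.toIntLinearMap
  let h' : Y →ₗ[ℤ] X := h.toAddMonoidHom.toIntLinearMap
  have e1 : h' ∘ₗ (f' ∘ₗ groupRep G X x) = n • groupRep G X x := by
    ext y; exact hf _
  have e2 : (f' ∘ₗ groupRep G X x) ∘ₗ h' = n • groupRep G Y x := by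
    ext y
    change f (MonoidAlgebra.of ℤ G x • h y) = n • (MonoidAlgebra.of ℤ G x • y)
    rw [← map_smul, hh, smul_comm]
  have h3 := LinearMap.trace_comp_comm' h' (f' ∘ₗ groupRep G X x)
  rw [e1, e2, map_nsmul, map_nsmul] at h3
  exact (smul_right_injective ℤ hn h3).symm

/-- The norm operator N = Σ g on Hom(X, Z) has trace Σ χ_X(g⁻¹)χ_Z(g), which sees Z only through its
character. For Z = X it is nonzero, since N(id) = |G|·id, and N² = |G|N then makes its trace
nonzero. Hence N is also nonzero on Hom(X, Y), and every value of N is equivariant. -/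
theorem exists_ne_zero_hom [Finite G] (X Y : Type u)
    [AddCommGroup X] [Module (MonoidAlgebra ℤ G) X] [Module.Finite (MonoidAlgebra ℤ G) X]
    [Module.Projective ℤ X]
    [AddCommGroup Y] [Module (MonoidAlgebra ℤ G) Y] [Module.Finite (MonoidAlgebra ℤ G) Y]
    [Module.Projective ℤ Y] [Nontrivial X] (h : ∀ x : G, chi X x = chi Y x) :
    ∃ f : X →ₗ[MonoidAlgebra ℤ G] Y, f ≠ 0 := by
  have := finite_int (Λ := MonoidAlgebra ℤ G) X
  have := finite_int (Λ := MonoidAlgebra ℤ G) Y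
  have := free_of_projective X
  have := free_of_projective Y
  let _ := Fintype.ofFinite G
  have key : ∀ (Z : Type u) [AddCommGroup Z] [Module (MonoidAlgebra ℤ G) Z]
      [Module.Finite ℤ Z] [Module.Free ℤ Z],
      LinearMap.trace ℤ _ (Representation.linHom (groupRep G X) (groupRep G Z)).norm =
        ∑ g : G, chi X g⁻¹ * chi Z g := fun Z _ _ _ _ => by
    rw [Representation.norm, map_sum]
    exact Finset.sum_congr rfl fun g _ => trace_comp_left_right _ _ _ fun φ =>
      Representation.linHom_apply _ _ g φ
  have h1 : (Representation.linHom (groupRep G X) (groupRep G X)).norm ≠ 0 := by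
    intro h0
    have h1 := LinearMap.congr_fun h0 LinearMap.id
    obtain ⟨x, hx⟩ := exists_ne (0 : X)
    have h2 := LinearMap.congr_fun h1 x
    have h3 : ∀ g : G, (Representation.linHom (groupRep G X) (groupRep G X)) g LinearMap.id x = x :=
      fun g => Representation.self_inv_apply (groupRep G X) g x
    rw [Representation.norm, LinearMap.sum_apply, LinearMap.sum_apply] at h2
    simp only [h3, Finset.sum_const, LinearMap.zero_apply, ← natCast_zsmul] at h2
    exact hx ((smul_eq_zero.1 h2).resolve_left
      (Int.natCast_ne_zero.2 (Finset.card_ne_zero.2 Finset.univ_nonempty)))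
  have h2 := trace_ne_zero_of_mul_self _ (Fintype.card G : ℤ) (by simp) (by
    ext φ : 1
    rw [Module.End.mul_apply]
    nth_rewrite 1 [Representation.norm]
    simp [LinearMap.sum_apply]) h1
  rw [key] at h2
  simp only [h] at h2
  have h3 : (Representation.linHom (groupRep G X) (groupRep G Y)).norm ≠ 0 := by
    intro h0
    have := key Y
    rw [h0, map_zero] at this
    simp only [h] at this
    exact h2 this.symm
  -- Averaging any φ not killed by the norm yields a nonzero equivariant map.
  obtain ⟨φ, hφ⟩ : ∃ φ, (Representation.linHom (groupRep G X) (groupRep G Y)).norm φ ≠ 0 := by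
    by_contra! h0
    exact h3 (LinearMap.ext h0)
  set ψ := (Representation.linHom (groupRep G X) (groupRep G Y)).norm φ with hψ
  have hψ' : ∀ g x, ψ (groupRep G X g x) = groupRep G Y g (ψ x) := fun g x => by
    have h4 := Representation.self_norm_apply
      (Representation.linHom (groupRep G X) (groupRep G Y)) g φ
    rw [← hψ, Representation.linHom_apply] at h4
    have h5 := LinearMap.congr_fun h4 (groupRep G X g x)
    simpa only [LinearMap.comp_apply, Representation.inv_self_apply] using h5.symm
  refine ⟨equivariantHom ψ.toAddMonoidHom hψ', fun h0 => hφ ?_⟩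
  ext x
  exact LinearMap.congr_fun h0 x

end Characters

/-! ### Isogeny-invariant homomorphisms depend only on the character -/

section

variable {G : Type u} [Group G]

/-- The saturation of a submodule: the elements having a nonzero multiple in it. -/
def saturation {Λ : Type u} [Ring Λ] {Y : Type u} [AddCommGroup Y] [Module Λ Y]
    (N : Submodule Λ Y) : Submodule Λ Y where
  carrier := {y | ∃ n : ℤ, n ≠ 0 ∧ n • y ∈ N}
  zero_mem' := ⟨1, one_ne_zero, by simp⟩
  add_mem' := by
    rintro x y ⟨n, hn, hx⟩ ⟨m, hm, hy⟩
    refine ⟨n * m, mul_ne_zero hn hm, ?_⟩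
    rw [smul_add, mul_comm n m, mul_smul, mul_comm m n, mul_smul]
    exact N.add_mem (N.toAddSubgroup.zsmul_mem hx m) (N.toAddSubgroup.zsmul_mem hy n)
  smul_mem' := by
    rintro c x ⟨n, hn, hx⟩
    refine ⟨n, hn, ?_⟩
    rw [smul_comm]
    exact N.smul_mem c hx

theorem le_saturation {Λ : Type u} [Ring Λ] {Y : Type u} [AddCommGroup Y] [Module Λ Y]
    (N : Submodule Λ Y) : N ≤ saturation N := fun y hy => ⟨1, one_ne_zero, by simpa using hy⟩

theorem projective_of_torsionFree (Y : Type u) [AddCommGroup Y] [Module.Finite ℤ Y]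
    (h : ∀ (n : ℤ) (y : Y), n • y = 0 → n = 0 ∨ y = 0) : Module.Projective ℤ Y := by
  have : Module.IsTorsionFree ℤ Y := Module.IsTorsionFree.of_smul_eq_zero h
  infer_instance

/-- Induction on the rank. For a nonzero f : X → Y with image R, and I the saturation of R in Y,
additivity gives [X] = [ker f] + [R] and [Y] = [I] + [Y/I]. The lattices R and I are isogenous, so Ψ
does not distinguish them, and ker f and Y/I have equal characters and smaller rank. Saturation is
needed for Y/I to be torsion-free. No semisimplicity over ℚ has to be invoked. -/
theorem eq_of_chi_eq [Finite G] {A : Type*} [AddCommGroup A]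
    (Ψ : G0Lat (MonoidAlgebra ℤ G) →+ A)
    (hΨ : ∀ (X Y : Type u)
      [AddCommGroup X] [Module (MonoidAlgebra ℤ G) X] [Module.Finite (MonoidAlgebra ℤ G) X]
      [Module.Projective ℤ X] [AddCommGroup Y] [Module (MonoidAlgebra ℤ G) Y]
      [Module.Finite (MonoidAlgebra ℤ G) Y] [Module.Projective ℤ Y],
      Isogenous (Λ := MonoidAlgebra ℤ G) X Y →
        Ψ (G0Lat.cls (MonoidAlgebra ℤ G) X) = Ψ (G0Lat.cls (MonoidAlgebra ℤ G) Y))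
    (n : ℕ) : ∀ (X Y : Type u)
      [AddCommGroup X] [Module (MonoidAlgebra ℤ G) X] [Module.Finite (MonoidAlgebra ℤ G) X]
      [Module.Projective ℤ X] [AddCommGroup Y] [Module (MonoidAlgebra ℤ G) Y]
      [Module.Finite (MonoidAlgebra ℤ G) Y] [Module.Projective ℤ Y],
      Module.finrank ℤ X = n → (∀ g : G, chi X g = chi Y g) →
        Ψ (G0Lat.cls (MonoidAlgebra ℤ G) X) = Ψ (G0Lat.cls (MonoidAlgebra ℤ G) Y) := by
  have hfin : ∀ (X : Type u) [AddCommGroup X] [Module (MonoidAlgebra ℤ G) X]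
      [Module.Finite (MonoidAlgebra ℤ G) X] [Module.Projective ℤ X],
      Module.Finite ℤ X ∧ Module.Free ℤ X ∧ chi X (1 : G) = Module.finrank ℤ X := by
    intro X _ _ _ _
    have h1 := finite_int (Λ := MonoidAlgebra ℤ G) X
    have h2 := free_of_projective X
    refine ⟨h1, h2, ?_⟩
    rw [chi, map_one, LinearMap.trace_one]
  induction n using Nat.strong_induction_on with
  | _ n ih =>
  intro X Y _ _ _ _ _ _ _ _ hn hXY
  obtain ⟨_, _, hX1⟩ := hfin X
  obtain ⟨_, _, hY1⟩ := hfin Y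
  rcases subsingleton_or_nontrivial X with hX | hX
  -- The character at 1 is the rank, so X = 0 forces Y = 0.
  · have hY : Subsingleton Y := by
      rw [hXY, hY1, Module.finrank_zero_of_subsingleton (M := X)] at hX1
      exact (Module.finrank_eq_zero_iff_of_free ℤ Y).1 (by exact_mod_cast hX1)
    refine hΨ X Y ⟨0, 0, 1, one_ne_zero, fun x => Subsingleton.elim _ _,
      fun x => Subsingleton.elim _ _⟩
  · obtain ⟨f, hf⟩ := exists_ne_zero_hom X Y hXY
    let K := LinearMap.ker f
    let R := LinearMap.range f
    let I := saturation R
    have : Module.Finite (MonoidAlgebra ℤ G) K := finite_submodule K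
    have : Module.Finite (MonoidAlgebra ℤ G) R := finite_submodule R
    have : Module.Finite (MonoidAlgebra ℤ G) I := finite_submodule I
    have : Module.Projective ℤ K := projective_submodule K
    have : Module.Projective ℤ R := projective_submodule R
    have : Module.Projective ℤ I := projective_submodule I
    have := finite_int (Λ := MonoidAlgebra ℤ G) (Y ⧸ I)
    have : Module.Projective ℤ (Y ⧸ I) := by
      refine projective_of_torsionFree _ fun n y hy => ?_
      obtain ⟨y, rfl⟩ := I.mkQ_surjective y
      rw [or_iff_not_imp_left]
      intro hn
      have hy' : n • y ∈ I := by
        rw [← Submodule.Quotient.mk_eq_zero, Submodule.Quotient.mk_smul]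
        exact hy
      obtain ⟨m, hm, h⟩ := hy'
      rw [smul_smul] at h
      exact (Submodule.Quotient.mk_eq_zero _).2 ⟨m * n, mul_ne_zero hm hn, h⟩
    have hfr : Surjective f.rangeRestrict := f.surjective_rangeRestrict
    have hex : Exact K.subtype f.rangeRestrict := by
      rw [LinearMap.exact_iff, LinearMap.ker_rangeRestrict, Submodule.range_subtype]
    have hexI : Exact I.subtype I.mkQ := LinearMap.exact_subtype_mkQ I
    -- The quotient I/R is finitely generated and torsion, hence finite.
    have hRI : Isogenous (Λ := MonoidAlgebra ℤ G) R I := by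
      have hle : R ≤ I := le_saturation R
      have := finite_int (Λ := MonoidAlgebra ℤ G) (I ⧸ LinearMap.range (Submodule.inclusion hle))
      have : Finite (I ⧸ LinearMap.range (Submodule.inclusion hle)) := by
        refine Module.finite_of_fg_torsion _ fun y => ?_
        obtain ⟨⟨y, m, hm, hy⟩, rfl⟩ := Submodule.mkQ_surjective _ y
        refine ⟨⟨m, mem_nonZeroDivisors_of_ne_zero hm⟩, ?_⟩
        change Submodule.Quotient.mk (m • (⟨y, m, hm, hy⟩ : I)) = _
        rw [Submodule.Quotient.mk_eq_zero]
        exact ⟨⟨m • y, hy⟩, rfl⟩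
      exact isogenous_of_finite_quotient _ (Submodule.inclusion_injective hle)
    have c1 := chi_exact K.subtype f.rangeRestrict K.injective_subtype hex hfr
    have c2 := chi_exact I.subtype I.mkQ I.injective_subtype hexI I.mkQ_surjective
    have c3 := chi_eq_of_isogenous hRI
    rw [← G0Lat.cls_add K.subtype f.rangeRestrict K.injective_subtype hex hfr,
      ← G0Lat.cls_add I.subtype I.mkQ I.injective_subtype hexI I.mkQ_surjective, map_add, map_add,
      hΨ R I hRI, add_comm]
    congr 1
    obtain ⟨_, _, hK1⟩ := hfin K
    obtain ⟨_, _, hR1⟩ := hfin R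
    refine ih (Module.finrank ℤ K) ?_ K (Y ⧸ I) rfl fun g => ?_
    -- Since f ≠ 0 its image has positive rank, so the rank of the kernel drops strictly.
    · have hR0 : Module.finrank ℤ R ≠ 0 := by
        rw [Ne, Module.finrank_eq_zero_iff_of_free, Submodule.subsingleton_iff_eq_bot,
          LinearMap.range_eq_bot]
        exact hf
      have := c1 1
      rw [hK1, hR1, hX1, hn] at this
      omega
    · have h1 : chi K g + chi R g = chi X g := c1 g
      have h2 := c2 g
      have h3 : chi R g = chi I g := c3 g
      have h4 := hXY g
      omega

end

/-! ### The functor Hom(–, M) on lattices and reduction modulo a prime -/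

section

variable {G : Type u} [Group G]

variable (G) in
/-- The `ℤ[G]`-module `Hom(X, M)`, on which `G` acts by conjugation. -/
abbrev HomModule (X M : Type u) [AddCommGroup X] [Module (MonoidAlgebra ℤ G) X] [AddCommGroup M]
    [Module (MonoidAlgebra ℤ G) M] : Type u :=
  (Representation.linHom (groupRep G X) (groupRep G M)).asModule

section

variable {X Y M : Type u} [AddCommGroup X] [Module (MonoidAlgebra ℤ G) X]
  [AddCommGroup Y] [Module (MonoidAlgebra ℤ G) Y] [AddCommGroup M] [Module (MonoidAlgebra ℤ G) M]

/-- The homomorphism underlying an element of `HomModule G X M`. -/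
def HomModule.toHom : HomModule G X M ≃ₗ[ℤ] (X →ₗ[ℤ] M) :=
  (Representation.linHom (groupRep G X) (groupRep G M)).asModuleEquiv

theorem HomModule.smul_apply (g : G) (φ : HomModule G X M) (x : X) :
    HomModule.toHom (MonoidAlgebra.single g (1 : ℤ) • φ) x =
      MonoidAlgebra.single g (1 : ℤ) • HomModule.toHom φ (MonoidAlgebra.single g⁻¹ (1 : ℤ) • x) := by
  rw [asModule_smul]
  rfl

/-- Precomposition with a homomorphism. -/
def HomModule.precomp (M : Type u) [AddCommGroup M] [Module (MonoidAlgebra ℤ G) M]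
    (f : X →ₗ[MonoidAlgebra ℤ G] Y) : HomModule G Y M →ₗ[MonoidAlgebra ℤ G] HomModule G X M :=
  equivariantHom
    (((HomModule.toHom (X := X) (M := M)).symm.toLinearMap ∘ₗ
      LinearMap.lcomp ℤ M f.toAddMonoidHom.toIntLinearMap) ∘ₗ
        (HomModule.toHom (X := Y) (M := M)).toLinearMap).toAddMonoidHom fun g φ => by
    apply HomModule.toHom.injective
    ext x
    rw [HomModule.smul_apply]
    change HomModule.toHom (MonoidAlgebra.single g (1 : ℤ) • φ) (f x) = MonoidAlgebra.single g (1 : ℤ) •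
      HomModule.toHom φ (f (MonoidAlgebra.single g⁻¹ (1 : ℤ) • x))
    rw [HomModule.smul_apply, f.map_smul]

@[simp]
theorem HomModule.precomp_apply (f : X →ₗ[MonoidAlgebra ℤ G] Y) (φ : HomModule G Y M) (x : X) :
    HomModule.toHom (HomModule.precomp M f φ) x = HomModule.toHom φ (f x) := rfl

theorem HomModule.ext {φ ψ : HomModule G X M}
    (h : ∀ x, HomModule.toHom φ x = HomModule.toHom ψ x) : φ = ψ :=
  HomModule.toHom.injective (LinearMap.ext h)

instance HomModule.finite [Module.Finite ℤ X] [Finite M] : Finite (HomModule G X M) := by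
  obtain ⟨n, p, hp⟩ := Module.Finite.exists_fin' ℤ X
  refine Finite.of_injective
    (fun (φ : HomModule G X M) (i : Fin n) => HomModule.toHom φ (p (Pi.single i 1))) fun φ ψ h => ?_
  have : (HomModule.toHom φ).comp p = (HomModule.toHom ψ).comp p :=
    (Pi.basisFun ℤ (Fin n)).ext fun i => by simpa using congrFun h i
  refine HomModule.ext fun x => ?_
  obtain ⟨y, rfl⟩ := hp x
  exact LinearMap.congr_fun this y

end

/-- Exactness is a statement about the underlying groups, and there the sequence splits because N is
projective over ℤ. The section and the retraction need not be equivariant. -/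
theorem HomModule.exact [Finite G] {L M N : Type u}
    [AddCommGroup L] [Module (MonoidAlgebra ℤ G) L]
    [AddCommGroup M] [Module (MonoidAlgebra ℤ G) M]
    [AddCommGroup N] [Module (MonoidAlgebra ℤ G) N] [Module.Projective ℤ N]
    (f : L →ₗ[MonoidAlgebra ℤ G] M) (g : M →ₗ[MonoidAlgebra ℤ G] N)
    (hf : Injective f) (hfg : Exact f g) (hg : Surjective g)
    (A : Type u) [AddCommGroup A] [Module (MonoidAlgebra ℤ G) A] :
    Injective (precomp A g) ∧ Exact (precomp A g) (precomp A f) ∧ Surjective (precomp A f) := by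
  let f' : L →ₗ[ℤ] M := f.toAddMonoidHom.toIntLinearMap
  let g' : M →ₗ[ℤ] N := g.toAddMonoidHom.toIntLinearMap
  obtain ⟨s, hs⟩ := Module.projective_lifting_property g' LinearMap.id hg
  have hs' : ∀ n, g (s n) = n := fun n => LinearMap.congr_fun hs n
  refine ⟨?_, ?_, ?_⟩
  · intro φ ψ h
    refine HomModule.ext fun x => ?_
    obtain ⟨y, rfl⟩ := hg x
    rw [← precomp_apply, h, precomp_apply]
  · intro φ
    constructor
    · intro h
      have h0 : ∀ x, toHom φ (f x) = 0 := fun x => by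
        rw [← precomp_apply, h]
        rfl
      refine ⟨toHom.symm ((toHom φ).comp s), HomModule.ext fun x => ?_⟩
      rw [precomp_apply, LinearEquiv.apply_symm_apply, LinearMap.comp_apply, ← sub_eq_zero,
        ← map_sub]
      obtain ⟨y, hy⟩ := (hfg (s (g x) - x)).1 (by rw [map_sub, hs', sub_self])
      rw [← hy, h0]
    · rintro ⟨ψ, rfl⟩
      refine HomModule.ext fun x => ?_
      rw [precomp_apply, precomp_apply, (hfg _).2 ⟨x, rfl⟩, map_zero, map_zero]
      rfl
  · intro φ
    have hr : ∀ m, m - s (g m) ∈ LinearMap.range f' := fun m => by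
      obtain ⟨y, hy⟩ := (hfg (m - s (g m))).1 (by rw [map_sub, hs', sub_self])
      exact ⟨y, hy⟩
    let e : L ≃ₗ[ℤ] LinearMap.range f' := LinearEquiv.ofInjective f' hf
    let r : M →ₗ[ℤ] L := e.symm.toLinearMap.comp
      ((LinearMap.id - s.comp g').codRestrict (LinearMap.range f') hr)
    have hrf : ∀ x, r (f x) = x := fun x => by
      apply e.injective
      apply Subtype.ext
      simp only [r, LinearMap.comp_apply, LinearEquiv.coe_coe, LinearEquiv.apply_symm_apply]
      change f x - s (g (f x)) = f x
      rw [(hfg _).2 ⟨x, rfl⟩, map_zero, sub_zero]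
    refine ⟨toHom.symm ((toHom φ).comp r), HomModule.ext fun x => ?_⟩
    rw [precomp_apply, LinearEquiv.apply_symm_apply, LinearMap.comp_apply, hrf]

variable (G) in
/-- The homomorphism `[X] ↦ [Hom(X, M)]` from the Grothendieck group of lattices. -/
def homClass [Finite G] (M : Type u) [AddCommGroup M] [Module (MonoidAlgebra ℤ G) M] [Finite M] :
    G0Lat (MonoidAlgebra ℤ G) →+ G0 (MonoidAlgebra ℤ G) :=
  GrothendieckGroup.lift
    (fun X =>
      haveI : Module.Finite (MonoidAlgebra ℤ G) X.obj := X.property.1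
      haveI := finite_int (Λ := MonoidAlgebra ℤ G) X.obj
      G0.cls (MonoidAlgebra ℤ G) (HomModule G X.obj M))
    fun L M' N f g hf hfg hg => by
      have : Module.Finite (MonoidAlgebra ℤ G) L.obj := L.property.1
      have : Module.Finite (MonoidAlgebra ℤ G) M'.obj := M'.property.1
      have : Module.Finite (MonoidAlgebra ℤ G) N.obj := N.property.1
      have : Module.Projective ℤ N.obj := N.property.2
      have := finite_int (Λ := MonoidAlgebra ℤ G) L.obj
      have := finite_int (Λ := MonoidAlgebra ℤ G) M'.obj
      have := finite_int (Λ := MonoidAlgebra ℤ G) N.obj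
      obtain ⟨h1, h2, h3⟩ := HomModule.exact f g hf hfg hg M
      rw [add_comm]
      exact G0.cls_add _ _ h1 h2 h3

theorem homClass_cls [Finite G] (M : Type u) [AddCommGroup M] [Module (MonoidAlgebra ℤ G) M]
    [Finite M] (X : Type u) [AddCommGroup X] [Module (MonoidAlgebra ℤ G) X]
    [Module.Finite (MonoidAlgebra ℤ G) X] [Module.Projective ℤ X] [Module.Finite ℤ X] :
    homClass G M (G0Lat.cls (MonoidAlgebra ℤ G) X) =
      G0.cls (MonoidAlgebra ℤ G) (HomModule G X M) :=
  GrothendieckGroup.lift_mk _ _ _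

/-- If `h ∘ f = p` is prime, homomorphisms vanishing on the image of `f` extend along `h`. -/
theorem exists_extend_of_comp_eq {p : ℕ} (hp : p.Prime) {X Y M : Type*} [AddCommGroup X] [AddCommGroup Y]
    [AddCommGroup M] (f : X →+ Y) (h : Y →+ X)
    (hf : ∀ x, h (f x) = p • x) (hi : Injective h) (φ : Y →+ M) (hφ : ∀ x, φ (f x) = 0) :
    ∃ ψ : X →+ M, ∀ y, ψ (h y) = φ y := by
  have : Fact p.Prime := ⟨hp⟩
  -- Modulo p the kernel of h is exactly f(X): if h y lies in pX = h(f(X)), injectivity of h gives y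
  -- ∈ f(X). So φ factors through the image of Y in X/pX, which is a direct summand of this
  -- 𝔽_p-vector space.
  let S : AddSubgroup X := (nsmulAddMonoidHom p : X →+ X).range
  let Q := X ⧸ S
  have hQ : ∀ q : Q, p • q = 0 := fun q => by
    obtain ⟨x, rfl⟩ := QuotientAddGroup.mk_surjective q
    rw [← QuotientAddGroup.mk_nsmul, QuotientAddGroup.eq_zero_iff]
    exact ⟨x, rfl⟩
  let _ : Module (ZMod p) Q := AddCommGroup.zmodModule hQ
  let hbar : Y →+ Q := (QuotientAddGroup.mk' S).comp h
  let R : AddSubgroup Q := hbar.range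
  have hker : hbar.ker ≤ φ.ker := fun y hy => by
    obtain ⟨x, hx⟩ : h y ∈ S := (QuotientAddGroup.eq_zero_iff _).1 hy
    have : y = f x := hi (by rw [hf]; exact hx.symm)
    rw [AddMonoidHom.mem_ker, this, hφ]
  let φ' : R →+ M := (QuotientAddGroup.lift hbar.ker φ hker).comp
    (QuotientAddGroup.quotientKerEquivRange hbar).symm.toAddMonoidHom
  have hφ' : ∀ y, φ' ⟨hbar y, y, rfl⟩ = φ y := fun y => by
    have : (QuotientAddGroup.quotientKerEquivRange hbar).symm ⟨hbar y, y, rfl⟩ =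
        QuotientAddGroup.mk y := by
      rw [AddEquiv.symm_apply_eq]
      rfl
    change QuotientAddGroup.lift hbar.ker φ hker _ = _
    erw [this]
    rfl
  let _ : Module (ZMod p) R := AddCommGroup.zmodModule fun r => Subtype.ext (hQ r)
  -- A linear projection of X/pX onto the image of Y, along which the factored map is extended.
  obtain ⟨r, hr⟩ := LinearMap.exists_leftInverse_of_injective
    (AddMonoidHom.toZModLinearMap p R.subtype) (LinearMap.ker_eq_bot.2 R.subtype_injective)
  refine ⟨φ'.comp (r.toAddMonoidHom.comp (QuotientAddGroup.mk' S)), fun y => ?_⟩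
  rw [← hφ']
  exact congrArg φ' (LinearMap.congr_fun hr ⟨hbar y, y, rfl⟩)

theorem nsmul_injective_of_projective (X : Type u) [AddCommGroup X] [Module.Finite ℤ X]
    [Module.Projective ℤ X] {n : ℕ} (hn : n ≠ 0) : Injective fun x : X => n • x := by
  have := free_of_projective X
  intro x y h
  refine smul_right_injective X (Int.natCast_ne_zero.2 hn) ?_
  simpa only [natCast_zsmul] using h

/-- Multiplication by n is injective on M, so precomposition with f and with h are both injective.
Injections in both directions between finite modules are bijective. -/
theorem cls_hom_eq_of_coprime [Finite G] {p n : ℕ} (hpn : p.Coprime n) {X Y M : Type u}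
    [AddCommGroup X] [Module (MonoidAlgebra ℤ G) X] [Module.Finite ℤ X]
    [AddCommGroup Y] [Module (MonoidAlgebra ℤ G) Y] [Module.Finite ℤ Y]
    [AddCommGroup M] [Module (MonoidAlgebra ℤ G) M] [Finite M] (hM : ∀ m : M, p • m = 0)
    (f : X →ₗ[MonoidAlgebra ℤ G] Y) (h : Y →ₗ[MonoidAlgebra ℤ G] X)
    (hf : ∀ x, h (f x) = n • x) (hh : ∀ y, f (h y) = n • y) :
    G0.cls (MonoidAlgebra ℤ G) (HomModule G X M) = G0.cls (MonoidAlgebra ℤ G) (HomModule G Y M) := by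
  have hz : ∀ m : M, n • m = 0 → m = 0 := fun m hm =>
    AddMonoid.addOrderOf_eq_one_iff.1 (Nat.eq_one_of_dvd_coprimes hpn
      (addOrderOf_dvd_of_nsmul_eq_zero (hM m)) (addOrderOf_dvd_of_nsmul_eq_zero hm))
  have inj : ∀ {X Y : Type u} [AddCommGroup X] [Module (MonoidAlgebra ℤ G) X]
      [AddCommGroup Y] [Module (MonoidAlgebra ℤ G) Y] (f : X →ₗ[MonoidAlgebra ℤ G] Y)
      (h : Y →ₗ[MonoidAlgebra ℤ G] X), (∀ y, f (h y) = n • y) →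
      Injective (HomModule.precomp M f) := fun f h hh => by
    rw [injective_iff_map_eq_zero]
    intro φ hφ
    refine HomModule.ext fun y => hz _ ?_
    rw [← map_nsmul, ← hh, ← HomModule.precomp_apply, hφ]
    rfl
  have h1 := inj f h hh
  have h2 := inj h f hf
  have h3 : Bijective (HomModule.precomp M h) :=
    (Nat.bijective_iff_injective_and_card _).2 ⟨h2, le_antisymm
      (Nat.card_le_card_of_injective _ h2) (Nat.card_le_card_of_injective _ h1)⟩
  exact G0.cls_congr (LinearEquiv.ofBijective _ h3)

/-- The maps f* and h* between Hom(Y, M) and Hom(X, M) satisfy ker f* = im h* and ker h* = im f*.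
Hence both modules have class [ker f*] + [im f*], with the roles of kernel and image exchanged. They
need not be isomorphic. -/
theorem cls_hom_eq_of_prime [Finite G] {p : ℕ} (hp : p.Prime) {X Y M : Type u}
    [AddCommGroup X] [Module (MonoidAlgebra ℤ G) X] [Module.Finite ℤ X] [Module.Projective ℤ X]
    [AddCommGroup Y] [Module (MonoidAlgebra ℤ G) Y] [Module.Finite ℤ Y] [Module.Projective ℤ Y]
    [AddCommGroup M] [Module (MonoidAlgebra ℤ G) M] [Finite M] (hM : ∀ m : M, p • m = 0)
    (f : X →ₗ[MonoidAlgebra ℤ G] Y) (h : Y →ₗ[MonoidAlgebra ℤ G] X)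
    (hf : ∀ x, h (f x) = p • x) (hh : ∀ y, f (h y) = p • y) :
    G0.cls (MonoidAlgebra ℤ G) (HomModule G X M) = G0.cls (MonoidAlgebra ℤ G) (HomModule G Y M) := by
  have ex : ∀ {X Y : Type u} [AddCommGroup X] [Module (MonoidAlgebra ℤ G) X] [Module.Finite ℤ X]
      [Module.Projective ℤ X] [AddCommGroup Y] [Module (MonoidAlgebra ℤ G) Y] [Module.Finite ℤ Y]
      [Module.Projective ℤ Y] (f : X →ₗ[MonoidAlgebra ℤ G] Y) (h : Y →ₗ[MonoidAlgebra ℤ G] X)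
      (_ : ∀ x, h (f x) = p • x) (_ : ∀ y, f (h y) = p • y),
      LinearMap.ker (HomModule.precomp M f) = LinearMap.range (HomModule.precomp M h) := by
    intro X Y _ _ _ _ _ _ _ _ f h hf hh
    have hi : Injective h := fun x y hxy =>
      nsmul_injective_of_projective Y hp.ne_zero (by beta_reduce; rw [← hh, ← hh, hxy])
    ext φ
    constructor
    · intro hφ
      obtain ⟨ψ, hψ⟩ := exists_extend_of_comp_eq hp f.toAddMonoidHom h.toAddMonoidHom hf hi
        (HomModule.toHom φ).toAddMonoidHom fun x => by
          change HomModule.toHom φ (f x) = 0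
          rw [← HomModule.precomp_apply, LinearMap.mem_ker.1 hφ]
          rfl
      exact ⟨HomModule.toHom.symm ψ.toIntLinearMap, HomModule.ext hψ⟩
    · rintro ⟨ψ, rfl⟩
      refine LinearMap.mem_ker.2 (HomModule.ext fun x => ?_)
      rw [HomModule.precomp_apply, HomModule.precomp_apply, hf, map_nsmul, hM]
      rfl
  have := finite_submodule (LinearMap.ker (HomModule.precomp M f))
  have := finite_submodule (LinearMap.ker (HomModule.precomp M h))
  have := finite_submodule (LinearMap.range (HomModule.precomp M f))
  have := finite_submodule (LinearMap.range (HomModule.precomp M h))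
  rw [← G0.cls_ker_range (HomModule.precomp M f), ← G0.cls_ker_range (HomModule.precomp M h),
    add_comm]
  exact congrArg₂ (· + ·) (G0.cls_congr (LinearEquiv.ofEq _ _ (ex f h hf hh).symm))
    (G0.cls_congr (LinearEquiv.ofEq _ _ (ex h f hh hf)))

/-- Induction on the multiplier n. If p does not divide n the coprime case applies. If n = pm, the
isogeny factors as X → Z ⊆ Y with Z = f(X) + pY: the first map has multiplier m, because m(f x + p
y) = f(m x + h y), and the inclusion has multiplier p. -/
theorem cls_hom_eq_of_isogenous [Finite G] {p : ℕ} (hp : p.Prime) {M : Type u}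
    [AddCommGroup M] [Module (MonoidAlgebra ℤ G) M] [Finite M] (hM : ∀ m : M, p • m = 0) (n : ℕ) :
    ∀ {X Y : Type u} [AddCommGroup X] [Module (MonoidAlgebra ℤ G) X] [Module.Finite ℤ X]
    [Module.Projective ℤ X] [AddCommGroup Y] [Module (MonoidAlgebra ℤ G) Y] [Module.Finite ℤ Y]
    [Module.Projective ℤ Y] (f : X →ₗ[MonoidAlgebra ℤ G] Y) (h : Y →ₗ[MonoidAlgebra ℤ G] X)
    (_ : n ≠ 0) (_ : ∀ x, h (f x) = n • x) (_ : ∀ y, f (h y) = n • y),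
    G0.cls (MonoidAlgebra ℤ G) (HomModule G X M) = G0.cls (MonoidAlgebra ℤ G) (HomModule G Y M) := by
  induction n using Nat.strong_induction_on with
  | _ n ih =>
  intro X Y _ _ _ _ _ _ _ _ f h hn hf hh
  by_cases hpn : p ∣ n
  swap
  · exact cls_hom_eq_of_coprime ((Nat.Prime.coprime_iff_not_dvd hp).2 hpn) hM f h hf hh
  obtain ⟨m, rfl⟩ := hpn
  have hm : m ≠ 0 := right_ne_zero_of_mul hn
  have := finite_of_finite_int G (M := X) inferInstance
  have := finite_of_finite_int G (M := Y) inferInstance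
  have hfi : Injective f := fun x y hxy =>
    nsmul_injective_of_projective X hn (by beta_reduce; rw [← hf, ← hf, hxy])
  let Z : Submodule (MonoidAlgebra ℤ G) Y :=
    LinearMap.range f ⊔ LinearMap.range (p • (LinearMap.id : Y →ₗ[MonoidAlgebra ℤ G] Y))
  have : Module.Finite (MonoidAlgebra ℤ G) Z := finite_submodule Z
  have : Module.Projective ℤ Z := projective_submodule Z
  have := finite_int (Λ := MonoidAlgebra ℤ G) Z
  let f₁ : X →ₗ[MonoidAlgebra ℤ G] Z :=
    f.codRestrict Z fun x => Submodule.mem_sup_left (LinearMap.mem_range_self f x)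
  obtain ⟨h₁, e1, e2⟩ := exists_reverse f₁ (fun x y hxy => hfi (congrArg Subtype.val hxy)) m (by
    rintro ⟨z, hz⟩
    obtain ⟨_, ⟨x, rfl⟩, _, ⟨y, rfl⟩, rfl⟩ := Submodule.mem_sup.1 hz
    refine ⟨m • x + h y, Subtype.ext ?_⟩
    change f (m • x + h y) = m • (f x + p • y)
    rw [map_add, map_nsmul, hh, smul_add, smul_smul, mul_comm])
  obtain ⟨h₂, e3, e4⟩ := exists_reverse Z.subtype Z.injective_subtype p (fun y => by
    rw [Submodule.range_subtype]
    exact Submodule.mem_sup_right ⟨y, rfl⟩)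
  rw [ih m ?_ f₁ h₁ hm e1 e2, cls_hom_eq_of_prime hp hM Z.subtype h₂ e3 e4]
  nlinarith [hp.two_le, Nat.pos_of_ne_zero hm]

/-- An analogue of the Brauer–Nesbitt theorem: modulo p, the class obtained from a lattice is
determined by its rational character. Isogeny invariance is exactly the hypothesis of
`eq_of_chi_eq`. -/
theorem homClass_eq_zero [Finite G] {p : ℕ} (hp : p.Prime) {M : Type u}
    [AddCommGroup M] [Module (MonoidAlgebra ℤ G) M] [Finite M] (hM : ∀ m : M, p • m = 0)
    (x : G0Lat (MonoidAlgebra ℤ G)) (hx : ∀ g : G, chiHom g x = 0) : homClass G M x = 0 := by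
  obtain ⟨X, Y, _, _, _, _, _, _, _, _, rfl⟩ := x.exists_eq_sub
  rw [map_sub, sub_eq_zero]
  refine eq_of_chi_eq (homClass G M) ?_ _ X Y rfl fun g => ?_
  · intro X Y _ _ _ _ _ _ _ _ hXY
    have := finite_int (Λ := MonoidAlgebra ℤ G) X
    have := finite_int (Λ := MonoidAlgebra ℤ G) Y
    obtain ⟨f, h, n, hn, hf, hh⟩ := hXY
    rw [homClass_cls, homClass_cls]
    exact cls_hom_eq_of_isogenous hp hM n f h hn hf hh
  · have := hx g
    rwa [map_sub, sub_eq_zero, chiHom_cls, chiHom_cls] at this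

end

/-! ### Permutation modules and Artin induction -/

section Permutation

variable {G : Type u} [Group G]

variable (G) in
/-- The permutation module `ℤ[S]`. -/
abbrev PermModule (S : Type u) [MulAction G S] : Type u :=
  (Representation.ofMulAction ℤ G S).asModule

variable (G) in
/-- The basis `S` of the permutation module `ℤ[S]`. -/
def permBasis (S : Type u) [MulAction G S] : Module.Basis S ℤ (PermModule G S) :=
  .ofRepr ((Representation.ofMulAction ℤ G S).asModuleEquiv.trans (MonoidAlgebra.coeffLinearEquiv ℤ))

theorem single_smul_permBasis {S : Type u} [MulAction G S] (g : G) (s : S) :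
    MonoidAlgebra.single g (1 : ℤ) • permBasis G S s = permBasis G S (g • s) := by
  rw [asModule_smul]
  exact Representation.ofMulAction_single g s 1

theorem chi_eq_card_fixedBy {S : Type u} [MulAction G S] [Finite S] {X : Type u} [AddCommGroup X]
    [Module (MonoidAlgebra ℤ G) X] (b : Module.Basis S ℤ X)
    (hb : ∀ (g : G) s, MonoidAlgebra.single g (1 : ℤ) • b s = b (g • s)) (g : G) :
    chi X g = Nat.card (MulAction.fixedBy S g) := by
  classical
  let _ := Fintype.ofFinite S
  rw [chi, LinearMap.trace_eq_matrix_trace ℤ b, Matrix.trace]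
  have : ∀ s, (LinearMap.toMatrix b b (groupRep G X g)).diag s = if g • s = s then 1 else 0 :=
    fun s => by
      rw [Matrix.diag_apply, LinearMap.toMatrix_apply, groupRep_apply, MonoidAlgebra.of_apply, hb,
        Module.Basis.repr_self, Finsupp.single_apply]
  rw [Finset.sum_congr rfl fun s _ => this s, Finset.sum_boole, ← Fintype.card_subtype,
    Nat.card_eq_fintype_card]
  rfl

instance finite_permModule_int (S : Type u) [MulAction G S] [Finite S] :
    Module.Finite ℤ (PermModule G S) := Module.Finite.of_basis (permBasis G S)

instance free_permModule (S : Type u) [MulAction G S] : Module.Free ℤ (PermModule G S) :=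
  Module.Free.of_basis (permBasis G S)

instance finite_permModule (S : Type u) [MulAction G S] [Finite S] :
    Module.Finite (MonoidAlgebra ℤ G) (PermModule G S) :=
  finite_of_finite_int G inferInstance

/-- The equations are triangular for the order, so β is found by recursion from the maximal elements
downwards. On the poset of cyclic subgroups this yields the Artin coefficients. -/
theorem exists_mobius (P : Type*) [PartialOrder P] [Finite P] :
    ∃ β : P → ℤ, ∀ d : P, ∑ᶠ c ∈ Set.Ici d, β c = 1 := by
  classical
  let _ := Fintype.ofFinite P
  have wf : WellFounded ((· > ·) : P → P → Prop) := Finite.wellFounded_of_trans_of_irrefl _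
  let β : P → ℤ := wf.fix fun d ih => 1 - ∑ c : {c : P // c > d}, ih c.1 c.2
  have hβ : ∀ d, β d = 1 - ∑ c : {c : P // c > d}, β c := fun d => by
    rw [show β d = _ from wf.fix_eq _ d]
  refine ⟨β, fun d => ?_⟩
  have h1 : Set.Ici d = insert d (Set.Ioi d) := Set.Ioi_insert.symm
  rw [h1, finsum_mem_insert _ (by simp) (Set.toFinite _), hβ d,
    finsum_mem_eq_finite_toFinset_sum _ (Set.toFinite _), sub_add_eq_add_sub, sub_eq_iff_eq_add,
    add_right_inj]
  refine (Finset.sum_subtype _ (fun x => ?_) _)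
  simp

/-- The coset xC is fixed by g exactly when x⁻¹gx ∈ C, and each coset has |C| representatives x. -/
theorem card_fixedBy_mul_card [Finite G] (C : Subgroup G) (g : G) :
    Nat.card (MulAction.fixedBy (G ⧸ C) g) * Nat.card C = Nat.card {x : G // x⁻¹ * g * x ∈ C} := by
  rw [mul_comm, ← Nat.card_prod,
    ← Nat.card_congr (QuotientGroup.preimageMkEquivSubgroupProdSet C (MulAction.fixedBy (G ⧸ C) g))]
  refine Nat.card_congr (Equiv.subtypeEquivRight fun x => ?_)
  rw [Set.mem_preimage, MulAction.mem_fixedBy, ← QuotientGroup.mk_mul_of_mem x (one_mem C), mul_one,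
    eq_comm, mul_assoc]
  exact QuotientGroup.eq

/-- Artin's induction theorem for the trivial character, in terms of numbers of fixed points. -/
theorem exists_artin_coeff (G : Type u) [Group G] [Finite G] :
    ∃ β : {C : Subgroup G // IsCyclic C} → ℤ, ∀ g : G,
      ∑ᶠ C, β C * Nat.card (MulAction.fixedBy (G ⧸ C.1) g) = Nat.card G := by
  classical
  obtain ⟨β, hβ⟩ := exists_mobius {C : Subgroup G // IsCyclic C}
  let _ := Fintype.ofFinite G
  let _ := Fintype.ofFinite {C : Subgroup G // IsCyclic C}
  -- With the factor |C|, the term of C becomes β(C) times the number of x with x⁻¹gx ∈ C. The two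
  -- sums are then interchanged.
  refine ⟨fun C => β C * Nat.card C.1, fun g => ?_⟩
  have h1 : ∀ C : {C : Subgroup G // IsCyclic C},
      β C * (Nat.card C.1 : ℤ) * Nat.card (MulAction.fixedBy (G ⧸ C.1) g) =
        ∑ x : G, if x⁻¹ * g * x ∈ C.1 then β C else 0 := fun C => by
    have := card_fixedBy_mul_card C.1 g
    rw [mul_assoc, mul_comm (Nat.card C.1 : ℤ), ← Nat.cast_mul, this, ← Finset.sum_filter,
      Finset.sum_const, nsmul_eq_mul, mul_comm, Nat.card_eq_fintype_card, Fintype.card_subtype]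
  -- The cyclic subgroups containing x⁻¹gx are those above the one it generates, so β sums to 1 over
  -- them.
  have h2 : ∀ x : G, ∑ C : {C : Subgroup G // IsCyclic C},
      (if x⁻¹ * g * x ∈ C.1 then β C else 0) = 1 := fun x => by
    rw [← hβ ⟨Subgroup.zpowers (x⁻¹ * g * x), inferInstance⟩,
      finsum_mem_eq_finite_toFinset_sum _ (Set.toFinite _), ← Finset.sum_filter]
    refine Finset.sum_congr (Finset.ext fun C => ?_) fun _ _ => rfl
    simp only [Finset.mem_filter, Finset.mem_univ, true_and, Set.Finite.mem_toFinset, Set.mem_Ici,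
      ← Subtype.coe_le_coe, Subgroup.zpowers_le]
  rw [finsum_eq_sum_of_fintype, Finset.sum_congr rfl fun C _ => h1 C, Finset.sum_comm,
    Finset.sum_congr rfl fun x _ => h2 x, Finset.sum_const, Finset.card_univ, nsmul_eq_mul, mul_one,
    Nat.card_eq_fintype_card]

end Permutation

/-! ### Coinduction from a subgroup -/

section Coinduction

variable {G : Type u} [Group G] {C : Subgroup G}

variable (G) in
/-- The module coinduced from a `ℤ[C]`-module. -/
abbrev CoindModule (C : Subgroup G) (A : Type u) [AddCommGroup A] [Module (MonoidAlgebra ℤ C) A] :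
    Type u :=
  (Representation.coind C.subtype (groupRep C A)).asModule

section

variable {A B : Type u} [AddCommGroup A] [Module (MonoidAlgebra ℤ C) A]
  [AddCommGroup B] [Module (MonoidAlgebra ℤ C) B]

/-- The function underlying an element of a coinduced module. -/
def CoindModule.toFun (F : CoindModule G C A) : G → A :=
  ((Representation.coind C.subtype (groupRep C A)).asModuleEquiv F).1

theorem CoindModule.ext {F F' : CoindModule G C A}
    (h : ∀ x, CoindModule.toFun F x = CoindModule.toFun F' x) : F = F' :=
  (Representation.coind C.subtype (groupRep C A)).asModuleEquiv.injective
    (Subtype.ext (funext h))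

/-- The element of the coinduced module given by a `C`-equivariant function. -/
def CoindModule.mk (F : G → A)
    (h : ∀ (c : C) (x : G), F (c * x) = MonoidAlgebra.single c (1 : ℤ) • F x) : CoindModule G C A :=
  (Representation.coind C.subtype (groupRep C A)).asModuleEquiv.symm ⟨F, h⟩

@[simp]
theorem CoindModule.toFun_mk (F : G → A) (h) : CoindModule.toFun (mk (C := C) F h) = F := rfl

theorem CoindModule.toFun_mul (F : CoindModule G C A) (c : C) (x : G) :
    toFun F (c * x) = MonoidAlgebra.single c (1 : ℤ) • toFun F x :=
  ((Representation.coind C.subtype (groupRep C A)).asModuleEquiv F).2 c x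

@[simp]
theorem CoindModule.toFun_add (F F' : CoindModule G C A) (x : G) :
    toFun (F + F') x = toFun F x + toFun F' x := rfl

@[simp]
theorem CoindModule.toFun_zero (x : G) : toFun (0 : CoindModule G C A) x = 0 := rfl

theorem CoindModule.toFun_smul (g : G) (F : CoindModule G C A) (x : G) :
    toFun (MonoidAlgebra.single g (1 : ℤ) • F) x = toFun F (x * g) := by
  rw [asModule_smul]
  rfl

instance CoindModule.finite [Finite G] [Module.Finite ℤ A] :
    Module.Finite (MonoidAlgebra ℤ G) (CoindModule G C A) := by
  refine finite_of_finite_int G (M := CoindModule G C A) ?_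
  have : Module.Finite ℤ (Representation.coindV C.subtype (groupRep C A)) := inferInstance
  exact Module.Finite.equiv (Representation.coind C.subtype (groupRep C A)).asModuleEquiv.symm

/-- The homomorphism of coinduced modules induced by a homomorphism. -/
def CoindModule.map (f : A →ₗ[MonoidAlgebra ℤ C] B) :
    CoindModule G C A →ₗ[MonoidAlgebra ℤ G] CoindModule G C B :=
  equivariantHom (M := CoindModule G C A) (N := CoindModule G C B)
    { toFun := fun F => mk (fun x => f (toFun F x)) fun c x => by rw [toFun_mul, map_smul]
      map_zero' := ext fun x => by simp
      map_add' := fun F F' => ext fun x => by simp }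
    fun g F => ext fun x => by
      rw [toFun_smul]
      change f (toFun _ _) = f (toFun _ _)
      rw [toFun_smul]

@[simp]
theorem CoindModule.toFun_map (f : A →ₗ[MonoidAlgebra ℤ C] B) (F : CoindModule G C A) (x : G) :
    toFun (map f F) x = f (toFun F x) := rfl

/-- An element of a coinduced module may be prescribed on coset representatives. -/
theorem CoindModule.exists_toFun_out (s : G ⧸ C → A) :
    ∃ F : CoindModule G C A, ∀ q, toFun F (Quotient.out q)⁻¹ = s q := by
  have hc : ∀ x : G, x * (Quotient.out (QuotientGroup.mk x⁻¹ : G ⧸ C)) ∈ C := fun x => by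
    obtain ⟨c, hc⟩ := QuotientGroup.mk_out_eq_mul C x⁻¹
    rw [hc, mul_inv_cancel_left]
    exact c.2
  -- The inverses of the chosen representatives of G/C represent C\G, and κ(x) is the C-component of
  -- x: x = κ(x)·r⁻¹ with r the representative of x⁻¹C.
  let κ : G → C := fun x => ⟨_, hc x⟩
  have hq : ∀ (c : C) (x : G), (QuotientGroup.mk ((c : G) * x)⁻¹ : G ⧸ C) = QuotientGroup.mk x⁻¹ :=
    fun c x => by
      rw [mul_inv_rev]
      exact QuotientGroup.mk_mul_of_mem _ (inv_mem c.2)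
  have hκ : ∀ (c : C) (x : G), κ (c * x) = c * κ x := fun c x => Subtype.ext (by
    change (c : G) * x * Quotient.out (QuotientGroup.mk ((c : G) * x)⁻¹ : G ⧸ C) =
      c * (x * Quotient.out (QuotientGroup.mk x⁻¹ : G ⧸ C))
    rw [hq, mul_assoc])
  refine ⟨mk (fun x => MonoidAlgebra.single (κ x) (1 : ℤ) • s (QuotientGroup.mk x⁻¹))
    fun c x => ?_, fun q => ?_⟩
  · rw [hq, smul_smul, MonoidAlgebra.single_mul_single, one_mul, hκ]
  · rw [toFun_mk]
    have h : (QuotientGroup.mk ((Quotient.out q)⁻¹)⁻¹ : G ⧸ C) = q := by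
      rw [inv_inv]
      exact Quotient.out_eq q
    have h1 : κ (Quotient.out q)⁻¹ = 1 := Subtype.ext (by
      change (Quotient.out q)⁻¹ * Quotient.out (QuotientGroup.mk ((Quotient.out q)⁻¹)⁻¹ : G ⧸ C) = 1
      rw [h, inv_mul_cancel])
    rw [h1, h, ← MonoidAlgebra.one_def, one_smul]

theorem CoindModule.ext_out {F F' : CoindModule G C A}
    (h : ∀ q : G ⧸ C, toFun F (Quotient.out q)⁻¹ = toFun F' (Quotient.out q)⁻¹) : F = F' := by
  refine ext fun x => ?_
  obtain ⟨c, hc⟩ := QuotientGroup.mk_out_eq_mul C x⁻¹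
  have hx : x = (c : G) * (Quotient.out (QuotientGroup.mk x⁻¹ : G ⧸ C))⁻¹ := by
    rw [hc]
    group
  rw [hx, toFun_mul, toFun_mul, h]

end

/-- A coinduced element is an arbitrary choice of values on coset representatives, so preimages can
be chosen there independently. -/
theorem CoindModule.exact {L M N : Type u} [AddCommGroup L] [Module (MonoidAlgebra ℤ C) L]
    [AddCommGroup M] [Module (MonoidAlgebra ℤ C) M] [AddCommGroup N] [Module (MonoidAlgebra ℤ C) N]
    (f : L →ₗ[MonoidAlgebra ℤ C] M) (g : M →ₗ[MonoidAlgebra ℤ C] N)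
    (hf : Injective f) (hfg : Exact f g) (hg : Surjective g) :
    Injective (map (G := G) f) ∧ Exact (map (G := G) f) (map (G := G) g) ∧
      Surjective (map (G := G) g) := by
  refine ⟨fun F F' h => ext fun x => hf ?_, fun F => ⟨fun h => ?_, ?_⟩, fun F => ?_⟩
  · rw [← toFun_map, h, toFun_map]
  · have h1 : ∀ q : G ⧸ C, ∃ a, f a = toFun F (Quotient.out q)⁻¹ := fun q =>
      (hfg _).1 (by rw [← toFun_map, h, toFun_zero])
    choose s hs using h1
    obtain ⟨F', hF'⟩ := exists_toFun_out s
    exact ⟨F', ext_out fun q => by rw [toFun_map, hF', hs]⟩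
  · rintro ⟨F, rfl⟩
    exact ext fun x => (hfg _).2 ⟨_, rfl⟩
  · choose s hs using fun q : G ⧸ C => hg (toFun F (Quotient.out q)⁻¹)
    obtain ⟨F', hF'⟩ := exists_toFun_out s
    exact ⟨F', ext_out fun q => by rw [toFun_map, hF', hs]⟩

variable (C) in
/-- The homomorphism of Grothendieck groups given by coinduction. -/
def coindClass [Finite G] : G0 (MonoidAlgebra ℤ C) →+ G0 (MonoidAlgebra ℤ G) :=
  GrothendieckGroup.lift
    (fun A =>
      haveI : Module.Finite (MonoidAlgebra ℤ C) A.obj := A.property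
      haveI := finite_int (Λ := MonoidAlgebra ℤ C) A.obj
      G0.cls (MonoidAlgebra ℤ G) (CoindModule G C A.obj))
    fun L M N f g hf hfg hg => by
      have : Module.Finite (MonoidAlgebra ℤ C) L.obj := L.property
      have : Module.Finite (MonoidAlgebra ℤ C) M.obj := M.property
      have : Module.Finite (MonoidAlgebra ℤ C) N.obj := N.property
      have := finite_int (Λ := MonoidAlgebra ℤ C) L.obj
      have := finite_int (Λ := MonoidAlgebra ℤ C) M.obj
      have := finite_int (Λ := MonoidAlgebra ℤ C) N.obj
      obtain ⟨h1, h2, h3⟩ := CoindModule.exact (G := G) f g hf hfg hg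
      exact G0.cls_add _ _ h1 h2 h3

theorem coindClass_cls [Finite G] (A : Type u) [AddCommGroup A] [Module (MonoidAlgebra ℤ C) A]
    [Module.Finite (MonoidAlgebra ℤ C) A] [Module.Finite ℤ A] :
    coindClass C (G0.cls (MonoidAlgebra ℤ C) A) =
      G0.cls (MonoidAlgebra ℤ G) (CoindModule G C A) :=
  GrothendieckGroup.lift_mk _ _ _

/-- `Hom(ℤ[G/C], M)` is coinduced from the restriction of `M`. -/
theorem cls_hom_permModule [Finite G] (A M : Type u) [AddCommGroup A]
    [Module (MonoidAlgebra ℤ C) A] [Module.Finite ℤ A] [AddCommGroup M]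
    [Module (MonoidAlgebra ℤ G) M] [Finite M] (e : A ≃+ M)
    (he : ∀ (c : C) (a : A), e (MonoidAlgebra.single c (1 : ℤ) • a) =
      MonoidAlgebra.single (c : G) (1 : ℤ) • e a) :
    G0.cls (MonoidAlgebra ℤ G) (HomModule G (PermModule G (G ⧸ C)) M) =
      G0.cls (MonoidAlgebra ℤ G) (CoindModule G C A) := by
  have hb : ∀ q : G ⧸ C, permBasis G (G ⧸ C) q =
      MonoidAlgebra.single (Quotient.out q) (1 : ℤ) • permBasis G (G ⧸ C) (QuotientGroup.mk 1) :=
    fun q => by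
      rw [single_smul_permBasis]
      congr 1
      change q = QuotientGroup.mk (Quotient.out q * 1)
      rw [mul_one]
      exact (Quotient.out_eq q).symm
  have he' : ∀ (c : C) (m : M), e.symm (MonoidAlgebra.single (c : G) (1 : ℤ) • m) =
      MonoidAlgebra.single c (1 : ℤ) • e.symm m := fun c m => by
    rw [AddEquiv.symm_apply_eq, he, AddEquiv.apply_symm_apply]
  -- The isomorphism sends φ to x ↦ x·φ(x⁻¹C). Equivariance under C holds because (cx)⁻¹C = x⁻¹C.
  let θ₀ : HomModule G (PermModule G (G ⧸ C)) M →+ CoindModule G C A :=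
    { toFun := fun φ => CoindModule.mk (fun x => e.symm (MonoidAlgebra.single x (1 : ℤ) •
          HomModule.toHom φ (permBasis G (G ⧸ C) (QuotientGroup.mk x⁻¹)))) fun c x => by
        have h : (QuotientGroup.mk ((c : G) * x)⁻¹ : G ⧸ C) = QuotientGroup.mk x⁻¹ := by
          rw [mul_inv_rev]
          exact QuotientGroup.mk_mul_of_mem _ (inv_mem c.2)
        rw [h, ← he', smul_smul, MonoidAlgebra.single_mul_single, one_mul]
      map_zero' := CoindModule.ext fun x => by
        rw [CoindModule.toFun_mk, map_zero, LinearMap.zero_apply, smul_zero, map_zero]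
        rfl
      map_add' := fun φ ψ => CoindModule.ext fun x => by
        rw [CoindModule.toFun_mk, map_add, LinearMap.add_apply, smul_add, map_add]
        rfl }
  have hθ0 : ∀ φ x, CoindModule.toFun (θ₀ φ) x = e.symm (MonoidAlgebra.single x (1 : ℤ) •
      HomModule.toHom φ (permBasis G (G ⧸ C) (QuotientGroup.mk x⁻¹))) := fun φ x => rfl
  let θ : HomModule G (PermModule G (G ⧸ C)) M →ₗ[MonoidAlgebra ℤ G] CoindModule G C A :=
    equivariantHom θ₀ fun g φ => CoindModule.ext fun x => by
        have h : g⁻¹ • (QuotientGroup.mk x⁻¹ : G ⧸ C) = QuotientGroup.mk (x * g)⁻¹ := by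
          rw [mul_inv_rev]
          rfl
        rw [CoindModule.toFun_smul, hθ0, hθ0, HomModule.smul_apply, smul_smul,
          MonoidAlgebra.single_mul_single, one_mul, single_smul_permBasis, h]
  have hθ : ∀ φ (q : G ⧸ C), CoindModule.toFun (θ φ) (Quotient.out q)⁻¹ =
      e.symm (MonoidAlgebra.single (Quotient.out q)⁻¹ (1 : ℤ) •
        HomModule.toHom φ (permBasis G (G ⧸ C) q)) := fun φ q => by
    have h : (QuotientGroup.mk ((Quotient.out q)⁻¹)⁻¹ : G ⧸ C) = q := by
      rw [inv_inv]
      exact Quotient.out_eq q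
    exact (hθ0 _ _).trans (by rw [h])
  have hs : ∀ (g : G) (m : M), MonoidAlgebra.single g⁻¹ (1 : ℤ) • MonoidAlgebra.single g (1 : ℤ) • m = m :=
    fun g m => by
      rw [smul_smul, MonoidAlgebra.single_mul_single, one_mul, inv_mul_cancel,
        ← MonoidAlgebra.one_def, one_smul]
  refine G0.cls_congr (LinearEquiv.ofBijective θ ⟨fun φ ψ h => ?_, fun F => ?_⟩)
  · refine HomModule.toHom.injective ((permBasis G (G ⧸ C)).ext fun q => ?_)
    have := congrArg (fun F => CoindModule.toFun F (Quotient.out q)⁻¹) h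
    simp only [hθ] at this
    have := congrArg (fun m => MonoidAlgebra.single (Quotient.out q) (1 : ℤ) • m)
      (e.symm.injective this)
    have h2 := fun m => hs (Quotient.out q)⁻¹ m
    simp only [inv_inv] at h2
    simpa only [h2] using this
  · refine ⟨HomModule.toHom.symm ((permBasis G (G ⧸ C)).constr ℤ fun q =>
      MonoidAlgebra.single (Quotient.out q) (1 : ℤ) • e (CoindModule.toFun F (Quotient.out q)⁻¹)),
      CoindModule.ext_out fun q => ?_⟩
    rw [hθ, LinearEquiv.apply_symm_apply, Module.Basis.constr_basis, hs, AddEquiv.symm_apply_apply]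

end Coinduction

/-! ### Restriction of scalars -/

section RestrictScalars

variable {R S : Type u} [Ring R] [Ring S]

/-- The homomorphism of Grothendieck groups given by restriction of scalars along `f : R → S`, for
`S` finite over `ℤ`. -/
def restrictClass [Module.Finite ℤ S] (f : R →+* S) : G0 S →+ G0 R :=
  GrothendieckGroup.lift
    (fun M =>
      letI := Module.compHom M.obj f
      haveI : Module.Finite S M.obj := M.property
      haveI := finite_int (Λ := S) M.obj
      haveI : Module.Finite R M.obj := Module.Finite.of_restrictScalars_finite ℤ R M.obj
      G0.cls R M.obj)
    fun L M N i p hi hip hp => by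
      let _ := Module.compHom L.obj f
      let _ := Module.compHom M.obj f
      let _ := Module.compHom N.obj f
      have : Module.Finite S L.obj := L.property
      have : Module.Finite S M.obj := M.property
      have : Module.Finite S N.obj := N.property
      have := finite_int (Λ := S) L.obj
      have := finite_int (Λ := S) M.obj
      have := finite_int (Λ := S) N.obj
      have : Module.Finite R L.obj := Module.Finite.of_restrictScalars_finite ℤ R L.obj
      have : Module.Finite R M.obj := Module.Finite.of_restrictScalars_finite ℤ R M.obj
      have : Module.Finite R N.obj := Module.Finite.of_restrictScalars_finite ℤ R N.obj
      exact G0.cls_add (Λ := R)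
        { toFun := i, map_add' := map_add i, map_smul' := fun r x => map_smul i (f r) x }
        { toFun := p, map_add' := map_add p, map_smul' := fun r x => map_smul p (f r) x } hi hip hp

theorem restrictClass_cls [Module.Finite ℤ S] (f : R →+* S) (M : Type u) [AddCommGroup M]
    [Module S M] [Module.Finite S M] (N : Type u) [AddCommGroup N] [Module R N] [Module.Finite R N]
    (e : N ≃+ M) (he : ∀ (r : R) (n : N), e (r • n) = f r • e n) :
    restrictClass f (G0.cls S M) = G0.cls R N := by
  let _ := Module.compHom M f
  have := finite_int (Λ := S) M
  have : Module.Finite R M := Module.Finite.of_restrictScalars_finite ℤ R M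
  have h : G0.cls R N = G0.cls R M := G0.cls_congr { e with map_smul' := he }
  rw [h]
  exact GrothendieckGroup.lift_mk _ _ _

end RestrictScalars

/-! ### Residue fields of Dedekind domains -/

section Dedekind

variable {A : Type u} [CommRing A] [IsDedekindDomain A]

/-- Each graded piece Pⁿ/Pⁿ⁺¹ is isomorphic to A/P, through multiplication by any a in Pⁿ outside
Pⁿ⁺¹. -/
theorem cls_quotient_pow (P : Ideal A) [P.IsPrime] (hP : P ≠ ⊥) (n : ℕ) :
    G0.cls A (A ⧸ P ^ n) = n • G0.cls A (A ⧸ P) := by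
  induction n with
  | zero =>
    have : Subsingleton (A ⧸ P ^ 0) := Ideal.Quotient.subsingleton_iff.2 (by rw [pow_zero, Ideal.one_eq_top])
    rw [G0.cls_subsingleton, zero_smul]
  | succ n ih =>
    obtain ⟨a, ha, ha'⟩ := SetLike.exists_of_lt (Ideal.pow_succ_lt_pow hP n)
    let i : (A ⧸ P) →ₗ[A] A ⧸ P ^ (n + 1) := Submodule.mapQ P (P ^ (n + 1)) (LinearMap.mulLeft A a)
      fun x hx => by
        rw [Submodule.mem_comap, LinearMap.mulLeft_apply, pow_succ]
        exact Ideal.mul_mem_mul ha hx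
    let p : (A ⧸ P ^ (n + 1)) →ₗ[A] A ⧸ P ^ n := Submodule.factor (Ideal.pow_le_pow_right n.le_succ)
    have hp : ∀ x, p (Submodule.Quotient.mk x) = Submodule.Quotient.mk x := fun x => rfl
    rw [succ_nsmul, ← ih, add_comm (G0.cls A (A ⧸ P ^ n))]
    refine (G0.cls_add i p ?_ ?_ (Submodule.factor_surjective _)).symm
    · rw [← LinearMap.ker_eq_bot, LinearMap.ker_eq_bot']
      intro x hx
      obtain ⟨x, rfl⟩ := Submodule.Quotient.mk_surjective _ x
      rw [Submodule.mapQ_apply, Submodule.Quotient.mk_eq_zero, LinearMap.mulLeft_apply, mul_comm] at hx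
      exact (Submodule.Quotient.mk_eq_zero _).2 (((Ideal.IsPrime.mul_mem_pow P hx)).resolve_right ha')
    · intro y
      obtain ⟨y, rfl⟩ := Submodule.Quotient.mk_surjective _ y
      rw [hp, Submodule.Quotient.mk_eq_zero]
      constructor
      · intro hy
        obtain ⟨d, e, he, h⟩ := Ideal.exists_mul_add_mem_pow_succ hP a y ha ha' hy
        refine ⟨Submodule.Quotient.mk d, ?_⟩
        rw [Submodule.mapQ_apply, LinearMap.mulLeft_apply, Submodule.Quotient.eq, ← h,
          sub_add_cancel_left]
        exact neg_mem he
      · rintro ⟨x, hx⟩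
        obtain ⟨x, rfl⟩ := Submodule.Quotient.mk_surjective _ x
        rw [Submodule.mapQ_apply, LinearMap.mulLeft_apply, Submodule.Quotient.eq] at hx
        have h1 := (P ^ n).sub_mem (Ideal.mul_mem_right x _ ha) (Ideal.pow_le_pow_right n.le_succ hx)
        rwa [sub_sub_cancel] at h1

/-- With h the class number, Pʰ = (a) is principal. Multiplication by a gives 0 → A → A → A/Pʰ → 0,
hence [A/Pʰ] = 0, while [A/Pʰ] = h[A/P]. -/
theorem exists_nsmul_cls_quotient_eq_zero [Finite (ClassGroup A)] (P : Ideal A) [P.IsPrime]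
    (hP : P ≠ ⊥) : ∃ n : ℕ, n ≠ 0 ∧ n • G0.cls A (A ⧸ P) = 0 := by
  refine ⟨Nat.card (ClassGroup A), Nat.card_pos.ne', ?_⟩
  rw [← cls_quotient_pow P hP]
  have hne : P ^ Nat.card (ClassGroup A) ≠ ⊥ := pow_ne_zero _ hP
  have h1 : Submodule.IsPrincipal (P ^ Nat.card (ClassGroup A)) := by
    rw [← ClassGroup.mk0_eq_one_iff (mem_nonZeroDivisors_of_ne_zero hne)]
    have : ClassGroup.mk0 ⟨P, mem_nonZeroDivisors_of_ne_zero hP⟩ ^ Nat.card (ClassGroup A) = 1 :=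
      pow_card_eq_one'
    rw [← map_pow] at this
    exact this
  obtain ⟨a, ha⟩ := h1
  have ha0 : a ≠ 0 := by
    rintro rfl
    exact hne (ha.trans (by simp))
  rw [ha]
  have := G0.cls_add (LinearMap.mulLeft A a) (Submodule.mkQ (Submodule.span A {a}))
    (fun x y h => mul_left_cancel₀ ha0 h) (fun y => ?_) (Submodule.mkQ_surjective _)
  · exact add_eq_left.1 this
  · rw [Submodule.mkQ_apply, Submodule.Quotient.mk_eq_zero, Submodule.mem_span_singleton]
    exact ⟨fun ⟨c, hc⟩ => ⟨c, by rw [LinearMap.mulLeft_apply, mul_comm]; exact hc⟩,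
      fun ⟨c, hc⟩ => ⟨c, by rw [← hc, LinearMap.mulLeft_apply, mul_comm]; rfl⟩⟩

end Dedekind

/-! ### Simple modules over cyclic groups -/

section Cyclic

open NumberField

/-- A power basis of the ring of integers of the `m`-th cyclotomic field, in any universe. -/
theorem exists_cyclotomic_powerBasis (m : ℕ) (hm : m ≠ 0) : ∃ (L : Type u) (_ : Field L)
    (_ : NumberField L) (b : PowerBasis ℤ (𝓞 L)),
    minpoly ℤ b.gen = Polynomial.cyclotomic m ℤ ∧ b.gen ^ m = 1 := by
  suffices h : ∀ (M : Type) [Field M] [CharZero M] [Algebra ℚ M] [IsCyclotomicExtension {m} ℚ M],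
      ∃ (L : Type u) (_ : Field L) (_ : NumberField L) (b : PowerBasis ℤ (𝓞 L)),
        minpoly ℤ b.gen = Polynomial.cyclotomic m ℤ ∧ b.gen ^ m = 1 from
    @h (CyclotomicField m ℚ) _ _ (CyclotomicField.algebra m ℚ)
      (haveI : NeZero m := ⟨hm⟩
      haveI : NeZero ((m : ℕ) : ℚ) := ⟨Nat.cast_ne_zero.2 hm⟩
      CyclotomicField.isCyclotomicExtension m ℚ)
  intro M _ _ alg _
  obtain rfl : alg = DivisionRing.toRatAlgebra := Subsingleton.elim _ _
  have : NeZero m := ⟨hm⟩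
  let L := ULift.{u} M
  let e : M ≃ₐ[ℚ] L := ULift.algEquiv.symm
  have : CharZero L := charZero_of_injective_algebraMap (algebraMap ℚ L).injective
  have : IsCyclotomicExtension {m} ℚ L := by
    convert IsCyclotomicExtension.equiv {m} ℚ M e
    exact Subsingleton.elim _ _
  have : FiniteDimensional ℚ L := IsCyclotomicExtension.finiteDimensional {m} ℚ L
  have : NumberField L := {}
  obtain ⟨ζ, hζ⟩ := IsCyclotomicExtension.exists_isPrimitiveRoot ℚ L (Set.mem_singleton m) hm
  refine ⟨L, inferInstance, inferInstance, hζ.integralPowerBasis, ?_, ?_⟩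
  · rw [hζ.integralPowerBasis_gen, Polynomial.cyclotomic_eq_minpoly hζ (Nat.pos_of_ne_zero hm)]
    exact (minpoly.algebraMap_eq (A := ℤ) (B := 𝓞 L) (B' := L) RingOfIntegers.coe_injective
      hζ.toInteger).symm
  · rw [hζ.integralPowerBasis_gen]
    exact RingOfIntegers.ext hζ.pow_eq_one

/-- As ℤ[C] is commutative, N is a quotient by a maximal ideal, that is, a finite field k. A
generator of C maps to an element a of some order m in k. Being a primitive m-th root of unity in a
field, a is a root of the m-th cyclotomic polynomial, so ℤ[C] → k factors through ℤ[ζ_m] and N is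
the restriction of a residue field of ℤ[ζ_m]. -/
theorem exists_nsmul_cls_eq_zero_of_isSimpleModule {C : Type u} [CommGroup C] [Finite C] [IsCyclic C]
    (N : Type u) [AddCommGroup N] [Module (MonoidAlgebra ℤ C) N] [Finite N]
    [IsSimpleModule (MonoidAlgebra ℤ C) N] :
    ∃ n : ℕ, n ≠ 0 ∧ n • G0.cls (MonoidAlgebra ℤ C) N = 0 := by
  obtain ⟨I, hI, ⟨e⟩⟩ := isSimpleModule_iff_quot_maximal.1
    (inferInstance : IsSimpleModule (MonoidAlgebra ℤ C) N)
  let k := MonoidAlgebra ℤ C ⧸ I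
  let _ : Field k := Ideal.Quotient.field I
  have : Finite k := Finite.of_equiv N e.toEquiv
  obtain ⟨c, hc⟩ := IsCyclic.exists_generator (α := C)
  let q : MonoidAlgebra ℤ C →+* k := Ideal.Quotient.mk I
  let a : k := q (MonoidAlgebra.of ℤ C c)
  have hac : a ^ orderOf c = 1 := by
    rw [← map_pow, ← map_pow, pow_orderOf_eq_one, map_one, map_one]
  have hc0 : 0 < orderOf c := orderOf_pos c
  have hm : orderOf a ≠ 0 := orderOf_ne_zero_iff.2 (isOfFinOrder_iff_pow_eq_one.2 ⟨_, hc0, hac⟩)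
  obtain ⟨L, _, _, b, hb, hb1⟩ := exists_cyclotomic_powerBasis.{u} (orderOf a) hm
  have hroot := (IsPrimitiveRoot.orderOf a).isRoot_cyclotomic (Nat.pos_of_ne_zero hm)
  let ψ : 𝓞 L →ₐ[ℤ] k := b.lift a (by
    rw [hb, Polynomial.aeval_def, Polynomial.eval₂_eq_eval_map, Polynomial.map_cyclotomic]
    exact hroot)
  have hψ : ψ b.gen = a := b.lift_gen _ _
  let ζ : (𝓞 L)ˣ := Units.ofPowEqOne b.gen _ hb1 hm
  -- The generator c may be sent to ζ because ζᵐ = 1 and m, the order of a, divides the order of c.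
  let f : MonoidAlgebra ℤ C →ₐ[ℤ] 𝓞 L := MonoidAlgebra.lift ℤ (𝓞 L) C ((Units.coeHom (𝓞 L)).comp
    (monoidHomOfForallMemZpowers hc (g' := ζ)
      (orderOf_dvd_of_pow_eq_one (by
        obtain ⟨t, ht⟩ := orderOf_dvd_of_pow_eq_one hac
        rw [ht, pow_mul, Units.pow_ofPowEqOne, one_pow]))))
  -- Both ring homomorphisms send c to a, and C is generated by c.
  have hf : ∀ x, ψ (f x) = q x := by
    have : ((ψ : 𝓞 L →+* k).comp (f : MonoidAlgebra ℤ C →+* 𝓞 L)) = q := by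
      refine MonoidAlgebra.ringHom_ext (fun r => ?_) (fun x => ?_)
      · exact RingHom.congr_fun (RingHom.ext_int (((ψ : 𝓞 L →+* k).comp
          (f : MonoidAlgebra ℤ C →+* 𝓞 L)).comp MonoidAlgebra.singleOneRingHom)
          (q.comp MonoidAlgebra.singleOneRingHom)) r
      obtain ⟨n, rfl⟩ := Subgroup.mem_zpowers_iff.1 (hc x)
      have key : ∀ φ ψ : C →* k, φ c = ψ c → φ (c ^ n) = ψ (c ^ n) := fun φ ψ h => by
        rw [← zpow_mod_orderOf c n, ← Int.toNat_of_nonneg (Int.emod_nonneg n (by exact_mod_cast hc0.ne')),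
          zpow_natCast, map_pow, map_pow, h]
      refine key ((((ψ : 𝓞 L →+* k).comp
        (f : MonoidAlgebra ℤ C →+* 𝓞 L)) : MonoidAlgebra ℤ C →* k).comp
        (MonoidAlgebra.of ℤ C)) ((q : MonoidAlgebra ℤ C →* k).comp (MonoidAlgebra.of ℤ C)) ?_
      change ψ (f (MonoidAlgebra.single c 1)) = a
      rw [← hψ]
      congr 1
      rw [← MonoidAlgebra.of_apply]
      change MonoidAlgebra.lift ℤ (𝓞 L) C _ (MonoidAlgebra.of ℤ C c) = _
      rw [MonoidAlgebra.lift_of]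
      change ((monoidHomOfForallMemZpowers hc _ c : (𝓞 L)ˣ) : 𝓞 L) = b.gen
      rw [monoidHomOfForallMemZpowers_apply_gen]
      rfl
    exact fun x => DFunLike.congr_fun this x
  have hψs : Surjective ψ := fun y => by
    obtain ⟨x, rfl⟩ := Ideal.Quotient.mk_surjective y
    exact ⟨f x, hf x⟩
  let P : Ideal (𝓞 L) := RingHom.ker (ψ : 𝓞 L →+* k)
  have : P.IsPrime := RingHom.ker_isPrime _
  -- The ring of integers is infinite whereas k is finite.
  have hP : P ≠ ⊥ := fun h => by
    have hinj : Injective (ψ : 𝓞 L →+* k) := (RingHom.injective_iff_ker_eq_bot _).2 h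
    have := Finite.of_injective _ hinj
    exact not_finite (𝓞 L)
  obtain ⟨n, hn, h⟩ := exists_nsmul_cls_quotient_eq_zero P hP
  refine ⟨n, hn, ?_⟩
  let E : (𝓞 L ⧸ P) ≃+* k := RingHom.quotientKerEquivOfSurjective (f := (ψ : 𝓞 L →+* k)) hψs
  have hE : ∀ x, E (Ideal.Quotient.mk P x) = ψ x := fun x => rfl
  rw [← restrictClass_cls (f : MonoidAlgebra ℤ C →+* 𝓞 L) (𝓞 L ⧸ P) N
    (e.toAddEquiv.trans E.symm.toAddEquiv) fun r x => ?_, ← map_nsmul, h, map_zero]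
  change E.symm (e (r • x)) = f r • E.symm (e x)
  rw [RingEquiv.symm_apply_eq, Algebra.smul_def, map_mul, RingEquiv.apply_symm_apply, map_smul]
  change _ = ψ (f r) * _
  rw [hf]
  generalize e x = y
  obtain ⟨y, rfl⟩ := Ideal.Quotient.mk_surjective y
  rfl

end Cyclic

/-! ### Finite modules have torsion classes -/

section TorsionClasses

theorem mem_torsion_of_nsmul {A : Type*} [AddCommGroup A] {x : A} {n : ℕ} (hn : n ≠ 0)
    (h : n • x ∈ AddCommGroup.torsion A) : x ∈ AddCommGroup.torsion A := by
  obtain ⟨m, hm, h⟩ := isOfFinAddOrder_iff_nsmul_eq_zero.1 h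
  exact isOfFinAddOrder_iff_nsmul_eq_zero.2
    ⟨m * n, Nat.mul_pos hm (Nat.pos_of_ne_zero hn), by rw [mul_smul, h]⟩

theorem map_mem_torsion {A B : Type*} [AddCommGroup A] [AddCommGroup B] (f : A →+ B) {x : A}
    (h : x ∈ AddCommGroup.torsion A) : f x ∈ AddCommGroup.torsion B :=
  f.isOfFinAddOrder h

/-- Dévissage: a nonzero finite module has a simple submodule, and the quotient by it has smaller
order. -/
theorem cls_mem_torsion_of_simple {Λ : Type u} [Ring Λ]
    (h : ∀ (N : Type u) [AddCommGroup N] [Module Λ N] [Finite N] [IsSimpleModule Λ N],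
      G0.cls Λ N ∈ AddCommGroup.torsion (G0 Λ)) (n : ℕ) :
    ∀ (M : Type u) [AddCommGroup M] [Module Λ M] [Finite M], Nat.card M = n →
      G0.cls Λ M ∈ AddCommGroup.torsion (G0 Λ) := by
  induction n using Nat.strong_induction_on with
  | _ n ih =>
    intro M _ _ _ hn
    rcases subsingleton_or_nontrivial M with hM | hM
    · rw [G0.cls_subsingleton]
      exact zero_mem _
    · obtain ⟨S, hS⟩ := IsAtomic.exists_atom (Submodule Λ M)
      have : IsSimpleModule Λ S := isSimpleModule_iff_isAtom.2 hS
      have : Finite (M ⧸ S) := Quotient.finite _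
      rw [← G0.cls_submodule S]
      refine add_mem (h S) (ih (Nat.card (M ⧸ S)) ?_ _ rfl)
      have h1 := S.card_eq_card_quotient_mul_card
      have h2 : Nontrivial S := IsSimpleModule.nontrivial Λ S
      have h3 : 1 < Nat.card S := Finite.one_lt_card
      have h4 : 0 < Nat.card (M ⧸ S) := Nat.card_pos
      rw [← hn, h1]
      nlinarith

/-- For p dividing the order of N, the kernel of multiplication by p is a submodule, nonzero by
Cauchy's theorem, hence all of N. -/
theorem exists_prime_smul_eq_zero {Λ : Type u} [Ring Λ] (N : Type u) [AddCommGroup N] [Module Λ N]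
    [Finite N] [IsSimpleModule Λ N] : ∃ p : ℕ, p.Prime ∧ ∀ x : N, p • x = 0 := by
  have := IsSimpleModule.nontrivial Λ N
  obtain ⟨p, hp, hd⟩ := Nat.exists_prime_and_dvd (Finite.one_lt_card (α := N)).ne'
  have := Fact.mk hp
  obtain ⟨x, hx⟩ := exists_prime_addOrderOf_dvd_card' p hd
  refine ⟨p, hp, fun y => ?_⟩
  let f : N →ₗ[Λ] N := p • LinearMap.id
  rcases eq_bot_or_eq_top (LinearMap.ker f) with h | h
  · have h1 : x ∈ LinearMap.ker f := by
      change p • x = 0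
      rw [← hx, addOrderOf_nsmul_eq_zero]
    rw [h, Submodule.mem_bot] at h1
    rw [h1, addOrderOf_zero] at hx
    exact absurd hx.symm hp.one_lt.ne'
  · have : y ∈ LinearMap.ker f := h ▸ Submodule.mem_top
    exact this

theorem cls_mem_torsion_of_isCyclic {C : Type u} [Group C] [Finite C] [IsCyclic C]
    (N : Type u) [AddCommGroup N] [Module (MonoidAlgebra ℤ C) N] [Finite N] :
    G0.cls (MonoidAlgebra ℤ C) N ∈ AddCommGroup.torsion (G0 (MonoidAlgebra ℤ C)) := by
  have key : ∀ (D : Type u) [CommGroup D] [Finite D] [IsCyclic D] (N : Type u) [AddCommGroup N]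
      [Module (MonoidAlgebra ℤ D) N] [Finite N],
      G0.cls (MonoidAlgebra ℤ D) N ∈ AddCommGroup.torsion (G0 (MonoidAlgebra ℤ D)) :=
    fun D _ _ _ N _ _ _ => cls_mem_torsion_of_simple (fun S _ _ _ _ => by
      obtain ⟨n, hn, h⟩ := exists_nsmul_cls_eq_zero_of_isSimpleModule (C := D) S
      exact isOfFinAddOrder_iff_nsmul_eq_zero.2 ⟨n, Nat.pos_of_ne_zero hn, h⟩) _ N rfl
  let _ : CommGroup C := IsCyclic.commGroup
  exact key C N

variable {G : Type u} [Group G]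

theorem cls_hom_quotient_top [Finite G] (M : Type u) [AddCommGroup M]
    [Module (MonoidAlgebra ℤ G) M] [Finite M] :
    G0.cls (MonoidAlgebra ℤ G) (HomModule G (PermModule G (G ⧸ (⊤ : Subgroup G))) M) =
      G0.cls (MonoidAlgebra ℤ G) M := by
  have : Subsingleton (G ⧸ (⊤ : Subgroup G)) := QuotientGroup.subsingleton_quotient_top
  let b := permBasis G (G ⧸ (⊤ : Subgroup G))
  let s : G ⧸ (⊤ : Subgroup G) := QuotientGroup.mk 1
  let θ : HomModule G (PermModule G (G ⧸ (⊤ : Subgroup G))) M →ₗ[MonoidAlgebra ℤ G] M :=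
    equivariantHom (M := HomModule G (PermModule G (G ⧸ (⊤ : Subgroup G))) M)
      { toFun := fun φ => HomModule.toHom φ (b s)
        map_zero' := by rw [map_zero]; rfl
        map_add' := fun φ ψ => by rw [map_add]; rfl } fun g φ => by
      change HomModule.toHom (MonoidAlgebra.single g (1 : ℤ) • φ) (b s) =
        MonoidAlgebra.single g (1 : ℤ) • HomModule.toHom φ (b s)
      rw [HomModule.smul_apply, single_smul_permBasis, Subsingleton.elim (g⁻¹ • s) s]
  refine G0.cls_congr (LinearEquiv.ofBijective θ ⟨fun φ ψ h => ?_, fun m => ?_⟩)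
  · exact HomModule.toHom.injective (b.ext fun q => by rw [Subsingleton.elim q s]; exact h)
  · refine ⟨HomModule.toHom.symm (b.constr ℤ fun _ => m), ?_⟩
    change HomModule.toHom (G := G) (HomModule.toHom.symm (b.constr ℤ fun _ => m)) (b s) = m
    rw [LinearEquiv.apply_symm_apply, Module.Basis.constr_basis]

/-- The module is coinduced from the restriction of M to C. Coinduction is additive, so it carries
the torsion class known over the cyclic group to a torsion class over G. -/
theorem cls_hom_permModule_mem_torsion [Finite G] (C : Subgroup G) [IsCyclic C] (M : Type u)
    [AddCommGroup M] [Module (MonoidAlgebra ℤ G) M] [Finite M] :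
    G0.cls (MonoidAlgebra ℤ G) (HomModule G (PermModule G (G ⧸ C)) M) ∈
      AddCommGroup.torsion (G0 (MonoidAlgebra ℤ G)) := by
  let f : MonoidAlgebra ℤ C →+* MonoidAlgebra ℤ G := MonoidAlgebra.mapDomainRingHom ℤ C.subtype
  have key : ∀ (A : Type u) [AddCommGroup A] [Module (MonoidAlgebra ℤ C) A] (e : A ≃+ M),
      (∀ (r : MonoidAlgebra ℤ C) (a : A), e (r • a) = f r • e a) →
      G0.cls (MonoidAlgebra ℤ G) (HomModule G (PermModule G (G ⧸ C)) M) ∈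
        AddCommGroup.torsion (G0 (MonoidAlgebra ℤ G)) := fun A _ _ e he => by
    have : Finite A := Finite.of_equiv M e.symm.toEquiv
    rw [cls_hom_permModule A M e fun c a => by
      rw [he]
      congr 1
      exact MonoidAlgebra.mapDomain_single, ← coindClass_cls]
    exact map_mem_torsion _ (cls_mem_torsion_of_isCyclic A)
  exact @key M _ (Module.compHom M f) (AddEquiv.refl M) fun _ _ => rfl

theorem chiHom_permModule [Finite G] (S : Type u) [MulAction G S] [Finite S] (g : G) :
    chiHom g (G0Lat.cls (MonoidAlgebra ℤ G) (PermModule G S)) =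
      Nat.card (MulAction.fixedBy S g) := by
  rw [chiHom_cls]
  exact chi_eq_card_fixedBy (permBasis G S) (fun g s => single_smul_permBasis g s) g

/-- By Artin induction |G|·[ℤ] and Σ β(C)[ℤ[G/C]] have the same character, so they have the same
image under [X] ↦ [Hom(X, M)]. For X = ℤ this image is [M], and the cyclic terms are torsion, so
|G|[M] is torsion. -/
theorem cls_mem_torsion_of_smul_eq_zero [Finite G] {p : ℕ} (hp : p.Prime) (M : Type u)
    [AddCommGroup M] [Module (MonoidAlgebra ℤ G) M] [Finite M] (hM : ∀ m : M, p • m = 0) :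
    G0.cls (MonoidAlgebra ℤ G) M ∈ AddCommGroup.torsion (G0 (MonoidAlgebra ℤ G)) := by
  obtain ⟨β, hβ⟩ := exists_artin_coeff G
  let _ := Fintype.ofFinite {C : Subgroup G // IsCyclic C}
  have h1 := homClass_eq_zero hp hM
    (Nat.card G • G0Lat.cls (MonoidAlgebra ℤ G) (PermModule G (G ⧸ (⊤ : Subgroup G))) -
      ∑ C, β C • G0Lat.cls (MonoidAlgebra ℤ G) (PermModule G (G ⧸ C.1))) fun g => by
    have h2 : Nat.card (MulAction.fixedBy (G ⧸ (⊤ : Subgroup G)) g) = 1 := by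
      have : Subsingleton (G ⧸ (⊤ : Subgroup G)) := QuotientGroup.subsingleton_quotient_top
      rw [Nat.card_eq_one_iff_unique]
      exact ⟨inferInstance, ⟨⟨QuotientGroup.mk 1, Subsingleton.elim _ _⟩⟩⟩
    rw [map_sub, map_nsmul, map_sum, chiHom_permModule, h2, sub_eq_zero, nsmul_eq_mul, Nat.cast_one,
      mul_one, ← hβ g, finsum_eq_sum_of_fintype]
    exact Finset.sum_congr rfl fun C _ => by rw [map_zsmul, chiHom_permModule, smul_eq_mul]
  rw [map_sub, map_nsmul, map_sum, homClass_cls, cls_hom_quotient_top, sub_eq_zero] at h1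
  refine mem_torsion_of_nsmul (n := Nat.card G) Nat.card_pos.ne' ?_
  rw [h1]
  refine sum_mem fun C _ => ?_
  rw [map_zsmul, homClass_cls]
  have := C.2
  exact zsmul_mem (cls_hom_permModule_mem_torsion C.1 M) _

/-- The class of a finite `ℤ[G]`-module is torsion. -/
theorem cls_mem_torsion_of_finite [Finite G] (M : Type u) [AddCommGroup M]
    [Module (MonoidAlgebra ℤ G) M] [Finite M] :
    G0.cls (MonoidAlgebra ℤ G) M ∈ AddCommGroup.torsion (G0 (MonoidAlgebra ℤ G)) :=
  cls_mem_torsion_of_simple (fun N _ _ _ _ => by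
    obtain ⟨p, hp, h⟩ := exists_prime_smul_eq_zero (Λ := MonoidAlgebra ℤ G) N
    exact cls_mem_torsion_of_smul_eq_zero hp N h) _ M rfl

/-- The classes of two lattices with the same character differ by torsion. -/
theorem cls_sub_cls_mem_torsion [Finite G] (X Y : Type u)
    [AddCommGroup X] [Module (MonoidAlgebra ℤ G) X] [Module.Finite (MonoidAlgebra ℤ G) X]
    [Module.Projective ℤ X] [AddCommGroup Y] [Module (MonoidAlgebra ℤ G) Y]
    [Module.Finite (MonoidAlgebra ℤ G) Y] [Module.Projective ℤ Y] (h : ∀ g : G, chi X g = chi Y g) :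
    G0.cls (MonoidAlgebra ℤ G) X - G0.cls (MonoidAlgebra ℤ G) Y ∈
      AddCommGroup.torsion (G0 (MonoidAlgebra ℤ G)) := by
  -- Modulo torsion the class is isogeny invariant: an isogeny of lattices is injective with finite
  -- cokernel, and finite modules are torsion. The conclusion then follows from `eq_of_chi_eq`.
  let T := AddCommGroup.torsion (G0 (MonoidAlgebra ℤ G))
  rw [← QuotientAddGroup.eq_zero_iff, QuotientAddGroup.mk_sub, sub_eq_zero]
  refine eq_of_chi_eq ((QuotientAddGroup.mk' T).comp (latticeInclusion (MonoidAlgebra ℤ G))) ?_ _ X Y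
    rfl h
  intro X Y _ _ _ _ _ _ _ _ hXY
  have := finite_int (Λ := MonoidAlgebra ℤ G) X
  have := finite_int (Λ := MonoidAlgebra ℤ G) Y
  obtain ⟨f, h, n, hn, hf, hh⟩ := hXY
  have hinj : Injective f := fun x y hxy => by
    have h2 : n • x = n • y := by rw [← hf, hxy, hf]
    exact nsmul_injective_of_projective X hn h2
  have hfin : Finite (Y ⧸ LinearMap.range f) := by
    have hfg : Module.Finite ℤ (Y ⧸ LinearMap.range f) := inferInstance
    have ht : IsAddTorsion (Y ⧸ LinearMap.range f) := fun y => by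
      obtain ⟨y, rfl⟩ := Submodule.Quotient.mk_surjective _ y
      refine isOfFinAddOrder_iff_nsmul_eq_zero.2 ⟨n, Nat.pos_of_ne_zero hn, ?_⟩
      rw [← Submodule.Quotient.mk_smul, Submodule.Quotient.mk_eq_zero]
      exact ⟨h y, hh y⟩
    have : AddGroup.FG (Y ⧸ LinearMap.range f) := Module.Finite.iff_addGroup_fg.1 hfg
    exact AddCommGroup.finite_of_fg_isAddTorsion _ ht
  change (QuotientAddGroup.mk (G0.cls _ X) : G0 (MonoidAlgebra ℤ G) ⧸ T) =
    QuotientAddGroup.mk (G0.cls _ Y)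
  rw [← sub_eq_zero, ← QuotientAddGroup.mk_sub, QuotientAddGroup.eq_zero_iff,
    ← G0.cls_add f (LinearMap.range f).mkQ hinj (fun y => ?_) (Submodule.mkQ_surjective _),
    sub_add_cancel_left]
  · exact neg_mem (cls_mem_torsion_of_finite (Y ⧸ LinearMap.range f))
  · rw [Submodule.mkQ_apply, Submodule.Quotient.mk_eq_zero]
    rfl

end TorsionClasses

/-! ### The circle as ℝ/ℤ -/

section CircleExp

/-- The homomorphism `t ↦ exp (2πit)` from `ℝ` to the circle, written additively. -/
def unitExp : ℝ →+ Additive Circle where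
  toFun t := Additive.ofMul (Circle.exp (2 * Real.pi * t))
  map_zero' := by rw [mul_zero, Circle.exp_zero]; rfl
  map_add' s t := by rw [mul_add, Circle.exp_add]; rfl

theorem unitExp_eq_zero_iff (t : ℝ) : unitExp t = 0 ↔ ∃ n : ℤ, t = n := by
  have h : unitExp t = 0 ↔ Circle.exp (2 * Real.pi * t) = 1 := Iff.rfl
  rw [h, Circle.exp_eq_one]
  refine exists_congr fun n => ?_
  rw [mul_comm (n : ℝ), mul_right_inj' Real.two_pi_pos.ne']

theorem unitExp_surjective : Surjective unitExp := fun z => by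
  obtain ⟨t, ht⟩ := Circle.exp_surjective z.toMul
  refine ⟨t / (2 * Real.pi), ?_⟩
  change Additive.ofMul (Circle.exp (2 * Real.pi * (t / (2 * Real.pi)))) = z
  rw [mul_div_cancel₀ _ Real.two_pi_pos.ne', ht]
  rfl

end CircleExp

/-! ### Duality for finite modules and the value of σ on them -/

section CircleDual

variable {G : Type u} [Group G]

variable (G) in
/-- The `ℤ[G]`-module of homomorphisms from `M` to the circle group. -/
abbrev CircleDual (M : Type u) [AddCommGroup M] [Module (MonoidAlgebra ℤ G) M] : Type u :=
  (Representation.linHom (groupRep G M) (Representation.trivial ℤ G (Additive Circle))).asModule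

/-- The homomorphism underlying an element of `CircleDual G M`. -/
def CircleDual.toHom {M : Type u} [AddCommGroup M] [Module (MonoidAlgebra ℤ G) M] :
    CircleDual G M ≃ₗ[ℤ] (M →ₗ[ℤ] Additive Circle) :=
  (Representation.linHom (groupRep G M)
    (Representation.trivial ℤ G (Additive Circle))).asModuleEquiv

theorem CircleDual.smul_apply {M : Type u} [AddCommGroup M] [Module (MonoidAlgebra ℤ G) M] (g : G)
    (φ : CircleDual G M) (x : M) : CircleDual.toHom (MonoidAlgebra.single g (1 : ℤ) • φ) x =
      CircleDual.toHom φ (MonoidAlgebra.single g⁻¹ (1 : ℤ) • x) := by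
  rw [asModule_smul]
  rfl

variable {M P : Type u} [AddCommGroup M] [Module (MonoidAlgebra ℤ G) M] [AddCommGroup P]
  [Module (MonoidAlgebra ℤ G) P]

theorem nsmul_mem_ker [Finite M] (p : P →ₗ[MonoidAlgebra ℤ G] M) (x : P) :
    Nat.card M • x ∈ LinearMap.ker p := by
  rw [LinearMap.mem_ker, map_nsmul]
  exact card_nsmul_eq_zero'

/-- The homomorphism `x ↦ exp (2πi φ(Nx) / N)`, where `N` is the order of `M`. -/
def connectingAux [Finite M] (p : P →ₗ[MonoidAlgebra ℤ G] M) (φ : LinearMap.ker p →ₗ[ℤ] ℤ) :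
    P →+ Additive Circle :=
  unitExp.comp
    { toFun := fun x => (φ ⟨Nat.card M • x, nsmul_mem_ker p x⟩ : ℝ) / Nat.card M
      map_zero' := by
        have : (⟨Nat.card M • (0 : P), nsmul_mem_ker p 0⟩ : LinearMap.ker p) = 0 :=
          Subtype.ext (smul_zero _)
        rw [this, map_zero, Int.cast_zero, zero_div]
      map_add' := fun x y => by
        have : (⟨Nat.card M • (x + y), nsmul_mem_ker p _⟩ : LinearMap.ker p) =
            ⟨Nat.card M • x, nsmul_mem_ker p x⟩ + ⟨Nat.card M • y, nsmul_mem_ker p y⟩ :=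
          Subtype.ext (smul_add _ _ _)
        rw [this, map_add, Int.cast_add, add_div] }

theorem connectingAux_apply [Finite M] (p : P →ₗ[MonoidAlgebra ℤ G] M)
    (φ : LinearMap.ker p →ₗ[ℤ] ℤ) (x : P) : connectingAux p φ x =
      unitExp ((φ ⟨Nat.card M • x, nsmul_mem_ker p x⟩ : ℝ) / Nat.card M) := rfl

/-- On the kernel φ(Nx)/N = φ(x) is an integer, so the exponential is trivial and the map descends
to M. -/
theorem connectingAux_ker [Finite M] (p : P →ₗ[MonoidAlgebra ℤ G] M)
    (φ : LinearMap.ker p →ₗ[ℤ] ℤ) (x : P) (hx : p x = 0) : connectingAux p φ x = 0 := by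
  rw [connectingAux_apply, unitExp_eq_zero_iff]
  have : (⟨Nat.card M • x, nsmul_mem_ker p x⟩ : LinearMap.ker p) = Nat.card M • ⟨x, hx⟩ := rfl
  have h0 : (Nat.card M : ℝ) ≠ 0 := Nat.cast_ne_zero.2 Nat.card_pos.ne'
  exact ⟨φ ⟨x, hx⟩, by rw [this, map_nsmul, nsmul_eq_mul, Int.cast_mul, Int.cast_natCast,
    mul_div_cancel_left₀ _ h0]⟩

theorem connectingAux_congr [Finite M] (p : P →ₗ[MonoidAlgebra ℤ G] M)
    (φ : LinearMap.ker p →ₗ[ℤ] ℤ) {x y : P} (h : p x = p y) :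
    connectingAux p φ x = connectingAux p φ y := by
  rw [← sub_eq_zero, ← map_sub]
  exact connectingAux_ker p φ _ (by rw [map_sub, h, sub_self])

theorem connectingAux_add [Finite M] (p : P →ₗ[MonoidAlgebra ℤ G] M)
    (φ ψ : LinearMap.ker p →ₗ[ℤ] ℤ) (x : P) :
    connectingAux p (φ + ψ) x = connectingAux p φ x + connectingAux p ψ x := by
  rw [connectingAux_apply, connectingAux_apply, connectingAux_apply, LinearMap.add_apply,
    Int.cast_add, add_div, map_add]

/-- The homomorphism `M → Circle` induced by `connectingAux`. -/
def connectingHom [Finite M] (p : P →ₗ[MonoidAlgebra ℤ G] M) (hp : Surjective p)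
    (φ : LinearMap.ker p →ₗ[ℤ] ℤ) : M →+ Additive Circle where
  toFun m := connectingAux p φ (surjInv hp m)
  map_zero' := connectingAux_ker _ _ _ (surjInv_eq hp 0)
  map_add' x y := by
    rw [← map_add]
    exact connectingAux_congr _ _
      (by rw [surjInv_eq hp, map_add, surjInv_eq hp, surjInv_eq hp])

theorem connectingHom_apply [Finite M] (p : P →ₗ[MonoidAlgebra ℤ G] M) (hp : Surjective p)
    (φ : LinearMap.ker p →ₗ[ℤ] ℤ) (x : P) : connectingHom p hp φ (p x) = connectingAux p φ x := by
  have h : connectingHom p hp φ (p x) = connectingAux p φ (surjInv hp (p x)) := rfl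
  rw [h]
  exact connectingAux_congr p φ (surjInv_eq hp (p x))

/-- The connecting homomorphism, as a homomorphism of groups. -/
def connectingAddHom [Finite M] (p : P →ₗ[MonoidAlgebra ℤ G] M) (hp : Surjective p) :
    DualModule G (LinearMap.ker p) →+ CircleDual G M where
  toFun φ := CircleDual.toHom.symm (connectingHom p hp
    ((groupRep G (LinearMap.ker p)).dual.asModuleEquiv φ)).toIntLinearMap
  map_zero' := by
    rw [LinearEquiv.symm_apply_eq, map_zero, map_zero]
    refine LinearMap.ext fun m => ?_
    obtain ⟨x, rfl⟩ := hp m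
    refine (connectingHom_apply p hp _ x).trans ?_
    rw [connectingAux_apply, LinearMap.zero_apply, Int.cast_zero, zero_div, map_zero]
    rfl
  map_add' φ ψ := by
    rw [← map_add]
    congr 1
    refine LinearMap.ext fun m => ?_
    obtain ⟨x, rfl⟩ := hp m
    refine (connectingHom_apply p hp _ x).trans ?_
    rw [map_add, connectingAux_add]
    exact (congrArg₂ (· + ·) (connectingHom_apply p hp _ x) (connectingHom_apply p hp _ x)).symm

theorem connectingAddHom_apply [Finite M] (p : P →ₗ[MonoidAlgebra ℤ G] M) (hp : Surjective p)
    (φ : DualModule G (LinearMap.ker p)) (x : P) :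
    CircleDual.toHom (connectingAddHom p hp φ) (p x) =
      unitExp (((groupRep G (LinearMap.ker p)).dual.asModuleEquiv φ
        ⟨Nat.card M • x, nsmul_mem_ker p x⟩ : ℝ) / Nat.card M) :=
  connectingHom_apply p hp _ x

/-- The connecting homomorphism from the dual of the kernel of `p : P → M` to the circle dual of
`M`. -/
def connecting [Finite M] (p : P →ₗ[MonoidAlgebra ℤ G] M) (hp : Surjective p) :
    DualModule G (LinearMap.ker p) →ₗ[MonoidAlgebra ℤ G] CircleDual G M :=
  equivariantHom (connectingAddHom p hp) fun g φ => by
    apply CircleDual.toHom.injective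
    refine LinearMap.ext fun m => ?_
    obtain ⟨x, rfl⟩ := hp m
    rw [CircleDual.smul_apply, ← map_smul p, connectingAddHom_apply, connectingAddHom_apply,
      groupRep_dual_smul]
    congr 4
    exact Subtype.ext (smul_comm _ _ _)

theorem connecting_apply [Finite M] (p : P →ₗ[MonoidAlgebra ℤ G] M) (hp : Surjective p)
    (φ : DualModule G (LinearMap.ker p)) (x : P) :
    CircleDual.toHom (connecting p hp φ) (p x) =
      unitExp (((groupRep G (LinearMap.ker p)).dual.asModuleEquiv φ
        ⟨Nat.card M • x, nsmul_mem_ker p x⟩ : ℝ) / Nat.card M) :=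
  connectingAddHom_apply p hp φ x

/-- This is 0 → P* → (ker p)* → Ext¹(M, ℤ) → 0, with Ext¹(M, ℤ) made explicit as Hom(M, ℝ/ℤ). As
|M|·P lies in the kernel, an integral functional on the kernel extends uniquely to a real functional
on P, whose reduction modulo ℤ factors through M. -/
theorem connecting_exact [Finite M] (p : P →ₗ[MonoidAlgebra ℤ G] M) (hp : Surjective p)
    [Module.Free ℤ P] :
    Injective (dualMap (LinearMap.ker p).subtype) ∧
      Exact (dualMap (LinearMap.ker p).subtype) (connecting p hp) ∧
      Surjective (connecting p hp) := by
  have hN : Nat.card M ≠ 0 := Nat.card_pos.ne'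
  have h0 : (Nat.card M : ℝ) ≠ 0 := Nat.cast_ne_zero.2 hN
  have hext : ∀ φ ψ : CircleDual G M,
      (∀ x, CircleDual.toHom φ (p x) = CircleDual.toHom ψ (p x)) → φ = ψ := fun φ ψ h => by
    apply CircleDual.toHom.injective
    refine LinearMap.ext fun m => ?_
    obtain ⟨x, rfl⟩ := hp m
    exact h x
  refine ⟨fun φ ψ h => ?_, fun φ => ⟨fun h => ?_, ?_⟩, fun ψ => ?_⟩
  -- A functional on P is determined by its values on |M|·P, which lies in the kernel of p.
  · apply (groupRep G P).dual.asModuleEquiv.injective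
    ext x
    have := congrArg (fun η => (groupRep G (LinearMap.ker p)).dual.asModuleEquiv η
      ⟨Nat.card M • x, nsmul_mem_ker p x⟩) h
    simp only [dualMap_apply, Submodule.subtype_apply, map_nsmul] at this
    exact smul_right_injective ℤ hN this
  · set φ' := (groupRep G (LinearMap.ker p)).dual.asModuleEquiv φ with hφ'
    -- Triviality of the connecting character means that φ(|M|x) is divisible by |M|. The quotient
    -- defines an integral extension of φ to P.
    have h1 : ∀ x, ∃ n : ℤ, φ' ⟨Nat.card M • x, nsmul_mem_ker p x⟩ = Nat.card M * n := fun x => by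
      have h2 := connecting_apply p hp φ x
      rw [h, map_zero, LinearMap.zero_apply, eq_comm, unitExp_eq_zero_iff] at h2
      obtain ⟨n, hn⟩ := h2
      refine ⟨n, ?_⟩
      rw [div_eq_iff h0, mul_comm] at hn
      exact_mod_cast hn
    choose n hn using h1
    let ψ : P →+ ℤ :=
      { toFun := n
        map_zero' := by
          have := hn 0
          have h2 : (⟨Nat.card M • (0 : P), nsmul_mem_ker p 0⟩ : LinearMap.ker p) = 0 :=
            Subtype.ext (smul_zero _)
          rw [h2, map_zero] at this
          exact (mul_eq_zero.1 this.symm).resolve_left (Int.natCast_ne_zero.2 hN)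
        map_add' := fun x y => by
          have h2 : (⟨Nat.card M • (x + y), nsmul_mem_ker p _⟩ : LinearMap.ker p) =
            ⟨Nat.card M • x, nsmul_mem_ker p x⟩ + ⟨Nat.card M • y, nsmul_mem_ker p y⟩ :=
            Subtype.ext (smul_add _ _ _)
          refine mul_left_cancel₀ (Int.natCast_ne_zero.2 hN) ?_
          rw [mul_add, ← hn, ← hn, ← hn, h2, map_add] }
    refine ⟨(groupRep G P).dual.asModuleEquiv.symm ψ.toIntLinearMap, ?_⟩
    apply (groupRep G (LinearMap.ker p)).dual.asModuleEquiv.injective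
    ext x
    rw [dualMap_apply, LinearEquiv.apply_symm_apply, ← hφ']
    refine mul_left_cancel₀ (Int.natCast_ne_zero.2 hN) ((hn x).symm.trans ?_)
    have : (⟨Nat.card M • (x : P), nsmul_mem_ker p x⟩ : LinearMap.ker p) = Nat.card M • x := rfl
    rw [this, map_nsmul, nsmul_eq_mul]
  · rintro ⟨ψ, rfl⟩
    refine hext _ _ fun x => ?_
    rw [connecting_apply, dualMap_apply, map_zero, LinearMap.zero_apply, unitExp_eq_zero_iff]
    refine ⟨(groupRep G P).dual.asModuleEquiv ψ x, ?_⟩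
    rw [Submodule.subtype_apply, map_nsmul, nsmul_eq_mul, Int.cast_mul, Int.cast_natCast,
      mul_div_cancel_left₀ _ h0]
  · let b := Module.Free.chooseBasis ℤ P
    -- Freeness of P allows ψ ∘ p to be lifted to a real functional l. It is integral on ker p,
    -- where ψ ∘ p is trivial, and this restriction is the required preimage.
    choose t ht using fun i => unitExp_surjective (CircleDual.toHom ψ (p (b i)))
    let l : P →ₗ[ℤ] ℝ := b.constr ℤ t
    have hl : ∀ x, unitExp (l x) = CircleDual.toHom ψ (p x) := fun x => by
      have : unitExp.toIntLinearMap ∘ₗ l =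
          CircleDual.toHom ψ ∘ₗ p.toAddMonoidHom.toIntLinearMap := by
        refine b.ext fun i => ?_
        change unitExp (l (b i)) = CircleDual.toHom ψ (p (b i))
        rw [Module.Basis.constr_basis, ht]
      exact LinearMap.congr_fun this x
    have h1 : ∀ x : LinearMap.ker p, ∃ n : ℤ, l x = n := fun x => by
      rw [← unitExp_eq_zero_iff, hl, LinearMap.mem_ker.1 x.2, map_zero]
    choose n hn using h1
    let φ : LinearMap.ker p →+ ℤ :=
      { toFun := n
        map_zero' := by
          have := hn 0
          rw [Submodule.coe_zero, map_zero] at this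
          exact_mod_cast this.symm
        map_add' := fun x y => by
          have := hn (x + y)
          rw [Submodule.coe_add, map_add, hn, hn] at this
          exact_mod_cast this.symm }
    refine ⟨(groupRep G (LinearMap.ker p)).dual.asModuleEquiv.symm φ.toIntLinearMap,
      hext _ _ fun x => ?_⟩
    rw [connecting_apply, LinearEquiv.apply_symm_apply, ← hl]
    congr 1
    change ((n ⟨Nat.card M • x, nsmul_mem_ker p x⟩ : ℤ) : ℝ) / Nat.card M = l x
    rw [← hn, map_nsmul, nsmul_eq_mul, mul_div_cancel_left₀ _ h0]

instance finite_circleDual [Finite G] (M : Type u) [AddCommGroup M] [Module (MonoidAlgebra ℤ G) M]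
    [Finite M] : Module.Finite (MonoidAlgebra ℤ G) (CircleDual G M) := by
  obtain ⟨n, p, hp⟩ := exists_cover (Λ := MonoidAlgebra ℤ G) M
  have := finite_submodule (LinearMap.ker p)
  have := projective_submodule (LinearMap.ker p)
  have := finite_of_finite_int G (finite_dual (G := G) (LinearMap.ker p))
  exact Module.Finite.of_surjective _ (connecting_exact p hp).2.2

/-- `σ[M]` for a finite module `M`. -/
theorem sigma_cls_of_finite [Finite G] (M : Type u) [AddCommGroup M]
    [Module (MonoidAlgebra ℤ G) M] [Finite M] :
    sigma G (G0.cls (MonoidAlgebra ℤ G) M) = -G0.cls (MonoidAlgebra ℤ G) (CircleDual G M) := by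
  obtain ⟨n, p, hp⟩ := exists_cover (Λ := MonoidAlgebra ℤ G) M
  have := finite_submodule (LinearMap.ker p)
  have := projective_submodule (LinearMap.ker p)
  have := finite_of_finite_int G (finite_dual (G := G) (LinearMap.ker p))
  have := finite_of_finite_int G (finite_dual (G := G) (Fin n → MonoidAlgebra ℤ G))
  obtain ⟨h1, h2, h3⟩ := connecting_exact p hp
  have e1 := G0.cls_add (LinearMap.ker p).subtype p Subtype.val_injective
    (LinearMap.exact_subtype_ker_map p) hp
  have e2 := G0.cls_add _ _ h1 h2 h3
  -- In terms of a free cover P of M, [M] = [P] - [ker p], while the circle dual has class [(ker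
  -- p)*] - [P*]. Applying σ to the first equality gives the sign.
  rw [← eq_sub_iff_add_eq'] at e1 e2
  rw [e1, e2, map_sub, sigma_cls, sigma_cls, neg_sub]

end CircleDual

/-! ### The algebra F_ℝ and its components at the places -/

section RealAlgebra

open NumberField TensorProduct
open scoped ComplexConjugate

variable {F : Type u} [Field F] [NumberField F]

instance finite_FR : Module.Finite ℝ (FR F) := inferInstanceAs (Module.Finite ℝ (ℝ ⊗[ℚ] F))

instance isTopologicalRing_FR : IsTopologicalRing (FR F) := IsModuleTopology.isTopologicalRing ℝ (FR F)

theorem FR_algHom_ext {B : Type*} [Ring B] [Algebra ℝ B] {f g : FR F →ₐ[ℝ] B}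
    (h : ∀ x, f (toFR F x) = g (toFR F x)) : f = g := by
  let _ : Algebra ℚ B := Algebra.compHom B (algebraMap ℚ ℝ)
  have : IsScalarTower ℚ ℝ B := IsScalarTower.of_algebraMap_eq fun _ => rfl
  have : ∀ f g : ℝ ⊗[ℚ] F →ₐ[ℝ] B, (∀ x : F, f (1 ⊗ₜ x) = g (1 ⊗ₜ x)) → f = g :=
    fun f g h => Algebra.TensorProduct.ext (by ext) (AlgHom.ext h)
  exact this f g h

/-- The `ℝ`-algebra homomorphism `F_ℝ → B` extending a ring homomorphism `F → B`. -/
def liftFR {B : Type*} [CommRing B] [Algebra ℚ B] [Algebra ℝ B] [IsScalarTower ℚ ℝ B] (φ : F →+* B) :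
    FR F →ₐ[ℝ] B :=
  (Algebra.TensorProduct.lift (Algebra.ofId ℝ B) φ.toRatAlgHom fun _ _ => Commute.all _ _ :
    ℝ ⊗[ℚ] F →ₐ[ℝ] B)

@[simp]
theorem liftFR_toFR {B : Type*} [CommRing B] [Algebra ℚ B] [Algebra ℝ B] [IsScalarTower ℚ ℝ B]
    (φ : F →+* B) (x : F) : liftFR φ (toFR F x) = φ x := by
  change Algebra.TensorProduct.lift (Algebra.ofId ℝ B) φ.toRatAlgHom _ ((1 : ℝ) ⊗ₜ[ℚ] x) = φ x
  rw [Algebra.TensorProduct.lift_tmul, map_one, one_mul]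
  rfl

/-- The `ℝ`-algebra homomorphism `F_ℝ → ℂ` extending an embedding of `F`. -/
def embFR (φ : F →+* ℂ) : FR F →ₐ[ℝ] ℂ := liftFR φ

@[simp]
theorem embFR_toFR (φ : F →+* ℂ) (x : F) : embFR φ (toFR F x) = φ x := liftFR_toFR φ x

theorem eq_embFR (ψ : FR F →ₐ[ℝ] ℂ) : ψ = embFR ((ψ : FR F →+* ℂ).comp (toFR F)) :=
  FR_algHom_ext fun x => by rw [embFR_toFR]; rfl

theorem embFR_conjugate (φ : F →+* ℂ) (x : FR F) :
    embFR (ComplexEmbedding.conjugate φ) x = conj (embFR φ x) := by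
  have : embFR (ComplexEmbedding.conjugate φ) = (Complex.conjAe : ℂ →ₐ[ℝ] ℂ).comp (embFR φ) :=
    FR_algHom_ext fun x => by
      rw [embFR_toFR, AlgHom.comp_apply, embFR_toFR]
      rfl
  rw [this]
  rfl

theorem embFR_mapFR {K : Type v} [Field K] [Algebra K F] (g : F ≃ₐ[K] F) (φ : F →+* ℂ) (x : FR F) :
    embFR φ (mapFR K g x) = embFR (φ.comp (g : F →+* F)) x := by
  have : (embFR φ).comp (mapFR K g : FR F →ₐ[ℝ] FR F) = embFR (φ.comp (g : F →+* F)) :=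
    FR_algHom_ext fun x => by
      rw [AlgHom.comp_apply, embFR_toFR]
      change embFR φ (mapFR K g (toFR F x)) = _
      rw [mapFR_toFR, embFR_toFR]
      rfl
  rw [← this]
  rfl

variable (F) in
/-- The isomorphism of `F_ℝ` with the mixed space `ℝ^r₁ × ℂ^r₂`. -/
def mixedFR : FR F ≃ₐ[ℝ] mixedEmbedding.mixedSpace F :=
  AlgEquiv.ofBijective (liftFR (mixedEmbedding F)) (by
    -- An integral basis of F is a real basis of ℝ ⊗ F, and its image is the lattice basis of the
    -- mixed space, so the map is bijective.
    let b : Module.Basis _ ℝ (FR F) := Algebra.TensorProduct.basis ℝ (integralBasis F)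
    let E := b.equiv (mixedEmbedding.latticeBasis F) (Equiv.refl _)
    have : (liftFR (mixedEmbedding F) : FR F →ₐ[ℝ] _).toLinearMap = E.toLinearMap := by
      refine b.ext fun i => ?_
      rw [LinearEquiv.coe_coe, Module.Basis.equiv_apply, mixedEmbedding.latticeBasis_apply]
      have : b i = toFR F (integralBasis F i) := Algebra.TensorProduct.basis_apply _ i
      rw [this]
      exact liftFR_toFR _ _
    have h : ⇑(liftFR (mixedEmbedding F) : FR F →ₐ[ℝ] _) = E := funext fun x => LinearMap.congr_fun this x
    rw [h]
    exact E.bijective)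

theorem mixedFR_toFR (x : F) : mixedFR F (toFR F x) = mixedEmbedding F x :=
  liftFR_toFR (mixedEmbedding F) x

theorem mixedFR_fst (x : FR F) (w : {w : InfinitePlace F // w.IsReal}) :
    ((mixedFR F x).1 w : ℂ) = embFR w.1.embedding x := by
  have : (((Complex.ofRealAm.comp (Pi.evalAlgHom ℝ (fun _ : {w : InfinitePlace F // w.IsReal} => ℝ) w)).comp
      (AlgHom.fst ℝ _ ({w : InfinitePlace F // w.IsComplex} → ℂ))).comp (mixedFR F : FR F →ₐ[ℝ] _)) =
      embFR w.1.embedding := FR_algHom_ext fun x => by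
    rw [embFR_toFR]
    change (((mixedFR F (toFR F x)).1 w : ℝ) : ℂ) = _
    rw [mixedFR_toFR, mixedEmbedding.mixedEmbedding_apply_isReal,
      InfinitePlace.embedding_of_isReal_apply]
  rw [← this]
  rfl

theorem mixedFR_snd (x : FR F) (w : {w : InfinitePlace F // w.IsComplex}) :
    (mixedFR F x).2 w = embFR w.1.embedding x := by
  have : ((Pi.evalAlgHom ℝ (fun _ : {w : InfinitePlace F // w.IsComplex} => ℂ) w).comp
      (AlgHom.snd ℝ ({w : InfinitePlace F // w.IsReal} → ℝ) _)).comp (mixedFR F : FR F →ₐ[ℝ] _) =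
      embFR w.1.embedding := FR_algHom_ext fun x => by
    rw [embFR_toFR]
    change (mixedFR F (toFR F x)).2 w = _
    rw [mixedFR_toFR, mixedEmbedding.mixedEmbedding_apply_isComplex]
  rw [← this]
  rfl

theorem embFR_im_of_isReal (x : FR F) {w : InfinitePlace F} (hw : w.IsReal) :
    (embFR w.embedding x).im = 0 := by
  rw [← mixedFR_fst x ⟨w, hw⟩, Complex.ofReal_im]

theorem FR_ext {x y : FR F} (h : ∀ w : InfinitePlace F, embFR w.embedding x = embFR w.embedding y) :
    x = y := by
  refine (mixedFR F).injective (Prod.ext (funext fun w => ?_) (funext fun w => ?_))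
  · have := h w.1
    rw [← mixedFR_fst x w, ← mixedFR_fst y w] at this
    exact_mod_cast this
  · rw [mixedFR_snd, mixedFR_snd, h]

variable (F) in
/-- The element of `F_ℝ` with given components, of which only the real parts matter at the real
places. -/
def mkFR : (InfinitePlace F → ℂ) →ₗ[ℝ] FR F :=
  (mixedFR F).symm.toLinearMap.comp
    { toFun := fun z => (fun w => (z w.1).re, fun w => z w.1)
      map_add' := fun _ _ => rfl
      map_smul' := fun r z => Prod.ext (funext fun w => by simp) rfl }

theorem embFR_mkFR {z : InfinitePlace F → ℂ} {w : InfinitePlace F} (h : w.IsReal → (z w).im = 0) :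
    embFR w.embedding (mkFR F z) = z w := by
  have h0 : mixedFR F (mkFR F z) = (fun w => (z w.1).re, fun w => z w.1) :=
    (mixedFR F).apply_symm_apply _
  rcases w.isReal_or_isComplex with hw | hw
  · rw [← mixedFR_fst _ ⟨w, hw⟩, h0]
    exact Complex.ext rfl (h hw).symm
  · rw [← mixedFR_snd _ ⟨w, hw⟩, h0]

theorem continuous_mkFR : Continuous (mkFR F) := by
  have : ContinuousSMul ℝ (FR F) := IsModuleTopology.toContinuousSMul ℝ (FR F)
  exact (mkFR F).continuous_of_finiteDimensional

theorem continuous_embFR (φ : F →+* ℂ) : Continuous (embFR φ) :=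
  IsModuleTopology.continuous_of_linearMap (embFR φ).toLinearMap

theorem norm_embFR_mk (φ : F →+* ℂ) (x : FR F) :
    ‖embFR (InfinitePlace.mk φ).embedding x‖ = ‖embFR φ x‖ := by
  rcases InfinitePlace.embedding_mk_eq φ with h | h
  · rw [h]
  · rw [h, embFR_conjugate, RCLike.norm_conj]

theorem normAtPlace_mixedFR (w : InfinitePlace F) (x : FR F) :
    mixedEmbedding.normAtPlace w (mixedFR F x) = ‖embFR w.embedding x‖ := by
  rcases w.isReal_or_isComplex with hw | hw
  · rw [mixedEmbedding.normAtPlace_apply_of_isReal hw, ← mixedFR_fst _ ⟨w, hw⟩, Complex.norm_real]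
  · rw [mixedEmbedding.normAtPlace_apply_of_isComplex hw, mixedFR_snd]

/-- Multiplication by x acts factor by factor, so its determinant is a product. A complex factor
contributes |z|², matching the multiplicity 2. -/
theorem abs_norm_mixedSpace (x : mixedEmbedding.mixedSpace F) :
    |Algebra.norm ℝ x| = mixedEmbedding.norm x := by
  classical
  have h : Algebra.lmul ℝ (mixedEmbedding.mixedSpace F) x =
      LinearMap.prodMap (LinearMap.pi fun i => Algebra.lmul ℝ ℝ (x.1 i) ∘ₗ LinearMap.proj i)
        (LinearMap.pi fun i => Algebra.lmul ℝ ℂ (x.2 i) ∘ₗ LinearMap.proj i) :=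
    LinearMap.ext fun y => rfl
  rw [Algebra.norm_apply, h, LinearMap.det_prodMap, LinearMap.det_pi, LinearMap.det_pi]
  simp only [← Algebra.norm_apply]
  rw [mixedEmbedding.norm_apply, InfinitePlace.prod_eq_prod_mul_prod, abs_mul, Finset.abs_prod, Finset.abs_prod]
  congr 1
  · refine Finset.prod_congr rfl fun w _ => ?_
    rw [mixedEmbedding.normAtPlace_apply_of_isReal w.2, InfinitePlace.mult, if_pos w.2, pow_one,
      Algebra.norm_self, MonoidHom.id_apply, Real.norm_eq_abs]
  · refine Finset.prod_congr rfl fun w _ => ?_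
    rw [mixedEmbedding.normAtPlace_apply_of_isComplex w.2, InfinitePlace.mult,
      if_neg (InfinitePlace.not_isReal_iff_isComplex.2 w.2), Algebra.norm_complex_apply,
      Complex.normSq_eq_norm_sq, abs_of_nonneg (sq_nonneg _)]

theorem abs_norm_FR (x : FR F) :
    |Algebra.norm ℝ x| = ∏ w : InfinitePlace F, ‖embFR w.embedding x‖ ^ w.mult := by
  rw [← Algebra.norm_eq_of_algEquiv (mixedFR F), abs_norm_mixedSpace, mixedEmbedding.norm_apply]
  simp only [normAtPlace_mixedFR]

variable (F) in
/-- The families of nonzero complex numbers indexed by the infinite places which are real at the real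
places. -/
def realFamilies : Subgroup (InfinitePlace F → ℂˣ) where
  carrier := {z | ∀ w : InfinitePlace F, w.IsReal → (z w : ℂ).im = 0}
  one_mem' _ _ := Complex.one_im
  mul_mem' {a b} ha hb w hw := by
    rw [Pi.mul_apply, Units.val_mul, Complex.mul_im, ha w hw, hb w hw, mul_zero, zero_mul, add_zero]
  inv_mem' {a} ha w hw := by
    rw [Pi.inv_apply, Units.val_inv_eq_inv_val, Complex.inv_im, ha w hw, neg_zero, zero_div]

variable (F) in
/-- The unit of `F_ℝ` with given components. -/
def unitsMk : realFamilies F →* (FR F)ˣ :=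
  MonoidHom.toHomUnits
    { toFun := fun z => mkFR F fun w => z.1 w
      map_one' := FR_ext fun w => by
        rw [embFR_mkFR fun hw => (1 : realFamilies F).2 w hw, map_one]
        rfl
      map_mul' := fun a b => FR_ext fun w => by
        rw [embFR_mkFR fun hw => (a * b).2 w hw, map_mul, embFR_mkFR fun hw => a.2 w hw,
          embFR_mkFR fun hw => b.2 w hw]
        rfl }

theorem embFR_unitsMk (z : realFamilies F) (w : InfinitePlace F) :
    embFR w.embedding (unitsMk F z : FR F) = z.1 w :=
  embFR_mkFR fun hw => z.2 w hw

theorem continuous_unitsMk : Continuous (unitsMk F) := by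
  have h : Continuous fun z : realFamilies F => (unitsMk F z : FR F) :=
    continuous_mkFR.comp (continuous_pi fun w =>
      Units.continuous_val.comp ((continuous_apply w).comp continuous_subtype_val))
  refine Units.continuous_iff.2 ⟨h, ?_⟩
  simp only [← map_inv]
  exact h.comp continuous_inv

theorem units_ext {u v : (FR F)ˣ}
    (h : ∀ w : InfinitePlace F, embFR w.embedding (u : FR F) = embFR w.embedding (v : FR F)) : u = v :=
  Units.ext (FR_ext h)

/-- Every real algebra map F_ℝ → ℂ comes from an embedding of F, and conjugate embeddings give the
same absolute value. One embedding per place therefore suffices. -/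
theorem mem_compactUnits_iff (u : (FR F)ˣ) :
    u ∈ compactUnits F ↔ ∀ w : InfinitePlace F, ‖embFR w.embedding (u : FR F)‖ = 1 := by
  refine ⟨fun h w => h _, fun h φ => ?_⟩
  rw [eq_embFR φ, ← norm_embFR_mk]
  exact h _

theorem abs_norm_of_mem_compactUnits {u : (FR F)ˣ} (hu : u ∈ compactUnits F) :
    |Algebra.norm ℝ (u : FR F)| = 1 := by
  rw [abs_norm_FR]
  exact Finset.prod_eq_one fun w _ => by rw [(mem_compactUnits_iff u).1 hu w, one_pow]

end RealAlgebra

/-! ### Continuous characters of vector spaces and of the circle -/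

section Characters

/-- Continuous characters of a real vector space are exponentials of linear functionals. -/
theorem exists_linear_of_character {E : Type*} [NormedAddCommGroup E] [NormedSpace ℝ E]
    (f : E → Circle) (hf : Continuous f) (hadd : ∀ x y, f (x + y) = f x * f y) :
    ∃ l : E →ₗ[ℝ] ℝ, ∀ x, f x = Circle.exp (l x) := by
  have h0 : f 0 = 1 := by
    have := hadd 0 0
    rwa [add_zero, left_eq_mul] at this
  -- The space E is simply connected, so f lifts through the covering t ↦ exp(it), with g(0) = 0.
  obtain ⟨g, ⟨hg0, hg⟩, -⟩ := Circle.isCoveringMap_exp.existsUnique_continuousMap_lifts ⟨f, hf⟩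
    (0 : E) (0 : ℝ) (by rw [Circle.exp_zero, ContinuousMap.coe_mk, h0])
  have hg' : ∀ x, Circle.exp (g x) = f x := fun x => congrFun hg x
  -- Both sides lift the same map on the connected space E × E and agree at the origin.
  have hadd' : (fun p : E × E => g (p.1 + p.2)) = fun p => g p.1 + g p.2 := by
    refine Circle.isCoveringMap_exp.eq_of_comp_eq (by fun_prop) (by fun_prop) (funext fun p => ?_)
      (0 : E × E) (by simp [hg0])
    rw [Function.comp_apply, Function.comp_apply, Circle.exp_add, hg', hg', hg', hadd]
  let g' : E →+ ℝ := ⟨⟨g, hg0⟩, fun x y => congrFun hadd' (x, y)⟩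
  exact ⟨(g'.toRealLinearMap g.continuous).toLinearMap, fun x => (hg' x).symm⟩

/-- A nonzero functional takes the value 1, which is not an integral multiple of 2π. -/
theorem linear_eq_zero_of_exp {E : Type*} [AddCommGroup E] [Module ℝ E] (l : E →ₗ[ℝ] ℝ)
    (h : ∀ x, Circle.exp (l x) = 1) : l = 0 := by
  refine LinearMap.ext fun x => ?_
  by_contra hx
  have hx : l x ≠ 0 := hx
  have h1 := h ((l x)⁻¹ • x)
  rw [map_smul, smul_eq_mul, inv_mul_cancel₀ hx, Circle.exp_eq_one] at h1
  obtain ⟨n, hn⟩ := h1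
  have hpi := Real.pi_gt_three
  rcases lt_trichotomy n 0 with h2 | h2 | h2
  · have : (n : ℝ) ≤ -1 := by exact_mod_cast Int.le_sub_one_of_lt h2
    nlinarith
  · rw [h2, Int.cast_zero, zero_mul] at hn
    exact one_ne_zero hn
  · have : (1 : ℝ) ≤ n := by exact_mod_cast h2
    nlinarith

/-- Continuous characters of the circle are powers. -/
theorem exists_zpow_of_character (f : Circle →* Circle) (hf : Continuous f) :
    ∃ n : ℤ, ∀ z, f z = z ^ n := by
  obtain ⟨l, hl⟩ := exists_linear_of_character (E := ℝ) (fun t => f (Circle.exp t))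
    (hf.comp Circle.exp.continuous) fun x y => by rw [Circle.exp_add, map_mul]
  have h1 : ∀ t, l t = t * l 1 := fun t => by
    rw [← smul_eq_mul, ← map_smul, smul_eq_mul, mul_one]
  -- Periodicity forces l(2π) = 2πn, so the slope l(1) is the integer n.
  have h2 := hl (2 * Real.pi)
  rw [Circle.exp_two_pi, map_one, eq_comm, Circle.exp_eq_one, h1] at h2
  obtain ⟨n, hn⟩ := h2
  have hn' : l 1 = n := by
    rw [mul_comm] at hn
    exact mul_right_cancel₀ Real.two_pi_pos.ne' hn
  refine ⟨n, fun z => ?_⟩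
  obtain ⟨t, rfl⟩ := Circle.exp_surjective z
  rw [hl, h1, hn', mul_comm, Circle.exp_intCast_mul]

theorem eq_zero_of_forall_zpow (n : ℤ) (h : ∀ z : Circle, z ^ n = 1) : n = 0 := by
  have h1 := linear_eq_zero_of_exp ((n : ℝ) • LinearMap.id : ℝ →ₗ[ℝ] ℝ) fun x => by
    rw [LinearMap.smul_apply, LinearMap.id_apply, smul_eq_mul, Circle.exp_intCast_mul, h]
  have h2 := LinearMap.congr_fun h1 1
  rw [LinearMap.smul_apply, LinearMap.id_apply, smul_eq_mul, mul_one, LinearMap.zero_apply] at h2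
  exact_mod_cast h2

end Characters

/-! ### Pontryagin duals as Galois modules -/

section DualMod

variable (G : Type u) [Group G] (X : Type u) [CommGroup X] [TopologicalSpace X]
  [MulDistribMulAction G X] [ContinuousConstSMul G X]

/-- The Pontryagin dual of `X` as a `ℤ[G]`-module. -/
abbrev DualMod : Type u := (Representation.ofMulDistribMulAction G (PontryaginDual X)).asModule

variable {G X}

/-- The character underlying an element of `DualMod G X`. -/
def DualMod.char (χ : DualMod G X) : PontryaginDual X :=
  Additive.toMul ((Representation.ofMulDistribMulAction G (PontryaginDual X)).asModuleEquiv χ)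

/-- The element of `DualMod G X` given by a character. -/
def DualMod.mk (χ : PontryaginDual X) : DualMod G X :=
  (Representation.ofMulDistribMulAction G (PontryaginDual X)).asModuleEquiv.symm (Additive.ofMul χ)

theorem DualMod.ext {χ ψ : DualMod G X} (h : ∀ x, DualMod.char χ x = DualMod.char ψ x) : χ = ψ :=
  (Representation.ofMulDistribMulAction G (PontryaginDual X)).asModuleEquiv.injective
    (PontryaginDual.ext h : DualMod.char χ = DualMod.char ψ)

/-- Evaluation of characters at an element. -/
def DualMod.eval (x : X) : DualMod G X →+ Additive Circle where
  toFun χ := Additive.ofMul (DualMod.char χ x)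
  map_zero' := rfl
  map_add' _ _ := rfl

@[simp]
theorem DualMod.char_zero (x : X) : DualMod.char (0 : DualMod G X) x = 1 := rfl

theorem DualMod.char_zsmul (n : ℤ) (χ : DualMod G X) (x : X) :
    DualMod.char (n • χ) x = DualMod.char χ x ^ n :=
  congrArg Additive.toMul (map_zsmul (DualMod.eval x) n χ)

theorem DualMod.char_sum {ι : Type*} (s : Finset ι) (χ : ι → DualMod G X) (x : X) :
    DualMod.char (∑ i ∈ s, χ i) x = ∏ i ∈ s, DualMod.char (χ i) x :=
  (congrArg Additive.toMul (map_sum (DualMod.eval x) χ s)).trans (toMul_sum _ _)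

theorem DualMod.char_smul (g : G) (χ : DualMod G X) (x : X) :
    DualMod.char (MonoidAlgebra.single g (1 : ℤ) • χ) x = DualMod.char χ (g⁻¹ • x) := by
  rw [asModule_smul]
  rfl

/-- Pullback of characters along a continuous equivariant homomorphism. -/
def DualMod.pullback {Y : Type u} [CommGroup Y] [TopologicalSpace Y] [MulDistribMulAction G Y]
    [ContinuousConstSMul G Y] (f : X →ₜ* Y) (hf : ∀ (g : G) (x : X), f (g • x) = g • f x) :
    DualMod G Y →ₗ[MonoidAlgebra ℤ G] DualMod G X :=
  equivariantHom (M := DualMod G Y) (N := DualMod G X)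
    { toFun := fun χ => DualMod.mk (PontryaginDual.map f (DualMod.char χ))
      map_zero' := DualMod.ext fun x => rfl
      map_add' := fun χ ψ => DualMod.ext fun x => rfl }
    fun g χ => DualMod.ext fun x => by
      rw [DualMod.char_smul]
      change DualMod.char (MonoidAlgebra.single g (1 : ℤ) • χ) (f x) = DualMod.char χ (f (g⁻¹ • x))
      rw [DualMod.char_smul, hf]

end DualMod

/-! ### The Galois module of complex embeddings -/

section Embeddings

open NumberField

variable (K : Type v) {F : Type u} [Field K] [Field F] [Algebra K F]

/-- `G` acts on the embeddings of `F` by `g • φ = φ ∘ g⁻¹`. -/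
instance embAction : MulAction Gal(F/K) (F →+* ℂ) where
  smul g φ := φ.comp (g⁻¹ : Gal(F/K))
  one_smul φ := RingHom.ext fun x => by
    change φ ((1 : Gal(F/K))⁻¹ x) = φ x
    rw [inv_one]
    rfl
  mul_smul g h φ := RingHom.ext fun x => by
    change φ ((g * h)⁻¹ x) = φ (h⁻¹ (g⁻¹ x))
    rw [mul_inv_rev]
    rfl

theorem embAction_conjugate (g : Gal(F/K)) (φ : F →+* ℂ) :
    g • ComplexEmbedding.conjugate φ = ComplexEmbedding.conjugate (g • φ) := rfl

theorem smul_mk_eq (g : Gal(F/K)) (φ : F →+* ℂ) :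
    g • InfinitePlace.mk φ = InfinitePlace.mk (g • φ) := InfinitePlace.smul_mk g φ

theorem smul_embedding_injective (φ : F →+* ℂ) : Injective fun g : Gal(F/K) => g • φ := by
  intro g h hgh
  refine inv_injective (AlgEquiv.ext fun x => φ.injective ?_)
  exact RingHom.congr_fun hgh x

theorem exists_smul_eq [IsGalois K F] {φ ψ : F →+* ℂ}
    (h : φ.comp (algebraMap K F) = ψ.comp (algebraMap K F)) : ∃ g : Gal(F/K), g • φ = ψ := by
  obtain ⟨σ, hσ⟩ := ComplexEmbedding.exists_comp_symm_eq_of_comp_eq φ ψ h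
  exact ⟨σ, hσ⟩

variable [NumberField F]

theorem embFR_inv_smul (g : Gal(F/K)) (φ : F →+* ℂ) (u : (FR F)ˣ) :
    embFR φ ((g⁻¹ • u : (FR F)ˣ) : FR F) = embFR (g • φ) (u : FR F) :=
  embFR_mapFR g⁻¹ φ (u : FR F)

variable [NumberField K] [IsGalois K F]

/-- The module `ℤ[Hom(F, ℂ)]` is free of rank `[K : ℚ]`. -/
theorem cls_permModule_embeddings :
    G0.cls (GalRing K F) (PermModule Gal(F/K) (F →+* ℂ)) =
      Module.finrank ℚ K • G0.cls (GalRing K F) (GalRing K F) := by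
  classical
  -- One extension to F is chosen for each embedding τ of K. As G acts simply transitively on the
  -- extensions of τ, the pairs (τ, g) parametrise all embeddings of F, and ℤ[Hom(F,ℂ)] has one copy
  -- of ℤ[G] for each τ.
  let Φ : (K →+* ℂ) → (F →+* ℂ) := fun τ => ComplexEmbedding.lift F τ
  have hΦ : ∀ τ, (Φ τ).comp (algebraMap K F) = τ := fun τ => ComplexEmbedding.lift_comp_algebraMap F τ
  have hres : ∀ (g : Gal(F/K)) (φ : F →+* ℂ), (g • φ).comp (algebraMap K F) = φ.comp (algebraMap K F) :=
    fun g φ => RingHom.ext fun x => by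
      change φ (g⁻¹ (algebraMap K F x)) = _
      rw [AlgEquiv.commutes]
      rfl
  let e : (Σ _ : (K →+* ℂ), Gal(F/K)) ≃ (F →+* ℂ) := Equiv.ofBijective (fun p => p.2 • Φ p.1) <| by
    refine ⟨?_, fun φ => ?_⟩
    · rintro ⟨τ, g⟩ ⟨τ', g'⟩ h
      have h' : g • Φ τ = g' • Φ τ' := h
      obtain rfl : τ = τ' := by rw [← hΦ τ, ← hres g, h', hres, hΦ]
      obtain rfl := smul_embedding_injective K (Φ τ) h'
      rfl
    · obtain ⟨g, hg⟩ := exists_smul_eq K (hΦ (φ.comp (algebraMap K F)))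
      exact ⟨⟨_, g⟩, hg⟩
  let b₀ : Module.Basis Gal(F/K) ℤ (GalRing K F) := .ofRepr (MonoidAlgebra.coeffLinearEquiv ℤ)
  have hb₀ : ∀ g, b₀ g = MonoidAlgebra.single g 1 := fun g => rfl
  let b : Module.Basis _ ℤ ((K →+* ℂ) → GalRing K F) := Pi.basis fun _ => b₀
  let E : ((K →+* ℂ) → GalRing K F) ≃ₗ[ℤ] PermModule Gal(F/K) (F →+* ℂ) :=
    b.equiv (permBasis Gal(F/K) (F →+* ℂ)) e
  have hE : ∀ (g : Gal(F/K)) x, E ((MonoidAlgebra.single g 1 : GalRing K F) • x) =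
      (MonoidAlgebra.single g 1 : GalRing K F) • E x := by
    intro g x
    let L : ((K →+* ℂ) → GalRing K F) →ₗ[ℤ] ((K →+* ℂ) → GalRing K F) :=
      (DistribSMul.toAddMonoidHom _ (MonoidAlgebra.single g 1 : GalRing K F)).toIntLinearMap
    let R : PermModule Gal(F/K) (F →+* ℂ) →ₗ[ℤ] PermModule Gal(F/K) (F →+* ℂ) :=
      groupRep Gal(F/K) _ g
    have : E.toLinearMap ∘ₗ L = R ∘ₗ E.toLinearMap := by
      refine b.ext fun p => ?_
      have h1 : L (b p) = b ⟨p.1, g * p.2⟩ := by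
        change (MonoidAlgebra.single g 1 : GalRing K F) • b p = _
        rw [Pi.basis_apply, Pi.basis_apply, hb₀, hb₀, ← Pi.single_smul, smul_eq_mul,
          MonoidAlgebra.single_mul_single, one_mul]
      rw [LinearMap.comp_apply, h1, LinearMap.comp_apply, LinearEquiv.coe_coe,
        Module.Basis.equiv_apply, Module.Basis.equiv_apply]
      refine (congrArg _ ?_).trans (single_smul_permBasis g (e p)).symm
      exact mul_smul g p.2 (Φ p.1)
    exact LinearMap.congr_fun this x
  have h := G0.cls_pi (Λ := GalRing K F) (K →+* ℂ) (GalRing K F) (PermModule Gal(F/K) (F →+* ℂ))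
    (LinearEquiv.ofBijective (equivariantHom (G := Gal(F/K)) E.toAddEquiv.toAddMonoidHom hE) E.bijective).symm
  rwa [Nat.card_eq_fintype_card, Embeddings.card] at h

end Embeddings

/-! ### Phases and characters of the compact units -/

section Phases

open NumberField
open scoped ComplexConjugate

variable {F : Type u} [Field F] [NumberField F]

theorem embFR_units_ne_zero (φ : F →+* ℂ) (u : (FR F)ˣ) : embFR φ (u : FR F) ≠ 0 :=
  (Units.map (embFR φ : FR F →* ℂ) u).ne_zero

/-- The phase `φ(u) / |φ(u)|` of a unit of `F_ℝ` at an embedding. -/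
def phase (φ : F →+* ℂ) : (FR F)ˣ →* Circle where
  toFun u := ⟨embFR φ (u : FR F) / ‖embFR φ (u : FR F)‖, mem_sphere_zero_iff_norm.2 (by
    rw [norm_div, Complex.norm_real, norm_norm,
      div_self (norm_ne_zero_iff.2 (embFR_units_ne_zero φ u))])⟩
  map_one' := Circle.ext (by simp)
  map_mul' u v := Circle.ext (by
    change embFR φ ((u * v : (FR F)ˣ) : FR F) / (‖embFR φ ((u * v : (FR F)ˣ) : FR F)‖ : ℂ) =
      (embFR φ (u : FR F) / (‖embFR φ (u : FR F)‖ : ℂ)) *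
        (embFR φ (v : FR F) / (‖embFR φ (v : FR F)‖ : ℂ))
    rw [Units.val_mul, map_mul, norm_mul, Complex.ofReal_mul, mul_div_mul_comm])

theorem coe_phase (φ : F →+* ℂ) (u : (FR F)ˣ) :
    (phase φ u : ℂ) = embFR φ (u : FR F) / ‖embFR φ (u : FR F)‖ := rfl

theorem coe_phase_of_mem (φ : F →+* ℂ) {u : (FR F)ˣ} (hu : u ∈ compactUnits F) :
    (phase φ u : ℂ) = embFR φ (u : FR F) := by
  rw [coe_phase, hu (embFR φ), Complex.ofReal_one, div_one]

theorem continuous_phase (φ : F →+* ℂ) : Continuous (phase φ) := by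
  have h : Continuous fun u : (FR F)ˣ => embFR φ (u : FR F) :=
    (continuous_embFR φ).comp Units.continuous_val
  exact (h.div (Complex.continuous_ofReal.comp h.norm) fun u => Complex.ofReal_ne_zero.2
    (norm_ne_zero_iff.2 (embFR_units_ne_zero φ u))).subtype_mk _

theorem phase_conjugate (φ : F →+* ℂ) (u : (FR F)ˣ) :
    phase (ComplexEmbedding.conjugate φ) u = (phase φ u)⁻¹ := by
  refine Circle.ext ?_
  rw [Circle.coe_inv_eq_conj, coe_phase, coe_phase, embFR_conjugate, RCLike.norm_conj, map_div₀,
    Complex.conj_ofReal]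

theorem phase_inv_smul {K : Type v} [Field K] [Algebra K F] (g : Gal(F/K)) (φ : F →+* ℂ)
    (u : (FR F)ˣ) : phase φ (g⁻¹ • u) = phase (g • φ) u :=
  Circle.ext (by rw [coe_phase, coe_phase, embFR_inv_smul])

open Classical in
theorem mulSingle_mem_realFamilies {w : InfinitePlace F} {z : Circle}
    (hz : w.IsReal → (z : ℂ).im = 0) :
    (Pi.mulSingle w (Circle.toUnits z) : InfinitePlace F → ℂˣ) ∈ realFamilies F := fun w' hw' => by
  rcases eq_or_ne w' w with rfl | h
  · rw [Pi.mulSingle_eq_same]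
    exact hz hw'
  · rw [Pi.mulSingle_eq_of_ne h]
    exact Complex.one_im

open Classical in
theorem embFR_unitsMk_mulSingle_self {w : InfinitePlace F} {z : Circle}
    (hz : w.IsReal → (z : ℂ).im = 0) :
    embFR w.embedding (unitsMk F ⟨_, mulSingle_mem_realFamilies hz⟩ : FR F) = z :=
  (embFR_unitsMk _ w).trans
    (congrArg Units.val (Pi.mulSingle_eq_same (M := fun _ => ℂˣ) w (Circle.toUnits z)))

open Classical in
theorem embFR_unitsMk_mulSingle_of_ne {w w' : InfinitePlace F} (h : w' ≠ w) {z : Circle}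
    (hz : w.IsReal → (z : ℂ).im = 0) :
    embFR w'.embedding (unitsMk F ⟨_, mulSingle_mem_realFamilies hz⟩ : FR F) = 1 :=
  (embFR_unitsMk _ w').trans
    (congrArg Units.val (Pi.mulSingle_eq_of_ne (M := fun _ => ℂˣ) h (Circle.toUnits z)))

open Classical in
/-- The compact unit with component `z` at `w` and components `1` elsewhere. -/
def singleUnit (w : InfinitePlace F) (z : Circle) (hz : w.IsReal → (z : ℂ).im = 0) :
    compactUnits F :=
  ⟨unitsMk F ⟨_, mulSingle_mem_realFamilies hz⟩, (mem_compactUnits_iff _).2 fun w' => by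
    rcases eq_or_ne w' w with rfl | h
    · rw [embFR_unitsMk_mulSingle_self hz]
      exact z.norm_coe
    · rw [embFR_unitsMk_mulSingle_of_ne h hz]
      exact norm_one⟩

theorem embFR_singleUnit_self (w : InfinitePlace F) (z : Circle) (hz : w.IsReal → (z : ℂ).im = 0) :
    embFR w.embedding ((singleUnit w z hz : (FR F)ˣ) : FR F) = z :=
  embFR_unitsMk_mulSingle_self hz

theorem embFR_singleUnit_of_ne {w w' : InfinitePlace F} (h : w' ≠ w) (z : Circle)
    (hz : w.IsReal → (z : ℂ).im = 0) :
    embFR w'.embedding ((singleUnit w z hz : (FR F)ˣ) : FR F) = 1 :=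
  embFR_unitsMk_mulSingle_of_ne h hz

theorem phase_singleUnit_self (w : InfinitePlace F) (z : Circle) (hz : w.IsReal → (z : ℂ).im = 0) :
    phase w.embedding (singleUnit w z hz : (FR F)ˣ) = z :=
  Circle.ext (by rw [coe_phase_of_mem _ (singleUnit w z hz).2, embFR_singleUnit_self])

theorem phase_singleUnit_of_ne {w : InfinitePlace F} {φ : F →+* ℂ} (h : InfinitePlace.mk φ ≠ w)
    (z : Circle) (hz : w.IsReal → (z : ℂ).im = 0) :
    phase φ (singleUnit w z hz : (FR F)ˣ) = 1 := by
  have h1 : phase (InfinitePlace.mk φ).embedding (singleUnit w z hz : (FR F)ˣ) = 1 :=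
    Circle.ext (by rw [coe_phase_of_mem _ (singleUnit w z hz).2, embFR_singleUnit_of_ne h]; rfl)
  rcases InfinitePlace.embedding_mk_eq φ with h2 | h2
  · rwa [h2] at h1
  · rwa [h2, phase_conjugate, inv_eq_one] at h1

theorem phase_im_of_isReal {w : InfinitePlace F} (hw : w.IsReal) (c : compactUnits F) :
    (phase w.embedding (c : (FR F)ˣ) : ℂ).im = 0 := by
  rw [coe_phase_of_mem _ c.2]
  exact embFR_im_of_isReal _ hw

/-- The compact units are the product of their components, so a character is determined by its
restriction to each place. -/
theorem prod_singleUnit (c : compactUnits F) :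
    ∏ w : InfinitePlace F, singleUnit w (phase w.embedding (c : (FR F)ˣ))
      (fun hw => phase_im_of_isReal hw c) = c := by
  classical
  refine Subtype.ext (units_ext fun w => ?_)
  rw [Subgroup.val_finsetProd, Units.coe_prod, map_prod, Fintype.prod_eq_single w fun w' h => by
    exact embFR_singleUnit_of_ne h.symm _ _, embFR_singleUnit_self, coe_phase_of_mem _ c.2]

theorem singleUnit_mul (w : InfinitePlace F) (z z' : Circle) (hz : w.IsReal → (z : ℂ).im = 0)
    (hz' : w.IsReal → (z' : ℂ).im = 0) (h : w.IsReal → ((z * z' : Circle) : ℂ).im = 0) :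
    singleUnit w (z * z') h = singleUnit w z hz * singleUnit w z' hz' := by
  refine Subtype.ext (units_ext fun w' => ?_)
  rw [Subgroup.coe_mul, Units.val_mul, map_mul]
  rcases eq_or_ne w' w with rfl | hw
  · rw [embFR_singleUnit_self, embFR_singleUnit_self, embFR_singleUnit_self, Circle.coe_mul]
  · rw [embFR_singleUnit_of_ne hw, embFR_singleUnit_of_ne hw, embFR_singleUnit_of_ne hw, mul_one]

theorem continuous_singleUnit {w : InfinitePlace F} (hw : ¬ w.IsReal) :
    Continuous fun z : Circle => singleUnit w z fun h => absurd h hw := by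
  classical
  have h1 : Continuous (Circle.toUnits : Circle → ℂˣ) :=
    Units.continuous_iff.2 ⟨continuous_subtype_val, by
      simp only [← map_inv]
      exact continuous_subtype_val.comp continuous_inv⟩
  exact (continuous_unitsMk.comp (((continuous_mulSingle w).comp h1).subtype_mk _)).subtype_mk _

/-- A continuous character of the compact units is a power of the phase at each component. -/
theorem exists_zpow_singleUnit (χ : compactUnits F →* Circle) (hχ : Continuous χ)
    (w : InfinitePlace F) : ∃ k : ℤ, ∀ (z : Circle) (hz : w.IsReal → (z : ℂ).im = 0),
      χ (singleUnit w z hz) = z ^ k := by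
  -- At a real place the component is ±1, so only the value at -1 matters: it is ±1, giving exponent
  -- 0 or 1. At a complex place the component is a full circle, whose continuous characters are
  -- powers.
  by_cases hw : w.IsReal
  · have hone : (w.IsReal → ((1 : Circle) : ℂ).im = 0) := fun _ => Complex.one_im
    have hneg : (w.IsReal → ((-1 : Circle) : ℂ).im = 0) := fun _ => by
      rw [Circle.coe_neg, Circle.coe_one, Complex.neg_im, Complex.one_im, neg_zero]
    have h1 : χ (singleUnit w 1 hone) = 1 := by
      have := singleUnit_mul w 1 1 hone hone (by rwa [mul_one])
      simp only [mul_one] at this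
      have h2 := congrArg χ this
      rwa [map_mul, left_eq_mul] at h2
    have h2 : χ (singleUnit w (-1) hneg) * χ (singleUnit w (-1) hneg) = 1 := by
      rw [← map_mul, ← singleUnit_mul w (-1) (-1) hneg hneg (by rwa [neg_mul_neg, mul_one])]
      simp only [neg_mul_neg, mul_one]
      exact h1
    have h3 : χ (singleUnit w (-1) hneg) = 1 ∨ χ (singleUnit w (-1) hneg) = -1 := by
      have h4 := congrArg (fun z : Circle => (z : ℂ)) h2
      simp only [Circle.coe_mul, Circle.coe_one, mul_self_eq_one_iff] at h4
      rcases h4 with h4 | h4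
      · exact Or.inl (Circle.ext h4)
      · exact Or.inr (Circle.ext (by rw [h4, Circle.coe_neg, Circle.coe_one]))
    have hz : ∀ z : Circle, (z : ℂ).im = 0 → z = 1 ∨ z = -1 := fun z hz => by
      have h5 : (z : ℂ) * z = 1 := by
        have h6 := Circle.normSq_coe z
        rw [Complex.normSq_apply, hz, mul_zero, add_zero] at h6
        refine Complex.ext ?_ ?_
        · rw [Complex.mul_re, hz, mul_zero, sub_zero, h6, Complex.one_re]
        · rw [Complex.mul_im, hz, mul_zero, zero_mul, add_zero, Complex.one_im]
      rcases mul_self_eq_one_iff.1 h5 with h6 | h6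
      · exact Or.inl (Circle.ext h6)
      · exact Or.inr (Circle.ext (by rw [h6, Circle.coe_neg, Circle.coe_one]))
    rcases h3 with h3 | h3
    · refine ⟨0, fun z h => ?_⟩
      rcases hz z (h hw) with rfl | rfl
      · rw [h1, zpow_zero]
      · rw [h3, zpow_zero]
    · refine ⟨1, fun z h => ?_⟩
      rcases hz z (h hw) with rfl | rfl
      · rw [h1, zpow_one]
      · rw [h3, zpow_one]
  · let f : Circle →* Circle :=
      { toFun := fun z => χ (singleUnit w z fun h => absurd h hw)
        map_one' := by
          have := singleUnit_mul w 1 1 (fun h => absurd h hw) (fun h => absurd h hw)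
            (fun h => absurd h hw)
          simp only [mul_one] at this
          have h2 := congrArg χ this
          rwa [map_mul, left_eq_mul] at h2
        map_mul' := fun z z' => by
          rw [← map_mul, ← singleUnit_mul] }
    obtain ⟨n, hn⟩ := exists_zpow_of_character f (hχ.comp (continuous_singleUnit hw))
    exact ⟨n, fun z hz => hn z⟩

end Phases

/-! ### Homomorphisms out of permutation modules -/

section PermLift

variable {G : Type u} [Group G] {S : Type u} [MulAction G S] {N : Type u} [AddCommGroup N]
  [Module (MonoidAlgebra ℤ G) N]

/-- The homomorphism out of a permutation module given by an equivariant map. -/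
def permLift (f : S → N) (hf : ∀ (g : G) (s : S), f (g • s) = MonoidAlgebra.single g (1 : ℤ) • f s) :
    PermModule G S →ₗ[MonoidAlgebra ℤ G] N :=
  equivariantHom (((permBasis G S).constr ℤ f).toAddMonoidHom) fun g m => by
    let L : PermModule G S →ₗ[ℤ] PermModule G S := groupRep G (PermModule G S) g
    let R : N →ₗ[ℤ] N := groupRep G N g
    have : (permBasis G S).constr ℤ f ∘ₗ L = R ∘ₗ (permBasis G S).constr ℤ f := by
      refine (permBasis G S).ext fun s => ?_
      have h1 : L (permBasis G S s) = permBasis G S (g • s) := single_smul_permBasis g s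
      rw [LinearMap.comp_apply, h1, LinearMap.comp_apply, Module.Basis.constr_basis,
        Module.Basis.constr_basis]
      exact hf g s
    exact LinearMap.congr_fun this m

variable (f : S → N) (hf : ∀ (g : G) (s : S), f (g • s) = MonoidAlgebra.single g (1 : ℤ) • f s)

theorem permLift_permBasis (s : S) : permLift f hf (permBasis G S s) = f s :=
  (permBasis G S).constr_basis ℤ f s

theorem permLift_apply [Fintype S] (m : PermModule G S) :
    permLift f hf m = ∑ s, (permBasis G S).repr m s • f s :=
  (permBasis G S).constr_apply_fintype ℤ f m

end PermLift

/-! ### A presentation of the dual of the compact units by places and embeddings -/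

section CompactDual

open NumberField

variable (K : Type v) {F : Type u} [Field K] [Field F] [NumberField F] [Algebra K F]

theorem compactUnits_stable (g : Gal(F/K)) (u : (FR F)ˣ) (hu : u ∈ compactUnits F) :
    g • u ∈ compactUnits F := fun φ => hu (φ.comp (mapFR K g : FR F →ₐ[ℝ] FR F))

instance compactUnitsAction : MulDistribMulAction Gal(F/K) (compactUnits F) :=
  subgroupAction (compactUnits F) (compactUnits_stable K)

instance compactUnitsContinuous : ContinuousConstSMul Gal(F/K) (compactUnits F) :=
  subgroupAction_continuous (compactUnits F) (compactUnits_stable K)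

variable (F) in
/-- The `ℤ[G]`-module of characters of the maximal compact subgroup of `F_ℝˣ`. -/
abbrev CompactDual : Type u := DualMod Gal(F/K) (compactUnits F)

/-- The phase at an embedding as a character of the compact units. -/
def phaseChar (φ : F →+* ℂ) : PontryaginDual (compactUnits F) where
  toMonoidHom := (phase φ).comp (compactUnits F).subtype
  continuous_toFun := (continuous_phase φ).comp continuous_subtype_val

variable (F) in
/-- The homomorphism sending an embedding to the corresponding phase. -/
def phaseHom : PermModule Gal(F/K) (F →+* ℂ) →ₗ[GalRing K F] CompactDual K F :=
  permLift (fun φ => DualMod.mk (phaseChar φ)) fun g φ => DualMod.ext fun c => by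
    rw [DualMod.char_smul]
    exact (phase_inv_smul g φ (c : (FR F)ˣ)).symm

theorem char_phaseHom (n : PermModule Gal(F/K) (F →+* ℂ)) (c : compactUnits F) :
    DualMod.char (phaseHom K F n) c =
      ∏ φ, phase φ (c : (FR F)ˣ) ^ (permBasis Gal(F/K) (F →+* ℂ)).repr n φ := by
  rw [phaseHom, permLift_apply, DualMod.char_sum]
  exact Finset.prod_congr rfl fun φ _ => DualMod.char_zsmul _ _ _

theorem eq_embedding_or_of_mk_eq {φ : F →+* ℂ} {w : InfinitePlace F}
    (h : InfinitePlace.mk φ = w) : φ = w.embedding ∨ φ = ComplexEmbedding.conjugate w.embedding := by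
  subst h
  rcases InfinitePlace.embedding_mk_eq φ with h | h
  · exact Or.inl h.symm
  · exact Or.inr (by rw [h, ComplexEmbedding.involutive_conjugate F φ])

theorem conjugate_embedding_of_isReal {w : InfinitePlace F} (hw : w.IsReal) :
    ComplexEmbedding.conjugate w.embedding = w.embedding :=
  ComplexEmbedding.isReal_iff.1 (InfinitePlace.isReal_iff.1 hw)

theorem conjugate_embedding_ne {w : InfinitePlace F} (hw : ¬ w.IsReal) :
    ComplexEmbedding.conjugate w.embedding ≠ w.embedding := fun h =>
  hw (InfinitePlace.isReal_iff.2 (ComplexEmbedding.isReal_iff.2 h))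

theorem char_phaseHom_singleUnit_of_isReal (n : PermModule Gal(F/K) (F →+* ℂ)) {w : InfinitePlace F}
    (hw : w.IsReal) (z : Circle) (hz : w.IsReal → (z : ℂ).im = 0) :
    DualMod.char (phaseHom K F n) (singleUnit w z hz) =
      z ^ (permBasis Gal(F/K) (F →+* ℂ)).repr n w.embedding := by
  rw [char_phaseHom, Fintype.prod_eq_single w.embedding, phase_singleUnit_self]
  intro φ hφ
  rw [phase_singleUnit_of_ne, one_zpow]
  intro h
  rcases eq_embedding_or_of_mk_eq h with h | h
  · exact hφ h
  · exact hφ (h.trans (conjugate_embedding_of_isReal hw))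

/-- Two embeddings lie above a complex place and their phases are mutually inverse, so only the
difference of the exponents is visible. -/
theorem char_phaseHom_singleUnit_of_not_isReal (n : PermModule Gal(F/K) (F →+* ℂ))
    {w : InfinitePlace F} (hw : ¬ w.IsReal) (z : Circle) :
    DualMod.char (phaseHom K F n) (singleUnit w z fun h => absurd h hw) =
      z ^ ((permBasis Gal(F/K) (F →+* ℂ)).repr n w.embedding -
        (permBasis Gal(F/K) (F →+* ℂ)).repr n (ComplexEmbedding.conjugate w.embedding)) := by
  rw [char_phaseHom, Fintype.prod_eq_mul w.embedding (ComplexEmbedding.conjugate w.embedding)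
    (conjugate_embedding_ne hw).symm, phase_singleUnit_self, phase_conjugate,
    phase_singleUnit_self, inv_zpow, ← zpow_neg, ← zpow_add, sub_eq_add_neg]
  rintro φ ⟨h1, h2⟩
  rw [phase_singleUnit_of_ne, one_zpow]
  intro h
  rcases eq_embedding_or_of_mk_eq h with h | h
  · exact h1 h
  · exact h2 h

/-- At each place the character is a power of the phase. The exponents are placed on the chosen
embeddings, one above each place. -/
theorem phaseHom_surjective : Surjective (phaseHom K F) := by
  intro χ
  choose k hk using exists_zpow_singleUnit (DualMod.char χ : compactUnits F →* Circle)
    (DualMod.char χ).continuous_toFun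
  refine ⟨∑ w : InfinitePlace F, k w • permBasis Gal(F/K) (F →+* ℂ) w.embedding,
    DualMod.ext fun c => ?_⟩
  rw [map_sum, DualMod.char_sum, ← prod_singleUnit c, prod_singleUnit c]
  have h1 : DualMod.char χ c = ∏ w : InfinitePlace F, phase w.embedding (c : (FR F)ˣ) ^ k w := by
    conv_lhs => rw [← prod_singleUnit c]
    rw [map_prod]
    exact Finset.prod_congr rfl fun w _ => hk w _ _
  rw [h1]
  refine Finset.prod_congr rfl fun w _ => ?_
  rw [map_zsmul, DualMod.char_zsmul, phaseHom, permLift_permBasis]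
  rfl

/-- The sum of an embedding and its conjugate does not depend on which of them is chosen above the
place. This makes `placesHom` equivariant although the choice of embeddings is not. -/
theorem single_add_single_conjugate (φ : F →+* ℂ) :
    permBasis Gal(F/K) (F →+* ℂ) (InfinitePlace.mk φ).embedding + permBasis Gal(F/K) (F →+* ℂ)
      (ComplexEmbedding.conjugate (InfinitePlace.mk φ).embedding) =
    permBasis Gal(F/K) (F →+* ℂ) φ +
      permBasis Gal(F/K) (F →+* ℂ) (ComplexEmbedding.conjugate φ) := by
  rcases InfinitePlace.embedding_mk_eq φ with h | h
  · rw [h]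
  · rw [h, ComplexEmbedding.involutive_conjugate F φ, add_comm]

variable (F) in
/-- The homomorphism sending an Archimedean place to the sum of its two embeddings. -/
def placesHom : PermModule Gal(F/K) (InfinitePlace F) →ₗ[GalRing K F]
    PermModule Gal(F/K) (F →+* ℂ) :=
  permLift (fun w => permBasis Gal(F/K) (F →+* ℂ) w.embedding +
      permBasis Gal(F/K) (F →+* ℂ) (ComplexEmbedding.conjugate w.embedding)) fun g w => by
    rw [smul_add, single_smul_permBasis, single_smul_permBasis, embAction_conjugate,
      ← single_add_single_conjugate K (g • w.embedding), ← smul_mk_eq, InfinitePlace.mk_embedding]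

-- The factor 2 at a real place arises because the embedding equals its own conjugate and is counted
-- twice.
open Classical in
theorem repr_placesHom (m : PermModule Gal(F/K) (InfinitePlace F)) (φ : F →+* ℂ) :
    (permBasis Gal(F/K) (F →+* ℂ)).repr (placesHom K F m) φ =
      (permBasis Gal(F/K) (InfinitePlace F)).repr m (InfinitePlace.mk φ) *
        if (InfinitePlace.mk φ).IsReal then 2 else 1 := by
  rw [placesHom, permLift_apply, map_sum, Finsupp.finsetSum_apply,
    Fintype.sum_eq_single (InfinitePlace.mk φ)]
  · rw [map_zsmul, Finsupp.smul_apply, smul_eq_mul, single_add_single_conjugate, map_add,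
      Module.Basis.repr_self, Module.Basis.repr_self, Finsupp.add_apply, Finsupp.single_eq_same,
      Finsupp.single_apply]
    congr 1
    rw [← ComplexEmbedding.isReal_iff, InfinitePlace.isReal_mk_iff]
    split_ifs <;> rfl
  · intro w hw
    rw [map_zsmul, Finsupp.smul_apply, map_add,
      Module.Basis.repr_self, Module.Basis.repr_self, Finsupp.add_apply, Finsupp.single_eq_of_ne,
      Finsupp.single_eq_of_ne, add_zero, smul_zero]
    · rintro rfl
      exact hw (by rw [InfinitePlace.mk_conjugate_eq, InfinitePlace.mk_embedding])
    · rintro rfl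
      exact hw (by rw [InfinitePlace.mk_embedding])

theorem placesHom_injective : Injective (placesHom K F) := by
  classical
  refine (injective_iff_map_eq_zero _).2 fun m hm => ?_
  refine (permBasis Gal(F/K) (InfinitePlace F)).repr.injective (Finsupp.ext fun w => ?_)
  have h := repr_placesHom K m w.embedding
  rw [hm, map_zero, Finsupp.zero_apply, eq_comm, mul_eq_zero, InfinitePlace.mk_embedding] at h
  rw [map_zero, Finsupp.zero_apply]
  refine h.resolve_right ?_
  split_ifs <;> norm_num

/-- A product of phases is trivial exactly when each exponent at a real embedding is even (test on
-1) and the exponents at conjugate complex embeddings agree (test on the circle). These conditions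
describe the image of the places, where a real place contributes twice its embedding. -/
theorem exact_placesHom_phaseHom : Exact (placesHom K F) (phaseHom K F) := by
  classical
  intro n
  constructor
  · intro hn
    set r := (permBasis Gal(F/K) (F →+* ℂ)).repr n with hr
    have hreal : ∀ w : InfinitePlace F, w.IsReal → Even (r w.embedding) := fun w hw => by
      have h1 := char_phaseHom_singleUnit_of_isReal K n hw (-1) fun _ => by
        rw [Circle.coe_neg, Circle.coe_one, Complex.neg_im, Complex.one_im, neg_zero]
      rw [hn, DualMod.char_zero] at h1
      have h2 := congrArg (fun z : Circle => (z : ℂ)) h1.symm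
      simp only [Circle.coe_zpow, Circle.coe_neg, Circle.coe_one] at h2
      by_contra h3
      rw [(Int.not_even_iff_odd.1 h3).neg_one_zpow] at h2
      norm_num at h2
    have hcomplex : ∀ w : InfinitePlace F, ¬ w.IsReal →
        r w.embedding = r (ComplexEmbedding.conjugate w.embedding) := fun w hw =>
      sub_eq_zero.1 (eq_zero_of_forall_zpow _ fun z => by
        rw [← char_phaseHom_singleUnit_of_not_isReal K n hw z, hn, DualMod.char_zero])
    refine ⟨(permBasis Gal(F/K) (InfinitePlace F)).equivFun.symm fun w =>
      if w.IsReal then r w.embedding / 2 else r w.embedding, ?_⟩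
    refine (permBasis Gal(F/K) (F →+* ℂ)).repr.injective (Finsupp.ext fun φ => ?_)
    rw [repr_placesHom, ← Module.Basis.equivFun_apply, LinearEquiv.apply_symm_apply, ← hr]
    split_ifs with h
    · rw [Int.ediv_mul_cancel (hreal _ h).two_dvd]
      rcases eq_embedding_or_of_mk_eq (φ := φ) rfl with h1 | h1
      · rw [← h1]
      · conv_rhs => rw [h1, conjugate_embedding_of_isReal h]
    · rw [mul_one]
      rcases eq_embedding_or_of_mk_eq (φ := φ) rfl with h1 | h1
      · rw [← h1]
      · conv_rhs => rw [h1, ← hcomplex _ h]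
  · rintro ⟨m, rfl⟩
    rw [placesHom, permLift_apply, map_sum]
    refine Finset.sum_eq_zero fun w _ => ?_
    have : phaseHom K F (permBasis Gal(F/K) (F →+* ℂ) w.embedding +
        permBasis Gal(F/K) (F →+* ℂ) (ComplexEmbedding.conjugate w.embedding)) = 0 := by
      rw [map_add, phaseHom, permLift_permBasis, permLift_permBasis]
      refine DualMod.ext fun c => ?_
      change phase _ _ * phase _ _ = 1
      rw [phase_conjugate, mul_inv_cancel]
    rw [map_zsmul, this, smul_zero]

variable [NumberField K] [IsGalois K F]

instance finite_compactDual : Module.Finite (GalRing K F) (CompactDual K F) :=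
  Module.Finite.of_surjective _ (phaseHom_surjective K)

theorem cls_compactDual : G0.cls (GalRing K F) (PlacesModule K F) +
    G0.cls (GalRing K F) (CompactDual K F) =
      Module.finrank ℚ K • G0.cls (GalRing K F) (GalRing K F) := by
  rw [← cls_permModule_embeddings]
  exact G0.cls_add (placesHom K F) (phaseHom K F) (placesHom_injective K)
    (exact_placesHom_phaseHom K) (phaseHom_surjective K)

end CompactDual

/-! ### Extension of characters by divisibility of the circle -/

section Extension

instance divisibleBy_circle : DivisibleBy (Additive Circle) ℤ :=
  divisibleByOfSMulRightSurj _ _ fun {n} hn z => by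
    obtain ⟨t, ht⟩ := Circle.exp_surjective z.toMul
    refine ⟨Additive.ofMul (Circle.exp (t / n)), ?_⟩
    change Additive.ofMul (Circle.exp (t / n) ^ n) = z
    rw [← Circle.exp_intCast_mul, mul_div_cancel₀ _ (Int.cast_ne_zero.2 hn), ht]
    rfl

/-- A character which is trivial on the kernel of a homomorphism extends along it. -/
theorem exists_monoidHom_circle {A B : Type*} [CommGroup A] [CommGroup B] (f : A →* B)
    (ψ : A →* Circle) (h : ∀ a, f a = 1 → ψ a = 1) :
    ∃ χ : B →* Circle, ∀ a, χ (f a) = ψ a := by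
  -- The circle is divisible, hence injective, so the character induced on A/ker f extends from this
  -- subgroup of B.
  obtain ⟨χ, hχ⟩ := Module.Baer.extension_property_addMonoidHom
    (Module.Baer.of_divisible (Additive Circle)) (MonoidHom.toAdditive (QuotientGroup.kerLift f))
    (QuotientGroup.kerLift_injective f)
    (MonoidHom.toAdditive (QuotientGroup.lift f.ker ψ fun a ha => h a ha))
  exact ⟨MonoidHom.toAdditive.symm χ, fun a =>
    congrArg Additive.toMul (DFunLike.congr_fun hχ (Additive.ofMul (QuotientGroup.mk a)))⟩

end Extension

/-! ### Units of norm ±1 inside the oriented class group -/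

section NormOne

open NumberField
open scoped nonZeroDivisors

variable (F : Type u) [Field F] [NumberField F]

/-- The units of `F_ℝ` of norm `±1`. -/
def normOne : Subgroup (FR F)ˣ where
  carrier := {u | |Algebra.norm ℝ (u : FR F)| = 1}
  one_mem' := by simp
  mul_mem' {u v} hu hv := by
    simp only [Set.mem_ofPred_eq] at hu hv ⊢
    rw [Units.val_mul, map_mul, abs_mul, hu, hv, one_mul]
  inv_mem' {u} hu := by
    simp only [Set.mem_ofPred_eq] at hu ⊢
    have h : Algebra.norm ℝ ((u⁻¹ : (FR F)ˣ) : FR F) * Algebra.norm ℝ (u : FR F) = 1 := by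
      rw [← map_mul, Units.inv_mul, map_one]
    have h' := congrArg abs h
    rwa [abs_mul, hu, mul_one, abs_one] at h'

variable {F}

theorem compactUnits_le_normOne : compactUnits F ≤ normOne F :=
  fun _ hu => abs_norm_of_mem_compactUnits hu

theorem one_mk_mem_fibreProduct (u : (FR F)ˣ) :
    ((1 : IdealGroup F), u) ∈ fibreProduct F ↔ u ∈ normOne F := by
  change ((FractionalIdeal.absNorm ((1 : IdealGroup F) : FractionalIdeal (𝓞 F)⁰ F) : ℚ) : ℝ) =
    |Algebra.norm ℝ (u : FR F)| ↔ |Algebra.norm ℝ (u : FR F)| = 1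
  rw [Units.val_one, map_one, Rat.cast_one, eq_comm]

variable (F) in
/-- The inclusion of the units of norm `±1` into the fibre product. -/
def normOneInclusion : normOne F →ₜ* fibreProduct F where
  toFun u := ⟨(1, u), (one_mk_mem_fibreProduct _).2 u.2⟩
  map_one' := rfl
  map_mul' _ _ := Subtype.ext (Prod.ext (one_mul 1).symm rfl)
  continuous_toFun := (continuous_const.prodMk continuous_subtype_val).subtype_mk _

variable (F) in
/-- The canonical homomorphism onto the oriented Arakelov class group. -/
def toPicTilde : fibreProduct F →ₜ* PicTilde F where
  toMonoidHom := QuotientGroup.mk' (principal F).range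
  continuous_toFun := continuous_quotient_mk'

theorem toPicTilde_surjective : Surjective (toPicTilde F) := QuotientGroup.mk_surjective

theorem toPicTilde_eq_one {x : fibreProduct F} : toPicTilde F x = 1 ↔ x ∈ (principal F).range :=
  QuotientGroup.eq_one_iff x

variable (F) in
/-- The homomorphism `u ↦ [(1, u)]` from the units of norm `±1` to the oriented Arakelov class
group. -/
def unitClass : normOne F →ₜ* PicTilde F := (toPicTilde F).comp (normOneInclusion F)

variable (F) in
/-- The image in `F_ℝˣ` of the units of the ring of integers. -/
def globalUnit : (𝓞 F)ˣ →* (FR F)ˣ :=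
  (Units.map (toFR F : F →* FR F)).comp (Units.map (algebraMap (𝓞 F) F : 𝓞 F →* F))

theorem embFR_globalUnit (φ : F →+* ℂ) (ε : (𝓞 F)ˣ) :
    embFR φ (globalUnit F ε : FR F) = φ (ε : F) := embFR_toFR φ _

/-- If α generates the unit ideal, so does α⁻¹, and both are then integral. -/
theorem mk_principal_eq_one_iff (α : Fˣ) :
    toPrincipalIdeal (𝓞 F) F α = 1 ↔
      ∃ ε : (𝓞 F)ˣ, Units.map (algebraMap (𝓞 F) F : 𝓞 F →* F) ε = α := by
  have key : ∀ β : Fˣ, toPrincipalIdeal (𝓞 F) F β = 1 → ∃ x : 𝓞 F, algebraMap (𝓞 F) F x = β := by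
    intro β hβ
    have h1 := FractionalIdeal.mem_spanSingleton_self (𝓞 F)⁰ (β : F)
    rw [toPrincipalIdeal_eq_iff, Units.val_one] at hβ
    rw [hβ] at h1
    exact (FractionalIdeal.mem_one_iff _).1 h1
  constructor
  · intro h
    obtain ⟨x, hx⟩ := key α h
    obtain ⟨y, hy⟩ := key α⁻¹ (by rw [map_inv, h, inv_one])
    have hxy : x * y = 1 := FaithfulSMul.algebraMap_injective (𝓞 F) F (by
      rw [map_mul, hx, hy, Units.mul_inv, map_one])
    exact ⟨Units.mkOfMulEqOne x y hxy, Units.ext hx⟩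
  · rintro ⟨ε, rfl⟩
    rw [toPrincipalIdeal_eq_iff, Units.val_one]
    refine le_antisymm ?_ ?_
    · rw [FractionalIdeal.spanSingleton_le_iff_mem]
      exact (FractionalIdeal.mem_one_iff _).2 ⟨ε, rfl⟩
    · intro x hx
      obtain ⟨y, rfl⟩ := (FractionalIdeal.mem_one_iff _).1 hx
      refine (FractionalIdeal.mem_spanSingleton _).2 ⟨y * ((ε⁻¹ : (𝓞 F)ˣ) : 𝓞 F), ?_⟩
      rw [Algebra.smul_def, Units.coe_map, MonoidHom.coe_coe, ← map_mul, mul_assoc, Units.inv_mul,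
        mul_one]

theorem globalUnit_mem_normOne (ε : (𝓞 F)ˣ) : globalUnit F ε ∈ normOne F := by
  have h := absNorm_eq_abs_norm (F := F) (Units.map (algebraMap (𝓞 F) F : 𝓞 F →* F) ε)
  rw [(mk_principal_eq_one_iff _).2 ⟨ε, rfl⟩] at h
  exact (one_mk_mem_fibreProduct _).1 h

theorem unitClass_eq_one_iff (u : normOne F) :
    unitClass F u = 1 ↔ ∃ ε : (𝓞 F)ˣ, globalUnit F ε = u := by
  have h : unitClass F u = 1 ↔ normOneInclusion F u ∈ (principal F).range := toPicTilde_eq_one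
  rw [h]
  constructor
  · rintro ⟨α, hα⟩
    obtain ⟨ε, rfl⟩ := (mk_principal_eq_one_iff α).1 (congrArg (fun x => x.1.1) hα)
    exact ⟨ε, congrArg (fun x => x.1.2) hα⟩
  · rintro ⟨ε, hε⟩
    exact ⟨Units.map (algebraMap (𝓞 F) F : 𝓞 F →* F) ε, Subtype.ext (Prod.ext
      ((mk_principal_eq_one_iff _).2 ⟨ε, rfl⟩) hε)⟩

/-- A continuous character of the units of norm `±1` which is trivial on the global units extends
to the oriented Arakelov class group. -/
theorem exists_extension (ψ : normOne F →* Circle) (hψ : Continuous ψ)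
    (h : ∀ ε : (𝓞 F)ˣ, ψ ⟨globalUnit F ε, globalUnit_mem_normOne ε⟩ = 1) :
    ∃ χ : PontryaginDual (PicTilde F), ∀ u, χ (unitClass F u) = ψ u := by
  -- The kernel of the class map on units of norm ±1 is the group of global units, so ψ extends as
  -- an abstract character. Continuity is checked afterwards.
  obtain ⟨χ, hχ⟩ := exists_monoidHom_circle (unitClass F : normOne F →* PicTilde F) ψ fun u hu => by
    obtain ⟨ε, hε⟩ := (unitClass_eq_one_iff u).1 hu
    obtain rfl : (⟨globalUnit F ε, globalUnit_mem_normOne ε⟩ : normOne F) = u := Subtype.ext hε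
    exact h ε
  have hcont : Continuous (χ.comp (toPicTilde F : fibreProduct F →* PicTilde F)) := by
    let U : Set (fibreProduct F) := {x | x.1.1 = 1}
    -- Ideals form a discrete group, so the elements with trivial ideal are an open neighbourhood of
    -- 1. There the extension is ψ of the second component, hence continuous, and continuity at 1 is
    -- enough for a homomorphism.
    have hU : IsOpen U := (isOpen_discrete {(1 : IdealGroup F)}).preimage
      (continuous_fst.comp continuous_subtype_val)
    let s : U → normOne F := fun x => ⟨x.1.1.2, (one_mk_mem_fibreProduct _).1 (by
      have h1 : x.1.1.1 = 1 := x.2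
      rw [← h1]
      exact x.1.2)⟩
    have hs : Continuous s := (continuous_snd.comp
      (continuous_subtype_val.comp continuous_subtype_val)).subtype_mk _
    refine continuous_of_continuousAt_one _ ?_
    refine (hU.isOpenEmbedding_subtypeVal.continuousAt_iff (x := ⟨1, rfl⟩)).1 ?_
    have h2 : (χ.comp (toPicTilde F : fibreProduct F →* PicTilde F)) ∘ (Subtype.val : U → _) =
        ψ ∘ s := funext fun x => by
      rw [comp_apply, comp_apply, ← hχ]
      refine congrArg (fun y => χ (toPicTilde F y)) (Subtype.ext (Prod.ext ?_ rfl))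
      exact x.2
    rw [h2]
    exact (hψ.comp hs).continuousAt
  exact ⟨⟨χ, (QuotientGroup.isQuotientMap_mk (N := (principal F).range)).continuous_iff.2 hcont⟩, hχ⟩

end NormOne

/-! ### The logarithmic embedding and fundamental units -/

section Logarithm

open NumberField NumberField.mixedEmbedding NumberField.mixedEmbedding.fundamentalCone
  NumberField.Units NumberField.Units.dirichletUnitTheorem

variable {F : Type u} [Field F] [NumberField F]

/-- The logarithmic embedding `u ↦ (mult(w) log |u_w|)_w` of `F_ℝˣ`. -/
def logFR (u : (FR F)ˣ) : realSpace F := fun w => w.mult * Real.log ‖embFR w.embedding (u : FR F)‖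

theorem logFR_apply (u : (FR F)ˣ) (w : InfinitePlace F) :
    logFR u w = w.mult * Real.log ‖embFR w.embedding (u : FR F)‖ := rfl

theorem logFR_mul (u v : (FR F)ˣ) : logFR (u * v) = logFR u + logFR v := funext fun w => by
  rw [Pi.add_apply, logFR_apply, logFR_apply, logFR_apply, Units.val_mul, map_mul, norm_mul,
    Real.log_mul (norm_ne_zero_iff.2 (embFR_units_ne_zero _ u))
      (norm_ne_zero_iff.2 (embFR_units_ne_zero _ v)), mul_add]

theorem logFR_of_mem_compactUnits {u : (FR F)ˣ} (hu : u ∈ compactUnits F) : logFR u = 0 :=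
  funext fun w => by rw [logFR_apply, hu, Real.log_one, mul_zero, Pi.zero_apply]

theorem logFR_one : logFR (1 : (FR F)ˣ) = 0 := logFR_of_mem_compactUnits (one_mem _)

theorem continuous_logFR : Continuous (logFR : (FR F)ˣ → realSpace F) :=
  continuous_pi fun w => continuous_const.mul
    ((((continuous_embFR w.embedding).comp Units.continuous_val).norm).log fun u =>
      norm_ne_zero_iff.2 (embFR_units_ne_zero _ u))

/-- These are the members of `completeBasis` other than the one at w₀. That they belong to a basis
is the content of Dirichlet's unit theorem used below. -/
theorem logFR_fundSystem (i : {w : InfinitePlace F // w ≠ w₀}) :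
    logFR (globalUnit F (fundSystem F (equivFinRank.symm i))) = completeBasis F i := by
  rw [completeBasis_apply_of_ne]
  funext w
  rw [logFR_apply, expMap_symm_apply, normAtAllPlaces_mixedEmbedding, embFR_globalUnit,
    InfinitePlace.norm_embedding_eq]

theorem sum_logFR {u : (FR F)ˣ} (hu : u ∈ normOne F) : ∑ w, logFR u w = 0 := by
  have h : |Algebra.norm ℝ (u : FR F)| = 1 := hu
  rw [abs_norm_FR] at h
  have h' := congrArg Real.log h
  rw [Real.log_one, Real.log_prod fun w _ => pow_ne_zero _
    (norm_ne_zero_iff.2 (embFR_units_ne_zero _ u))] at h'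
  simpa only [Real.log_pow, logFR_apply] using h'

theorem globalUnit_mem_compactUnits {ζ : (𝓞 F)ˣ} (hζ : ζ ∈ torsion F) :
    globalUnit F ζ ∈ compactUnits F := by
  rw [mem_compactUnits_iff]
  intro w
  rw [embFR_globalUnit, InfinitePlace.norm_embedding_eq]
  exact (mem_torsion F).1 hζ w

/-- The character `u ↦ exp (i ℓ(log |u|))`. -/
def expChar (l : realSpace F →ₗ[ℝ] ℝ) : (FR F)ˣ →* Circle where
  toFun u := Circle.exp (l (logFR u))
  map_one' := by rw [logFR_one, map_zero, Circle.exp_zero]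
  map_mul' u v := by rw [logFR_mul, map_add, Circle.exp_add]

theorem expChar_apply (l : realSpace F →ₗ[ℝ] ℝ) (u : (FR F)ˣ) :
    expChar l u = Circle.exp (l (logFR u)) := rfl

theorem continuous_expChar (l : realSpace F →ₗ[ℝ] ℝ) : Continuous (expChar l) :=
  Circle.exp.continuous.comp (l.continuous_of_finiteDimensional.comp continuous_logFR)

/-- A homomorphism of `(𝓞 F)ˣ` is trivial if it is so on the fundamental units and on the roots of
unity. -/
theorem hom_units_eq_one {A : Type*} [CommGroup A] (f : (𝓞 F)ˣ →* A)
    (h1 : ∀ i, f (fundSystem F i) = 1) (h2 : ∀ ζ ∈ torsion F, f ζ = 1) (ε : (𝓞 F)ˣ) : f ε = 1 := by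
  have : ⊤ ≤ f.ker := by
    rw [← closure_fundSystem_sup_torsion_eq_top, sup_le_iff, Subgroup.closure_le]
    refine ⟨?_, fun ζ hζ => h2 ζ hζ⟩
    rintro _ ⟨i, rfl⟩
    exact h1 i
  exact this (Subgroup.mem_top ε)

/-- The logarithms of the fundamental units are linearly independent, so a functional can be
prescribed on them. Its value on the remaining basis vector is immaterial and set to 0. -/
theorem exists_expChar_fundSystem (z : Fin (rank F) → Circle) :
    ∃ l : realSpace F →ₗ[ℝ] ℝ, ∀ i, expChar l (globalUnit F (fundSystem F i)) = z i := by
  classical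
  choose t ht using fun i => Circle.exp_surjective (z i)
  refine ⟨(completeBasis F).constr ℝ fun w =>
    if h : w ≠ w₀ then t (equivFinRank.symm ⟨w, h⟩) else 0, fun i => ?_⟩
  obtain ⟨w, rfl⟩ := equivFinRank.symm.surjective i
  rw [expChar_apply, logFR_fundSystem, Module.Basis.constr_basis, dif_pos w.2, ht]

end Logarithm

/-! ### The exact sequence 0 → Ar → Ãr → (compact units)^∨ → μ_F^∨ → 0 -/

section Sequence

open NumberField NumberField.Units

variable (F : Type u) [Field F] [NumberField F]

/-- The canonical homomorphism onto the Arakelov class group. -/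
def toPic0 : PicTilde F →ₜ* Pic0 F where
  toMonoidHom := QuotientGroup.mk' (compactImage F)
  continuous_toFun := continuous_quotient_mk'

theorem toPic0_surjective : Surjective (toPic0 F) := QuotientGroup.mk_surjective

/-- The homomorphism from the compact units to the oriented Arakelov class group. -/
def compactClass : compactUnits F →ₜ* PicTilde F :=
  (unitClass F).comp ⟨Subgroup.inclusion compactUnits_le_normOne,
    continuous_inclusion compactUnits_le_normOne⟩

variable {F}

theorem mem_compactImage_iff {x : PicTilde F} : x ∈ compactImage F ↔ ∃ c, compactClass F c = x := by
  constructor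
  · rintro ⟨⟨⟨I, u⟩, hy⟩, ⟨h1, h2⟩, rfl⟩
    obtain rfl : I = 1 := h1
    exact ⟨⟨u, h2⟩, rfl⟩
  · rintro ⟨c, rfl⟩
    exact ⟨normOneInclusion F ⟨c, compactUnits_le_normOne c.2⟩, ⟨rfl, c.2⟩, rfl⟩

variable (K : Type v) [Field K] [Algebra K F]

theorem normOne_stable (g : Gal(F/K)) (u : (FR F)ˣ) (hu : u ∈ normOne F) : g • u ∈ normOne F := by
  change |Algebra.norm ℝ (mapFR K g (u : FR F))| = 1
  rw [Algebra.norm_eq_of_algEquiv]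
  exact hu

theorem smul_unitClass (g : Gal(F/K)) (u : normOne F) :
    g • unitClass F u = unitClass F ⟨g • (u : (FR F)ˣ), normOne_stable K g u u.2⟩ := by
  change toPicTilde F (g • normOneInclusion F u) = toPicTilde F _
  refine congrArg _ (Subtype.ext (Prod.ext ?_ rfl))
  exact smul_one g

variable (F) in
/-- The inflation of characters from the Arakelov class group to the oriented one. -/
def inflation : Ar K F →ₗ[GalRing K F] ArTilde K F :=
  DualMod.pullback (G := Gal(F/K)) (X := PicTilde F) (Y := Pic0 F) (toPic0 F) fun _ _ => rfl

variable (F) in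
/-- The restriction of characters to the maximal compact subgroup. -/
def restriction : ArTilde K F →ₗ[GalRing K F] CompactDual K F :=
  DualMod.pullback (G := Gal(F/K)) (X := compactUnits F) (Y := PicTilde F) (compactClass F)
    fun g c => (smul_unitClass K g ⟨c, compactUnits_le_normOne c.2⟩).symm

theorem inflation_injective : Injective (inflation F K) := fun χ ψ h =>
  DualMod.ext fun x => by
    obtain ⟨y, rfl⟩ := toPic0_surjective F x
    exact congrArg (fun χ => DualMod.char (G := Gal(F/K)) (X := PicTilde F) χ y) h

theorem exact_inflation_restriction : Exact (inflation F K) (restriction F K) := by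
  intro χ
  constructor
  · intro h
    let χ' : PontryaginDual (PicTilde F) := DualMod.char χ
    have h1 : ∀ x ∈ compactImage F, χ' x = 1 := fun x hx => by
      obtain ⟨c, rfl⟩ := mem_compactImage_iff.1 hx
      exact congrArg (fun ψ : CompactDual K F => DualMod.char ψ c) h
    let ψ : PontryaginDual (Pic0 F) :=
      ⟨QuotientGroup.lift (compactImage F) (χ' : PicTilde F →* Circle) h1,
        (QuotientGroup.isQuotientMap_mk (N := compactImage F)).continuous_iff.2
          χ'.continuous_toFun⟩
    exact ⟨DualMod.mk (G := Gal(F/K)) ψ, DualMod.ext fun x => rfl⟩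
  · rintro ⟨ψ, rfl⟩
    refine DualMod.ext fun c => ?_
    have h : toPic0 F (compactClass F c) = 1 :=
      (QuotientGroup.eq_one_iff _).2 (mem_compactImage_iff.2 ⟨c, rfl⟩)
    change DualMod.char ψ (toPic0 F (compactClass F c)) = 1
    rw [h, map_one]

variable (F) in
/-- The roots of unity as compact units. -/
def rootsInclusion : CommGroup.torsion Fˣ →* compactUnits F :=
  ((Units.map (toFR F : F →* FR F)).comp (CommGroup.torsion Fˣ).subtype).codRestrict _ fun ζ φ => by
    have h1 : IsOfFinOrder (φ (toFR F ((ζ : Fˣ) : F))) :=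
      ((φ : FR F →* ℂ).comp ((toFR F : F →* FR F).comp (Units.coeHom F))).isOfFinOrder ζ.2
    exact h1.norm_eq_one

theorem phase_rootsInclusion (φ : F →+* ℂ) (ζ : CommGroup.torsion Fˣ) :
    (phase φ (rootsInclusion F ζ : (FR F)ˣ) : ℂ) = φ ((ζ : Fˣ) : F) := by
  rw [coe_phase_of_mem _ (rootsInclusion F ζ).2]
  exact embFR_toFR φ _

/-- A root of unity as an element of the module of roots of unity. -/
def rootMk (ζ : CommGroup.torsion Fˣ) : RootsOfUnityModule K F :=
  (Representation.ofMulDistribMulAction Gal(F/K) (CommGroup.torsion Fˣ)).asModuleEquiv.symm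
    (Additive.ofMul ζ)

theorem rootMk_surjective : Surjective (rootMk K : CommGroup.torsion Fˣ → RootsOfUnityModule K F) :=
  fun m => ⟨Additive.toMul ((Representation.ofMulDistribMulAction Gal(F/K)
    (CommGroup.torsion Fˣ)).asModuleEquiv m), rfl⟩

theorem smul_rootMk (g : Gal(F/K)) (ζ : CommGroup.torsion Fˣ) :
    (MonoidAlgebra.single g (1 : ℤ) : GalRing K F) • rootMk K ζ = rootMk K (g • ζ) := by
  rw [asModule_smul]
  rfl

/-- The restriction of a character of the compact units to the roots of unity. -/
def rootsChar (χ : CompactDual K F) : CircleDual Gal(F/K) (RootsOfUnityModule K F) :=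
  CircleDual.toHom.symm ((MonoidHom.toAdditive
    ((DualMod.char χ : compactUnits F →* Circle).comp (rootsInclusion F))).comp
      (Representation.ofMulDistribMulAction Gal(F/K)
        (CommGroup.torsion Fˣ)).asModuleEquiv.toAddEquiv.toAddMonoidHom).toIntLinearMap

theorem toHom_rootsChar (χ : CompactDual K F) (ζ : CommGroup.torsion Fˣ) :
    CircleDual.toHom (rootsChar K χ) (rootMk K ζ) =
      Additive.ofMul (DualMod.char χ (rootsInclusion F ζ)) := rfl

theorem circleDual_ext {a b : CircleDual Gal(F/K) (RootsOfUnityModule K F)}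
    (h : ∀ ζ, CircleDual.toHom a (rootMk K ζ) = CircleDual.toHom b (rootMk K ζ)) : a = b := by
  refine CircleDual.toHom.injective (LinearMap.ext fun m => ?_)
  obtain ⟨ζ, rfl⟩ := rootMk_surjective K m
  exact h ζ

variable (F) in
/-- The restriction of characters of the compact units to the roots of unity. -/
def rootsRestriction : CompactDual K F →ₗ[GalRing K F]
    CircleDual Gal(F/K) (RootsOfUnityModule K F) :=
  equivariantHom
    { toFun := rootsChar K
      map_zero' := circleDual_ext K fun ζ => rfl
      map_add' := fun χ ψ => circleDual_ext K fun ζ => rfl }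
    fun g χ => circleDual_ext K fun ζ => by
      rw [CircleDual.smul_apply, smul_rootMk]
      change CircleDual.toHom (rootsChar K _) (rootMk K ζ) = CircleDual.toHom (rootsChar K _) _
      rw [toHom_rootsChar, toHom_rootsChar, DualMod.char_smul]
      refine congrArg (fun c => Additive.ofMul (DualMod.char χ c)) (Subtype.ext (Units.ext ?_))
      exact mapFR_toFR K g⁻¹ ((ζ : Fˣ) : F)

theorem rootsRestriction_eq_zero_iff {χ : CompactDual K F} :
    rootsRestriction F K χ = 0 ↔ ∀ ζ, DualMod.char χ (rootsInclusion F ζ) = 1 :=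
  ⟨fun h ζ => congrArg Additive.toMul (congrArg (fun a => CircleDual.toHom a (rootMk K ζ)) h),
    fun h => circleDual_ext K fun ζ => congrArg Additive.ofMul (h ζ)⟩

/-- The group μ_F is cyclic and an embedding φ sends a generator to a primitive root of unity of the
same order. Every character of μ_F is therefore a power of the phase at φ. -/
theorem rootsRestriction_surjective : Surjective (rootsRestriction F K) := by
  intro f
  have hcyc : IsCyclic (CommGroup.torsion Fˣ) := isCyclic_of_injective_ringHom
    ((Units.coeHom F).comp (CommGroup.torsion Fˣ).subtype)
    (Units.val_injective.comp Subtype.val_injective)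
  obtain ⟨ζ, hζ⟩ := hcyc.exists_generator
  let f' : CommGroup.torsion Fˣ →* Circle :=
    { toFun := fun z => Additive.toMul (CircleDual.toHom f (rootMk K z))
      map_one' := congrArg Additive.toMul (map_zero (CircleDual.toHom f))
      map_mul' := fun x y => congrArg Additive.toMul
        (map_add (CircleDual.toHom f) (rootMk K x) (rootMk K y)) }
  obtain ⟨φ⟩ : Nonempty (F →+* ℂ) := inferInstance
  let p : CommGroup.torsion Fˣ →* ℂ :=
    (φ : F →* ℂ).comp ((Units.coeHom F).comp (CommGroup.torsion Fˣ).subtype)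
  have hp : Injective p := φ.injective.comp (Units.val_injective.comp Subtype.val_injective)
  have hprim := (IsPrimitiveRoot.orderOf ζ).map_of_injective hp
  have hne : NeZero (orderOf ζ) := ⟨(orderOf_pos ζ).ne'⟩
  obtain ⟨k, -, hk⟩ := hprim.eq_pow_of_pow_eq_one (ξ := (f' ζ : ℂ)) (by
    rw [← Circle.coe_pow, ← map_pow, pow_orderOf_eq_one, map_one, Circle.coe_one])
  have hk' : phase φ (rootsInclusion F ζ : (FR F)ˣ) ^ k = f' ζ := Circle.ext (by
    rw [Circle.coe_pow, phase_rootsInclusion, ← hk]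
    rfl)
  refine ⟨(k : ℤ) • DualMod.mk (phaseChar φ), circleDual_ext K fun z => ?_⟩
  obtain ⟨n, rfl⟩ := Subgroup.mem_zpowers_iff.1 (hζ z)
  change Additive.ofMul (DualMod.char ((k : ℤ) • DualMod.mk (G := Gal(F/K)) (phaseChar φ))
    (rootsInclusion F (ζ ^ n))) = Additive.ofMul (f' (ζ ^ n))
  rw [DualMod.char_zsmul]
  have hn : phase φ (rootsInclusion F (ζ ^ n) : (FR F)ˣ) ^ (k : ℤ) = f' (ζ ^ n) := by
    rw [map_zpow, map_zpow, ← hk', Subgroup.coe_zpow, map_zpow, ← zpow_natCast, zpow_comm]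
  exact congrArg Additive.ofMul hn

theorem exists_unit_eq_of_torsion (ζ : CommGroup.torsion Fˣ) :
    ∃ ε : (𝓞 F)ˣ, Units.map (algebraMap (𝓞 F) F : 𝓞 F →* F) ε = ζ := by
  have key : ∀ z : CommGroup.torsion Fˣ, IsIntegral ℤ ((z : Fˣ) : F) := fun z => by
    obtain ⟨n, hn, hz⟩ := isOfFinOrder_iff_pow_eq_one.1 z.2
    exact IsIntegral.of_pow hn (by
      rw [← Units.val_pow_eq_pow_val, hz, Units.val_one]
      exact isIntegral_one)
  exact ⟨Units.mkOfMulEqOne ⟨_, key ζ⟩ ⟨_, key ζ⁻¹⟩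
    (RingOfIntegers.ext (Units.mul_inv (ζ : Fˣ))), Units.ext rfl⟩

/-- A character of the compact units is a product of phases, and phases are defined on all of F_ℝˣ.
Multiplication by a character exp(iℓ(log|u|)) changes nothing on compact units but can be arranged
to cancel the values on fundamental units. If the roots of unity are in the kernel as well, the
product is trivial on all global units and extends to the oriented class group. Conversely roots of
unity are global units, whose class is trivial. -/
theorem exact_restriction_rootsRestriction :
    Exact (restriction F K) (rootsRestriction F K) := by
  intro ρ
  rw [rootsRestriction_eq_zero_iff]
  constructor
  · intro h
    obtain ⟨n, rfl⟩ := phaseHom_surjective K ρ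
    let ψ₀ : (FR F)ˣ →* Circle :=
      ∏ φ, phase φ ^ (permBasis Gal(F/K) (F →+* ℂ)).repr n φ
    have hψ₀ : ∀ u, ψ₀ u = ∏ φ, phase φ u ^ (permBasis Gal(F/K) (F →+* ℂ)).repr n φ := fun u => by
      rw [MonoidHom.finsetProd_apply]
      rfl
    have hψ₀c : Continuous ψ₀ := by
      have : ⇑ψ₀ = fun u => ∏ φ, phase φ u ^ (permBasis Gal(F/K) (F →+* ℂ)).repr n φ := funext hψ₀
      rw [this]
      exact continuous_finsetProd _ fun φ _ => (continuous_phase φ).zpow _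
    have hψ₀' : ∀ c : compactUnits F, ψ₀ c = DualMod.char (phaseHom K F n) c := fun c => by
      rw [hψ₀, char_phaseHom]
    -- The functional is chosen so that the exponential character cancels the phases on the
    -- fundamental units.
    obtain ⟨l, hl⟩ := exists_expChar_fundSystem (F := F)
      fun i => (ψ₀ (globalUnit F (fundSystem F i)))⁻¹
    have htriv : ∀ ε, (ψ₀ * expChar l) (globalUnit F ε) = 1 := by
      refine hom_units_eq_one ((ψ₀ * expChar l).comp (globalUnit F)) (fun i => ?_) fun ζ hζ => ?_
      · rw [MonoidHom.comp_apply, MonoidHom.mul_apply, hl, mul_inv_cancel]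
      · have h1 := globalUnit_mem_compactUnits hζ
        rw [MonoidHom.comp_apply, MonoidHom.mul_apply, expChar_apply, logFR_of_mem_compactUnits h1,
          map_zero, Circle.exp_zero, mul_one]
        refine (hψ₀' ⟨_, h1⟩).trans ?_
        rw [← h ⟨Units.map (algebraMap (𝓞 F) F : 𝓞 F →* F) ζ,
          (Units.map (algebraMap (𝓞 F) F : 𝓞 F →* F)).isOfFinOrder hζ⟩]
        rfl
    obtain ⟨χ, hχ⟩ := exists_extension ((ψ₀ * expChar l).comp (normOne F).subtype)
      ((hψ₀c.mul (continuous_expChar l)).comp continuous_subtype_val) htriv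
    refine ⟨DualMod.mk (G := Gal(F/K)) χ, DualMod.ext fun c => ?_⟩
    refine (hχ ⟨c, compactUnits_le_normOne c.2⟩).trans ?_
    change ψ₀ c * expChar l c = _
    rw [expChar_apply, logFR_of_mem_compactUnits c.2, map_zero, Circle.exp_zero, mul_one, hψ₀']
  · rintro ⟨χ, rfl⟩ ζ
    obtain ⟨ε, hε⟩ := exists_unit_eq_of_torsion ζ
    have h1 : compactClass F (rootsInclusion F ζ) = 1 :=
      (unitClass_eq_one_iff _).2 ⟨ε, congrArg (Units.map (toFR F : F →* FR F)) hε⟩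
    change DualMod.char χ (compactClass F (rootsInclusion F ζ)) = 1
    rw [h1, map_one]

instance finite_rootsOfUnityModule_type : Finite (RootsOfUnityModule K F) :=
  inferInstanceAs (Finite (Additive (CommGroup.torsion Fˣ)))

variable [NumberField K] [IsGalois K F] [Module.Finite (GalRing K F) (Ar K F)]

instance finite_arTilde : Module.Finite (GalRing K F) (ArTilde K F) := by
  have h1 : Module.Finite ℤ (GalRing K F) := inferInstance
  have h2 := finite_submodule (Λ := GalRing K F) (LinearMap.range (restriction F K))
  have h3 : Module.Finite (GalRing K F) (LinearMap.ker (restriction F K)) := by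
    rw [(exact_inflation_restriction K).linearMap_ker_eq]
    infer_instance
  have h4 := Module.Finite.equiv (restriction F K).quotKerEquivRange.symm
  exact Module.Finite.of_submodule_quotient (LinearMap.ker (restriction F K))

/-- The four-term sequence is cut at the image of the restriction map into two short exact
sequences. -/
theorem cls_arTilde :
    G0.cls (GalRing K F) (ArTilde K F) +
        G0.cls (GalRing K F) (CircleDual Gal(F/K) (RootsOfUnityModule K F)) =
      G0.cls (GalRing K F) (Ar K F) + G0.cls (GalRing K F) (CompactDual K F) := by
  have h1 : Module.Finite ℤ (GalRing K F) := inferInstance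
  have h2 := finite_submodule (Λ := GalRing K F) (LinearMap.range (restriction F K))
  have e1 := G0.cls_add (inflation F K) (restriction F K).rangeRestrict (inflation_injective K)
    (fun χ => by
      rw [← exact_inflation_restriction K χ, Subtype.ext_iff]
      rfl) (restriction F K).surjective_rangeRestrict
  have e2 := G0.cls_add (LinearMap.range (restriction F K)).subtype (rootsRestriction F K)
    (Submodule.injective_subtype _) (fun χ => by
      rw [exact_restriction_rootsRestriction K χ, Submodule.coe_subtype, Subtype.range_coe]
      rfl) (rootsRestriction_surjective K)
  rw [← e1, ← e2, add_assoc]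

end Sequence

/-! ### Characters of full lattices in real vector spaces -/

section RealCharacter

/-- The character of a lattice may be computed on the real vector space it spans. -/
theorem chi_eq_trace {G : Type u} [Group G] {ι : Type*} [Finite ι] {X : Type u} [AddCommGroup X]
    [Module (MonoidAlgebra ℤ G) X] {V : Type*} [AddCommGroup V] [Module ℝ V]
    (b : Module.Basis ι ℤ X) (b' : Module.Basis ι ℝ V) (j : X →+ V) (hj : ∀ i, j (b i) = b' i)
    (g : G) (T : V →ₗ[ℝ] V) (hT : ∀ x, j (MonoidAlgebra.single g (1 : ℤ) • x) = T (j x)) :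
    (chi X g : ℝ) = LinearMap.trace ℝ V T := by
  classical
  let _ := Fintype.ofFinite ι
  -- Integral and real coordinates agree, so the matrix of g on the lattice is the matrix of T.
  have key : ∀ (x : X) (i : ι), b'.repr (j x) i = b.repr x i := fun x i => by
    let p : X →ₗ[ℤ] ℝ := ((b'.coord i).toAddMonoidHom.comp j).toIntLinearMap
    let q : X →ₗ[ℤ] ℝ := ((Int.castAddHom ℝ).comp (b.coord i).toAddMonoidHom).toIntLinearMap
    have : p = q := b.ext fun k => by
      change b'.repr (j (b k)) i = ((b.repr (b k) i : ℤ) : ℝ)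
      rw [hj, b.repr_self, b'.repr_self, Finsupp.single_apply, Finsupp.single_apply]
      split_ifs <;> simp
    exact LinearMap.congr_fun this x
  rw [chi, LinearMap.trace_eq_matrix_trace ℤ b, LinearMap.trace_eq_matrix_trace ℝ b', Matrix.trace,
    Matrix.trace, Int.cast_sum]
  refine Finset.sum_congr rfl fun i _ => ?_
  rw [Matrix.diag_apply, Matrix.diag_apply, LinearMap.toMatrix_apply, LinearMap.toMatrix_apply,
    ← hj, ← hT, key]
  rfl

end RealCharacter

/-! ### Polar decomposition and the functional attached to a character -/

section ExponentialSection

open NumberField NumberField.mixedEmbedding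

variable {F : Type u} [Field F] [NumberField F]

theorem mem_normOne_iff (u : (FR F)ˣ) : u ∈ normOne F ↔ ∑ w, logFR u w = 0 := by
  refine ⟨sum_logFR, fun h => ?_⟩
  change |Algebra.norm ℝ (u : FR F)| = 1
  have hne : ∀ w : InfinitePlace F, ‖embFR w.embedding (u : FR F)‖ ≠ 0 := fun w =>
    norm_ne_zero_iff.2 (embFR_units_ne_zero _ u)
  rw [abs_norm_FR]
  refine Real.eq_one_of_pos_of_log_eq_zero
    (Finset.prod_pos fun w _ => pow_pos (norm_pos_iff.2 (embFR_units_ne_zero _ u)) _) ?_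
  rw [Real.log_prod fun w _ => pow_ne_zero _ (hne w), ← h]
  simp only [Real.log_pow, logFR_apply]

/-- The positive unit of `F_ℝ` with given logarithm. -/
def expFR (x : realSpace F) : (FR F)ˣ :=
  unitsMk F ⟨fun w => ⟨Complex.exp ((x w / w.mult : ℝ) : ℂ), Complex.exp (-((x w / w.mult : ℝ) : ℂ)),
    by rw [← Complex.exp_add, add_neg_cancel, Complex.exp_zero],
    by rw [← Complex.exp_add, neg_add_cancel, Complex.exp_zero]⟩, fun w _ => Complex.exp_ofReal_im _⟩

theorem embFR_expFR (x : realSpace F) (w : InfinitePlace F) :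
    embFR w.embedding (expFR x : FR F) = Complex.exp ((x w / w.mult : ℝ) : ℂ) :=
  embFR_unitsMk _ w

theorem logFR_expFR (x : realSpace F) : logFR (expFR x) = x := funext fun w => by
  rw [logFR_apply, embFR_expFR, Complex.norm_exp_ofReal, Real.log_exp,
    mul_div_cancel₀ _ InfinitePlace.mult_coe_ne_zero]

theorem expFR_add (x y : realSpace F) : expFR (x + y) = expFR x * expFR y :=
  units_ext fun w => by
    rw [Units.val_mul, map_mul, embFR_expFR, embFR_expFR, embFR_expFR, ← Complex.exp_add,
      Pi.add_apply, add_div, Complex.ofReal_add]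

theorem continuous_expFR : Continuous (expFR : realSpace F → (FR F)ˣ) := by
  have h : ∀ w : InfinitePlace F, Continuous fun x : realSpace F => ((x w / w.mult : ℝ) : ℂ) :=
    fun w => Complex.continuous_ofReal.comp ((continuous_apply w).div_const _)
  refine continuous_unitsMk.comp (Continuous.subtype_mk (continuous_pi fun w => ?_) _)
  exact Units.continuous_iff.2 ⟨Complex.continuous_exp.comp (h w),
    Complex.continuous_exp.comp (h w).neg⟩

/-- Polar decomposition: dividing u by the positive element with the same absolute values leaves a
compact unit. -/
theorem mul_expFR_inv_mem (u : (FR F)ˣ) : u * (expFR (logFR u))⁻¹ ∈ compactUnits F := by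
  rw [mem_compactUnits_iff]
  intro w
  have h1 : ‖embFR w.embedding (expFR (logFR u) : FR F)‖ = ‖embFR w.embedding (u : FR F)‖ := by
    rw [embFR_expFR, Complex.norm_exp_ofReal, logFR_apply,
      mul_div_cancel_left₀ _ InfinitePlace.mult_coe_ne_zero,
      Real.exp_log (norm_pos_iff.2 (embFR_units_ne_zero _ u))]
  have h2 : embFR w.embedding (u : FR F) =
      embFR w.embedding ((u * (expFR (logFR u))⁻¹ : (FR F)ˣ) : FR F) *
        embFR w.embedding (expFR (logFR u) : FR F) := by
    rw [← map_mul, ← Units.val_mul, inv_mul_cancel_right]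
  have h3 := congrArg norm h2
  rw [norm_mul, h1, eq_comm] at h3
  exact (mul_eq_right₀ (norm_ne_zero_iff.2 (embFR_units_ne_zero _ u))).1 h3

variable (F) in
/-- The vector of local degrees. -/
def multVector : realSpace F := fun w => w.mult

variable (F) in
/-- The sum of the coordinates, as a linear functional. -/
def sumFunctional : realSpace F →ₗ[ℝ] ℝ := ∑ w, LinearMap.proj w

theorem sumFunctional_apply (x : realSpace F) : sumFunctional F x = ∑ w, x w := by
  rw [sumFunctional, LinearMap.sum_apply]
  rfl

theorem sumFunctional_multVector : sumFunctional F (multVector F) = Module.finrank ℚ F := by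
  rw [sumFunctional_apply, ← InfinitePlace.sum_mult_eq, Nat.cast_sum]
  rfl

variable (F) in
/-- The projection of the real space to the hyperplane of vectors of sum zero. -/
def hyperplaneProj : realSpace F →ₗ[ℝ] realSpace F :=
  LinearMap.id - ((Module.finrank ℚ F : ℝ)⁻¹ • sumFunctional F).smulRight (multVector F)

theorem hyperplaneProj_apply (x : realSpace F) : hyperplaneProj F x =
    x - ((Module.finrank ℚ F : ℝ)⁻¹ * sumFunctional F x) • multVector F := rfl

theorem finrank_cast_ne_zero : (Module.finrank ℚ F : ℝ) ≠ 0 :=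
  Nat.cast_ne_zero.2 Module.finrank_pos.ne'

theorem sumFunctional_hyperplaneProj (x : realSpace F) :
    sumFunctional F (hyperplaneProj F x) = 0 := by
  rw [hyperplaneProj_apply, map_sub, map_smul, sumFunctional_multVector, smul_eq_mul, mul_right_comm,
    inv_mul_cancel₀ finrank_cast_ne_zero, one_mul, sub_self]

theorem hyperplaneProj_multVector : hyperplaneProj F (multVector F) = 0 := by
  rw [hyperplaneProj_apply, sumFunctional_multVector, inv_mul_cancel₀ finrank_cast_ne_zero, one_smul,
    sub_self]

theorem hyperplaneProj_of_sum {x : realSpace F} (hx : sumFunctional F x = 0) :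
    hyperplaneProj F x = x := by
  rw [hyperplaneProj_apply, hx, mul_zero, zero_smul, sub_zero]

theorem apply_hyperplaneProj {l : realSpace F →ₗ[ℝ] ℝ} (hl : l (multVector F) = 0) (x : realSpace F) :
    l (hyperplaneProj F x) = l x := by
  rw [hyperplaneProj_apply, map_sub, map_smul, hl, smul_zero, sub_zero]

/-- The unit of norm `1` with logarithm the projection of `x`. -/
def expNormOne (x : realSpace F) : normOne F :=
  ⟨expFR (hyperplaneProj F x), (mem_normOne_iff _).2 (by
    rw [logFR_expFR, ← sumFunctional_apply, sumFunctional_hyperplaneProj])⟩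

theorem logFR_expNormOne (x : realSpace F) :
    logFR (expNormOne x : (FR F)ˣ) = hyperplaneProj F x := logFR_expFR _

theorem unitClass_eq_compactClass_mul (u : normOne F) : ∃ c : compactUnits F,
    unitClass F u = compactClass F c * unitClass F (expNormOne (logFR (u : (FR F)ˣ))) := by
  refine ⟨⟨_, mul_expFR_inv_mem (u : (FR F)ˣ)⟩, ?_⟩
  change unitClass F u = unitClass F _ * _
  rw [← map_mul]
  refine congrArg _ (Subtype.ext ?_)
  have h : ((expNormOne (logFR (u : (FR F)ˣ)) : normOne F) : (FR F)ˣ) = expFR (logFR (u : (FR F)ˣ)) := by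
    change expFR (hyperplaneProj F _) = _
    rw [hyperplaneProj_of_sum]
    rw [sumFunctional_apply]
    exact sum_logFR u.2
  rw [Subgroup.coe_mul, h]
  exact (inv_mul_cancel_right _ _).symm

/-- A character of the Arakelov class group is, on the classes of units of norm `±1`, the exponential
of a linear functional of the logarithm. -/
theorem exists_logFunctional (χ : PontryaginDual (Pic0 F)) :
    ∃ l : realSpace F →ₗ[ℝ] ℝ, l (multVector F) = 0 ∧
      ∀ u : normOne F, χ (toPic0 F (unitClass F u)) = expChar l (u : (FR F)ˣ) := by
  have hc : ∀ c, toPic0 F (compactClass F c) = 1 := fun c =>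
    (QuotientGroup.eq_one_iff _).2 (mem_compactImage_iff.2 ⟨c, rfl⟩)
  have hadd : ∀ x y : realSpace F, expNormOne (x + y) = expNormOne x * expNormOne y := fun x y =>
    Subtype.ext (by
      change expFR (hyperplaneProj F (x + y)) = expFR _ * expFR _
      rw [map_add, expFR_add])
  -- Projecting to the hyperplane first gives a continuous character of the whole real space, so no
  -- functional on a subspace is needed.
  obtain ⟨l, hl⟩ := exists_linear_of_character
    (fun x : realSpace F => χ (toPic0 F (unitClass F (expNormOne x))))
    (χ.continuous_toFun.comp ((toPic0 F).continuous_toFun.comp ((unitClass F).continuous_toFun.comp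
      ((continuous_expFR.comp (hyperplaneProj F).continuous_of_finiteDimensional).subtype_mk _))))
    fun x y => by rw [hadd, map_mul, map_mul, map_mul]
  -- The projection kills the line of the degree vector, so the character is trivial there and the
  -- functional vanishes on it. This normalisation makes the functional unique.
  have h0 : l (multVector F) = 0 := by
    have h1 := linear_eq_zero_of_exp (l.comp (LinearMap.toSpanSingleton ℝ _ (multVector F)))
      fun t => by
        rw [LinearMap.comp_apply, LinearMap.toSpanSingleton_apply, ← hl]
        have h2 : expNormOne (t • multVector F) = expNormOne 0 := Subtype.ext (by
          change expFR (hyperplaneProj F _) = expFR (hyperplaneProj F _)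
          rw [map_smul, hyperplaneProj_multVector, smul_zero, map_zero])
        rw [h2, hl, map_zero, Circle.exp_zero]
    have h2 := LinearMap.congr_fun h1 1
    rwa [LinearMap.comp_apply, LinearMap.toSpanSingleton_apply, one_smul] at h2
  refine ⟨l, h0, fun u => ?_⟩
  obtain ⟨c, hcu⟩ := unitClass_eq_compactClass_mul u
  rw [hcu, map_mul, hc, one_mul, hl]
  rfl

/-- Every vector of the trace-zero hyperplane is the logarithm of a unit of norm ±1, and functionals
killing the degree vector are determined on that hyperplane. -/
theorem logFunctional_unique {l l' : realSpace F →ₗ[ℝ] ℝ} (hl : l (multVector F) = 0)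
    (hl' : l' (multVector F) = 0)
    (h : ∀ u : normOne F, expChar l (u : (FR F)ˣ) = expChar l' (u : (FR F)ˣ)) : l = l' := by
  rw [← sub_eq_zero]
  refine linear_eq_zero_of_exp _ fun x => ?_
  have h1 := h (expNormOne x)
  rw [expChar_apply, expChar_apply, logFR_expNormOne, apply_hyperplaneProj hl,
    apply_hyperplaneProj hl'] at h1
  rw [LinearMap.sub_apply, Circle.exp_sub, h1, div_self']

end ExponentialSection

/-! ### The logarithmic lattice of Ar × ℤ -/

section LogDual

open NumberField NumberField.mixedEmbedding NumberField.mixedEmbedding.fundamentalCone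
  NumberField.Units NumberField.Units.dirichletUnitTheorem

variable (K : Type v) (F : Type u) [Field K] [Field F] [NumberField F] [Algebra K F]

/-- The permutation of the coordinates of the real space induced by an automorphism. -/
def permCoords (g : Gal(F/K)) : realSpace F →ₗ[ℝ] realSpace F :=
  LinearMap.funLeft ℝ ℝ fun w : InfinitePlace F => g • w

/-- The contragredient representation on linear functionals on the real space. -/
def logDualRep : Representation ℤ Gal(F/K) (realSpace F →ₗ[ℝ] ℝ) where
  toFun g :=
    { toFun := fun l => l.comp (permCoords K F g)
      map_add' := fun _ _ => rfl
      map_smul' := fun _ _ => rfl }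
  map_one' := LinearMap.ext fun l => LinearMap.ext fun x => congrArg l (funext fun w => by
    change x ((1 : Gal(F/K)) • w) = x w
    rw [one_smul])
  map_mul' g h := LinearMap.ext fun l => LinearMap.ext fun x => congrArg l (funext fun w => by
    change x ((g * h) • w) = x (g • h • w)
    rw [mul_smul])

/-- The `ℤ[G]`-module of linear functionals on the real space. -/
abbrev LogDual : Type u := (logDualRep K F).asModule

variable {K F}

/-- The linear functional underlying an element of `LogDual K F`. -/
def LogDual.fn : LogDual K F ≃ₗ[ℤ] (realSpace F →ₗ[ℝ] ℝ) := (logDualRep K F).asModuleEquiv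

theorem LogDual.fn_smul (g : Gal(F/K)) (l : LogDual K F) :
    LogDual.fn ((MonoidAlgebra.single g (1 : ℤ) : GalRing K F) • l) =
      (LogDual.fn l).comp (permCoords K F g) := by
  rw [asModule_smul]
  rfl

theorem mult_smul_place (g : Gal(F/K)) (w : InfinitePlace F) : (g • w).mult = w.mult := by
  classical
  rw [InfinitePlace.mult, InfinitePlace.mult]
  simp only [InfinitePlace.isReal_smul_iff]

theorem permCoords_multVector (g : Gal(F/K)) : permCoords K F g (multVector F) = multVector F :=
  funext fun w => congrArg Nat.cast (mult_smul_place g w)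

theorem sumFunctional_permCoords (g : Gal(F/K)) (x : realSpace F) :
    sumFunctional F (permCoords K F g x) = sumFunctional F x := by
  rw [sumFunctional_apply, sumFunctional_apply]
  exact Equiv.sum_comp (MulAction.toPerm g) x

/-- Automorphisms permute the embeddings, and neither the multiplicity nor the absolute value
depends on the embedding chosen above a place. -/
theorem logFR_inv_smul (g : Gal(F/K)) (u : (FR F)ˣ) :
    logFR (g⁻¹ • u) = permCoords K F g (logFR u) := funext fun w => by
  change logFR (g⁻¹ • u) w = logFR u (g • w)
  rw [logFR_apply, logFR_apply, mult_smul_place, embFR_inv_smul, ← norm_embFR_mk, ← smul_mk_eq,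
    InfinitePlace.mk_embedding]

/-- The linear functional attached to a character of the Arakelov class group. -/
def logFunctional (χ : Ar K F) : realSpace F →ₗ[ℝ] ℝ :=
  (exists_logFunctional (DualMod.char χ)).choose

theorem logFunctional_multVector (χ : Ar K F) : logFunctional χ (multVector F) = 0 :=
  (exists_logFunctional (DualMod.char χ)).choose_spec.1

theorem expChar_logFunctional (χ : Ar K F) (u : normOne F) :
    expChar (logFunctional χ) (u : (FR F)ˣ) = DualMod.char χ (toPic0 F (unitClass F u)) :=
  ((exists_logFunctional (DualMod.char χ)).choose_spec.2 u).symm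

theorem logFunctional_eq {χ : Ar K F} {l : realSpace F →ₗ[ℝ] ℝ} (hl : l (multVector F) = 0)
    (h : ∀ u : normOne F, expChar l (u : (FR F)ˣ) = DualMod.char χ (toPic0 F (unitClass F u))) :
    logFunctional χ = l :=
  logFunctional_unique (logFunctional_multVector χ) hl fun u => by rw [expChar_logFunctional, h]

variable (K F) in
/-- The homomorphism sending a character of the Arakelov class group to its linear functional. -/
def logHom : Ar K F →ₗ[GalRing K F] LogDual K F :=
  equivariantHom
    { toFun := fun χ => LogDual.fn.symm (logFunctional χ)
      map_zero' := by
        rw [LinearEquiv.symm_apply_eq, map_zero]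
        refine logFunctional_eq (LinearMap.zero_apply _) fun u => ?_
        rw [expChar_apply, LinearMap.zero_apply, Circle.exp_zero]
        rfl
      map_add' := fun χ ψ => by
        rw [← map_add]
        refine congrArg _ (logFunctional_eq ?_ fun u => ?_)
        · rw [LinearMap.add_apply, logFunctional_multVector, logFunctional_multVector, add_zero]
        · rw [expChar_apply, LinearMap.add_apply, Circle.exp_add, ← expChar_apply, ← expChar_apply,
            expChar_logFunctional, expChar_logFunctional]
          rfl }
    fun g χ => LogDual.fn.injective (by
      rw [LogDual.fn_smul]
      refine logFunctional_eq (χ := (MonoidAlgebra.single g (1 : ℤ) : GalRing K F) • χ) ?_ fun u => ?_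
      · rw [LinearMap.comp_apply, permCoords_multVector]
        exact logFunctional_multVector χ
      · refine Eq.trans ?_ (DualMod.char_smul (G := Gal(F/K)) (X := Pic0 F) g χ _).symm
        change _ = DualMod.char χ (toPic0 F (g⁻¹ • unitClass F u))
        rw [smul_unitClass, ← expChar_logFunctional, expChar_apply, expChar_apply, logFR_inv_smul]
        rfl)

variable (K F) in
/-- The homomorphism sending `n` to the functional `2πn/[F:ℚ]` times the sum of the coordinates. -/
def scaleHom : TrivialModule K F →ₗ[GalRing K F] LogDual K F :=
  equivariantHom
    { toFun := fun n => LogDual.fn.symm (((Representation.trivial ℤ Gal(F/K)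
        (ULift.{u} ℤ)).asModuleEquiv n).down • (2 * Real.pi / Module.finrank ℚ F) • sumFunctional F)
      map_zero' := by
        rw [map_zero, ULift.zero_down, zero_smul, map_zero]
      map_add' := fun m n => by
        rw [map_add, ULift.add_down, add_smul, map_add] }
    fun g n => LogDual.fn.injective (by
      rw [LogDual.fn_smul, asModule_smul]
      have key : ∀ m : ℤ, m • (2 * Real.pi / Module.finrank ℚ F) • sumFunctional F =
          (m • (2 * Real.pi / Module.finrank ℚ F) • sumFunctional F).comp (permCoords K F g) :=
        fun m => LinearMap.ext fun x => by
          simp only [LinearMap.comp_apply, LinearMap.smul_apply, sumFunctional_permCoords]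
      exact key _)

/-- The element of the trivial module given by an integer. -/
def trivialMk (n : ℤ) : TrivialModule K F :=
  (Representation.trivial ℤ Gal(F/K) (ULift.{u} ℤ)).asModuleEquiv.symm ⟨n⟩

theorem trivialMk_surjective : Surjective (trivialMk : ℤ → TrivialModule K F) := fun n =>
  ⟨((Representation.trivial ℤ Gal(F/K) (ULift.{u} ℤ)).asModuleEquiv n).down, rfl⟩

variable (K F) in
/-- The homomorphism `Ar × ℤ → LogDual` with finite kernel and image a full lattice. -/
def logScaleHom : Ar K F × TrivialModule K F →ₗ[GalRing K F] LogDual K F :=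
  (logHom K F).coprod (scaleHom K F)

theorem fn_logScaleHom (χ : Ar K F) (n : ℤ) (x : realSpace F) :
    LogDual.fn (logScaleHom K F (χ, trivialMk n)) x = logFunctional χ x +
      n * (2 * Real.pi / Module.finrank ℚ F * sumFunctional F x) := by
  have : LogDual.fn (logScaleHom K F (χ, trivialMk n)) =
    logFunctional χ + n • (2 * Real.pi / Module.finrank ℚ F) • sumFunctional F := rfl
  rw [this, LinearMap.add_apply, LinearMap.smul_apply, LinearMap.smul_apply, zsmul_eq_mul, smul_eq_mul]

/-- Characters contribute nothing on the degree vector, whose coordinates sum to [F:ℚ]. Division by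
[F:ℚ] in `scaleHom` thus makes this value read off the integer n exactly. -/
theorem logScaleHom_multVector (χ : Ar K F) (n : ℤ) :
    LogDual.fn (logScaleHom K F (χ, trivialMk n)) (multVector F) = n * (2 * Real.pi) := by
  rw [fn_logScaleHom, logFunctional_multVector, zero_add, sumFunctional_multVector,
    div_mul_cancel₀ _ finrank_cast_ne_zero]

theorem completeBasis_eq (i : InfinitePlace F) : completeBasis F i = multVector F ∨
    ∃ j, completeBasis F i = logFR (globalUnit F (fundSystem F j)) := by
  by_cases h : i = w₀
  · subst h
    exact Or.inl (completeBasis_apply_of_eq F)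
  · exact Or.inr ⟨_, (logFR_fundSystem ⟨i, h⟩).symm⟩

theorem unitClass_globalUnit (ε : (𝓞 F)ˣ) :
    unitClass F ⟨globalUnit F ε, globalUnit_mem_normOne ε⟩ = 1 :=
  (unitClass_eq_one_iff _).2 ⟨ε, rfl⟩

theorem sumFunctional_logFR_globalUnit (ε : (𝓞 F)ˣ) :
    sumFunctional F (logFR (globalUnit F ε)) = 0 := by
  rw [sumFunctional_apply]
  exact sum_logFR (globalUnit_mem_normOne ε)

/-- The image is 2π times the lattice dual to `completeBasis`. On the logarithm of a fundamental
unit, integrality expresses that exp(iℓ(log|u|)) is trivial on that unit. On the degree vector it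
records the component in ℤ. -/
theorem mem_range_logScaleHom_iff (l : LogDual K F) : l ∈ LinearMap.range (logScaleHom K F) ↔
    ∀ i, ∃ n : ℤ, LogDual.fn l (completeBasis F i) = n * (2 * Real.pi) := by
  constructor
  · rintro ⟨⟨χ, m⟩, rfl⟩ i
    obtain ⟨m, rfl⟩ := trivialMk_surjective m
    rcases completeBasis_eq i with h | ⟨j, h⟩
    · exact ⟨m, by rw [h, logScaleHom_multVector]⟩
    · rw [h, fn_logScaleHom, sumFunctional_logFR_globalUnit, mul_zero, mul_zero, add_zero]
      rw [← Circle.exp_eq_one, ← expChar_apply]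
      refine (expChar_logFunctional χ ⟨_, globalUnit_mem_normOne (fundSystem F j)⟩).trans ?_
      rw [unitClass_globalUnit, map_one, map_one]
  · intro h
    -- The value at the degree vector determines the integer component. After its contribution is
    -- subtracted, the remaining functional kills the degree vector and still takes values in 2πℤ on
    -- logarithms of fundamental units.
    obtain ⟨n, hn⟩ := h w₀
    rw [completeBasis_apply_of_eq] at hn
    let s := (n : ℝ) • (2 * Real.pi / Module.finrank ℚ F) • sumFunctional F
    let l' : realSpace F →ₗ[ℝ] ℝ := LogDual.fn l - s
    have hs : ∀ x, s x = n * (2 * Real.pi / Module.finrank ℚ F * sumFunctional F x) := fun x => rfl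
    have hl' : l' (multVector F) = 0 := by
      rw [LinearMap.sub_apply, hs, sumFunctional_multVector, div_mul_cancel₀ _ finrank_cast_ne_zero]
      exact sub_eq_zero.2 hn
    have htriv : ∀ ε, expChar l' (globalUnit F ε) = 1 := by
      refine hom_units_eq_one ((expChar l').comp (globalUnit F)) (fun j => ?_) fun ζ hζ => ?_
      · obtain ⟨w, rfl⟩ := equivFinRank.symm.surjective j
        rw [MonoidHom.comp_apply, expChar_apply, LinearMap.sub_apply, hs,
          sumFunctional_logFR_globalUnit, mul_zero, mul_zero, sub_zero, logFR_fundSystem,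
          Circle.exp_eq_one]
        exact h w
      · rw [MonoidHom.comp_apply, expChar_apply,
          logFR_of_mem_compactUnits (globalUnit_mem_compactUnits hζ), map_zero, Circle.exp_zero]
    obtain ⟨χ, hχ⟩ := exists_extension ((expChar l').comp (normOne F).subtype)
      ((continuous_expChar l').comp continuous_subtype_val) htriv
    -- The extended character is trivial on compact units, whose logarithm is 0, so it descends to
    -- the Arakelov class group.
    obtain ⟨ψ, hψ⟩ := (exact_inflation_restriction K (DualMod.mk (G := Gal(F/K)) χ)).1
      (DualMod.ext fun c => by
        refine (hχ ⟨c, compactUnits_le_normOne c.2⟩).trans ?_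
        change Circle.exp (l' (logFR (c : (FR F)ˣ))) = 1
        rw [logFR_of_mem_compactUnits c.2, map_zero, Circle.exp_zero])
    refine ⟨(ψ, trivialMk n), LogDual.fn.injective (LinearMap.ext fun x => ?_)⟩
    have h1 : logFunctional ψ = l' := logFunctional_eq hl' fun u => by
      refine (hχ u).symm.trans ?_
      exact congrArg (fun χ : ArTilde K F =>
        DualMod.char (G := Gal(F/K)) (X := PicTilde F) χ (unitClass F u)) hψ.symm
    rw [fn_logScaleHom, h1, ← hs, LinearMap.sub_apply, sub_add_cancel]

open Classical in
/-- The `ℤ`-basis of the image of `logScaleHom` dual to the complete basis, up to `2π`. -/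
theorem exists_basis_range : ∃ b : Module.Basis (InfinitePlace F) ℤ (LinearMap.range (logScaleHom K F)),
    ∀ i j, LogDual.fn (b i : LogDual K F) (completeBasis F j) =
      if i = j then 2 * Real.pi else 0 := by
  -- The basis consists of 2π times the coordinate functionals of `completeBasis`.
  let e : InfinitePlace F → LinearMap.range (logScaleHom K F) := fun i =>
    ⟨LogDual.fn.symm ((2 * Real.pi) • (completeBasis F).coord i),
      (mem_range_logScaleHom_iff _).2 fun j => by
        rw [LinearEquiv.apply_symm_apply, LinearMap.smul_apply, Module.Basis.coord_apply,
          Module.Basis.repr_self, Finsupp.single_apply]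
        refine ⟨if j = i then 1 else 0, ?_⟩
        split_ifs <;> simp⟩
  have he : ∀ i j, LogDual.fn (e i : LogDual K F) (completeBasis F j) =
      if i = j then 2 * Real.pi else 0 := fun i j => by
    change LogDual.fn (LogDual.fn.symm _) _ = _
    rw [LinearEquiv.apply_symm_apply, LinearMap.smul_apply, Module.Basis.coord_apply,
      Module.Basis.repr_self, Finsupp.single_apply]
    simp only [eq_comm (a := j), smul_eq_mul, mul_ite, mul_one, mul_zero]
  let ev : InfinitePlace F → LinearMap.range (logScaleHom K F) →ₗ[ℤ] ℝ := fun j =>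
    (((LinearMap.applyₗ (completeBasis F j)).toAddMonoidHom.comp
      (LogDual.fn : LogDual K F ≃ₗ[ℤ] _).toAddEquiv.toAddMonoidHom).comp
        (LinearMap.range (logScaleHom K F)).subtype.toAddMonoidHom).toIntLinearMap
  have hev : ∀ j x, ev j x = LogDual.fn (x : LogDual K F) (completeBasis F j) := fun j x => rfl
  have hsum : ∀ (n : InfinitePlace F → ℤ) j, ev j (∑ i, n i • e i) = n j * (2 * Real.pi) :=
    fun n j => by
      rw [map_sum, Fintype.sum_eq_single j fun i hi => by
        rw [map_zsmul, hev, he, if_neg hi, smul_zero], map_zsmul, hev, he, if_pos rfl, zsmul_eq_mul]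
  have hli : LinearIndependent ℤ e := Fintype.linearIndependent_iff.2 fun n hn j => by
    have h := hsum n j
    rw [hn, map_zero, eq_comm, mul_eq_zero] at h
    exact_mod_cast h.resolve_right Real.two_pi_pos.ne'
  have hsp : ⊤ ≤ Submodule.span ℤ (Set.range e) := fun x _ => by
    choose n hn using (mem_range_logScaleHom_iff (x : LogDual K F)).1 x.2
    have : x = ∑ i, n i • e i := by
      refine Subtype.ext (LogDual.fn.injective ((completeBasis F).ext fun j => ?_))
      rw [hn, ← hsum n j, hev]
    rw [this]
    exact Submodule.sum_mem _ fun i _ => Submodule.smul_mem _ _ (Submodule.subset_span ⟨i, rfl⟩)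
  exact ⟨Module.Basis.mk hli hsp, fun i j => by rw [Module.Basis.mk_apply, he]⟩

end LogDual

/-! ### Finite generation, torsion, and comparison of the two differences -/

section Finiteness

open NumberField NumberField.mixedEmbedding NumberField.mixedEmbedding.fundamentalCone
open scoped nonZeroDivisors

variable {K : Type v} {F : Type u} [Field K] [Field F] [NumberField F] [Algebra K F]

theorem finite_monoidHom_circle (A : Type*) [CommGroup A] [Finite A] : Finite (A →* Circle) := by
  let _ : TopologicalSpace A := ⊥
  have : DiscreteTopology A := ⟨rfl⟩
  have : Finite (PontryaginDual A) := inferInstance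
  exact Finite.of_injective (β := PontryaginDual A)
    (fun χ => (⟨χ, continuous_of_discreteTopology⟩ : PontryaginDual A))
    fun χ ψ h => MonoidHom.ext fun a => congrArg (fun f : PontryaginDual A => f a) h

/-- An element of the fibre product with principal ideal has the class of a unit of norm `±1`. -/
theorem exists_unitClass_eq {x : fibreProduct F} (hx : ClassGroup.mk F x.1.1 = 1) :
    ∃ u, toPicTilde F x = unitClass F u := by
  obtain ⟨a, ha⟩ := (ClassGroup.mk_eq_one_iff.1 hx).principal
  have ha' : FractionalIdeal.spanSingleton (𝓞 F)⁰ a = (x.1.1 : FractionalIdeal (𝓞 F)⁰ F) :=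
    FractionalIdeal.coeToSubmodule_injective (by
      beta_reduce
      rw [FractionalIdeal.coe_spanSingleton]
      exact ha.symm)
  obtain ⟨α, hα⟩ := mem_principal_ideals_iff.2 ⟨a, ha'⟩
  let y : fibreProduct F := x * (principal F α)⁻¹
  have hy : y.1.1 = 1 := by
    change x.1.1 * (toPrincipalIdeal (𝓞 F) F α)⁻¹ = 1
    rw [hα, mul_inv_cancel]
  have hy' : y.1.2 ∈ normOne F := (one_mk_mem_fibreProduct _).1 (by
    rw [← hy]
    exact y.2)
  refine ⟨⟨y.1.2, hy'⟩, ?_⟩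
  have h1 : toPicTilde F y = unitClass F ⟨y.1.2, hy'⟩ :=
    congrArg (toPicTilde F) (Subtype.ext (Prod.ext hy rfl))
  have h2 : toPicTilde F (principal F α) = 1 := toPicTilde_eq_one.2 ⟨α, rfl⟩
  rw [← h1, map_mul, map_inv, h2, inv_one, mul_one]

/-- Such a character is trivial on every class with principal ideal component, so it factors through
the ideal class group, which has finitely many characters. -/
theorem finite_logFunctional_eq_zero : Finite {χ : Ar K F // logFunctional χ = 0} := by
  have h : ∀ χ : {χ : Ar K F // logFunctional χ = 0}, ∃ χ' : ClassGroup (𝓞 F) →* Circle,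
      ∀ x : fibreProduct F, χ' (ClassGroup.mk F x.1.1) =
        DualMod.char χ.1 (toPic0 F (toPicTilde F x)) := fun χ =>
    exists_monoidHom_circle ((ClassGroup.mk F).comp
        ((MonoidHom.fst (IdealGroup F) (FR F)ˣ).comp (fibreProduct F).subtype))
      ((DualMod.char χ.1 : Pic0 F →* Circle).comp
        ((toPic0 F : PicTilde F →* Pic0 F).comp (toPicTilde F : fibreProduct F →* PicTilde F)))
      fun x hx => by
        obtain ⟨u, hu⟩ := exists_unitClass_eq hx
        change DualMod.char χ.1 (toPic0 F (toPicTilde F x)) = 1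
        rw [hu, ← expChar_logFunctional, χ.2, expChar_apply, LinearMap.zero_apply, Circle.exp_zero]
  choose X hX using h
  have := finite_monoidHom_circle (ClassGroup (𝓞 F))
  refine Finite.of_injective X fun χ ψ hχψ => Subtype.ext (DualMod.ext fun x => ?_)
  obtain ⟨y, rfl⟩ := toPic0_surjective F x
  obtain ⟨z, rfl⟩ := toPicTilde_surjective y
  rw [← hX, ← hX, hχψ]

/-- Evaluation at the degree vector shows that the integer component of a kernel element is 0. What
remains is a character with zero functional. -/
instance finite_ker_logScaleHom : Finite (LinearMap.ker (logScaleHom K F)) := by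
  have := finite_logFunctional_eq_zero (K := K) (F := F)
  have key : ∀ x : LinearMap.ker (logScaleHom K F),
      x.1.2 = trivialMk 0 ∧ logFunctional x.1.1 = 0 := by
    rintro ⟨⟨χ, m⟩, h⟩
    obtain ⟨n, rfl⟩ := trivialMk_surjective m
    have h0 : LogDual.fn (logScaleHom K F (χ, trivialMk n)) = 0 := by
      rw [LinearMap.mem_ker.1 h, map_zero]
    have h1 := logScaleHom_multVector χ n
    rw [h0, LinearMap.zero_apply, eq_comm, mul_eq_zero] at h1
    obtain rfl : n = 0 := by exact_mod_cast h1.resolve_right Real.two_pi_pos.ne'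
    refine ⟨rfl, LinearMap.ext fun x => ?_⟩
    have h2 := fn_logScaleHom χ 0 x
    rw [h0, Int.cast_zero, zero_mul, add_zero] at h2
    exact h2.symm
  exact Finite.of_injective
    (fun x => (⟨x.1.1, (key x).2⟩ : {χ : Ar K F // logFunctional χ = 0})) fun x y h =>
      Subtype.ext (Prod.ext (congrArg Subtype.val h) ((key x).1.trans (key y).1.symm))

instance finite_range_logScaleHom_int : Module.Finite ℤ (LinearMap.range (logScaleHom K F)) :=
  Module.Finite.of_basis (exists_basis_range (K := K) (F := F)).choose

instance free_range_logScaleHom : Module.Free ℤ (LinearMap.range (logScaleHom K F)) :=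
  Module.Free.of_basis (exists_basis_range (K := K) (F := F)).choose

instance finite_range_logScaleHom :
    Module.Finite (GalRing K F) (LinearMap.range (logScaleHom K F)) :=
  finite_of_finite_int _ inferInstance

theorem finite_ar_prod : Module.Finite (GalRing K F) (Ar K F × TrivialModule K F) := by
  have := Module.Finite.equiv (logScaleHom K F).quotKerEquivRange.symm
  exact Module.Finite.of_submodule_quotient (LinearMap.ker (logScaleHom K F))

instance finite_ar : Module.Finite (GalRing K F) (Ar K F) := by
  have := finite_ar_prod (K := K) (F := F)
  exact Module.Finite.of_surjective (LinearMap.fst (GalRing K F) (Ar K F) (TrivialModule K F))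
    LinearMap.fst_surjective

/-- The basis of the image is also a real basis of the dual of ℝ^{S_∞}, so the character is the
trace of the action on that space. -/
theorem chi_range_logScaleHom (g : Gal(F/K)) :
    (chi (LinearMap.range (logScaleHom K F)) g : ℝ) =
      LinearMap.trace ℝ _ (LinearMap.lcomp ℝ ℝ (permCoords K F g)) := by
  classical
  obtain ⟨b, hb⟩ := exists_basis_range (K := K) (F := F)
  refine chi_eq_trace b
    ((completeBasis F).dualBasis.unitsSMul fun _ => Units.mk0 (2 * Real.pi) Real.two_pi_pos.ne')
    ((LogDual.fn : LogDual K F ≃ₗ[ℤ] _).toAddEquiv.toAddMonoidHom.comp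
      (LinearMap.range (logScaleHom K F)).subtype.toAddMonoidHom) (fun i => ?_) g _ fun x => ?_
  · refine (completeBasis F).ext fun j => (hb i j).trans ?_
    rw [Module.Basis.unitsSMul_apply, Units.smul_mk0, LinearMap.smul_apply,
      Module.Basis.dualBasis_apply_self, smul_eq_mul, mul_ite, mul_one, mul_zero]
    simp only [eq_comm]
  · exact LogDual.fn_smul g (x : LogDual K F)

/-- The coordinate functionals embed ℤ[S_∞] as another full lattice in the same real representation,
whence the comparison of characters. -/
theorem chi_placesModule (g : Gal(F/K)) :
    (chi (PlacesModule K F) g : ℝ) =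
      LinearMap.trace ℝ _ (LinearMap.lcomp ℝ ℝ (permCoords K F g)) := by
  classical
  let f : InfinitePlace F → LogDual K F := fun w => LogDual.fn.symm (LinearMap.proj w)
  have hf : ∀ (g : Gal(F/K)) w, f (g • w) = (MonoidAlgebra.single g (1 : ℤ) : GalRing K F) • f w :=
    fun g w => LogDual.fn.injective (by
      rw [LogDual.fn_smul, LinearEquiv.apply_symm_apply, LinearEquiv.apply_symm_apply]
      rfl)
  refine chi_eq_trace (permBasis Gal(F/K) (InfinitePlace F))
    (Pi.basisFun ℝ (InfinitePlace F)).dualBasis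
    ((LogDual.fn : LogDual K F ≃ₗ[ℤ] _).toAddEquiv.toAddMonoidHom.comp
      (permLift f hf).toAddMonoidHom) (fun w => ?_) g _ fun x => ?_
  · change LogDual.fn (permLift f hf (permBasis Gal(F/K) (InfinitePlace F) w)) = _
    rw [permLift_permBasis, LinearEquiv.apply_symm_apply]
    refine LinearMap.ext fun x => ?_
    rw [Module.Basis.dualBasis_apply, Pi.basisFun_repr]
    rfl
  · change LogDual.fn (permLift f hf _) = (LogDual.fn (permLift f hf x)).comp (permCoords K F g)
    rw [map_smul, LogDual.fn_smul]

variable [NumberField K] [IsGalois K F]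

/-- The class of Ar × ℤ is that of a finite kernel plus that of a lattice with the character of
ℤ[S_∞]. The term σ[μ_F] is torsion because μ_F is finite. -/
theorem cls_ar_mem_torsion : G0.cls (GalRing K F) (Ar K F) -
    (G0.cls (GalRing K F) (PlacesModule K F) - G0.cls (GalRing K F) (TrivialModule K F) -
      sigma Gal(F/K) (G0.cls (GalRing K F) (RootsOfUnityModule K F))) ∈
    AddCommGroup.torsion (G0 (GalRing K F)) := by
  have h0 := finite_ar_prod (K := K) (F := F)
  have hM := G0.cls_ker_range (logScaleHom K F)
  rw [G0.cls_prod] at hM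
  have h1 := cls_sub_cls_mem_torsion (LinearMap.range (logScaleHom K F)) (PlacesModule K F) fun g =>
    Int.cast_injective (α := ℝ) ((chi_range_logScaleHom g).trans (chi_placesModule g).symm)
  have h2 := cls_mem_torsion_of_finite (G := Gal(F/K)) (LinearMap.ker (logScaleHom K F))
  have h3 := map_mem_torsion (sigma Gal(F/K)) (cls_mem_torsion_of_finite (RootsOfUnityModule K F))
  -- Since [Ar] = [ker] + [im] - [ℤ], the difference in question is ([im] - [ℤ[S_∞]]) + [ker] +
  -- σ[μ_F].
  have h4 := add_mem (add_mem h1 h2) h3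
  convert h4 using 1
  rw [eq_sub_of_add_eq hM.symm]
  abel

/-- With C the dual of the compact units, [Ãr] = [Ar] + [C] - [μ^∨], where [C] = d[ℤ[G]] - [ℤ[S_∞]]
and [μ^∨] = -σ[μ_F]. Both differences are thus one element, which gives the equivalence and
transfers the torsion statement. -/
theorem cls_arTilde_sub : G0.cls (GalRing K F) (ArTilde K F) -
    (Module.finrank ℚ K • G0.cls (GalRing K F) (GalRing K F) -
      G0.cls (GalRing K F) (TrivialModule K F)) =
    G0.cls (GalRing K F) (Ar K F) -
      (G0.cls (GalRing K F) (PlacesModule K F) - G0.cls (GalRing K F) (TrivialModule K F) -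
        sigma Gal(F/K) (G0.cls (GalRing K F) (RootsOfUnityModule K F))) := by
  have h1 := cls_arTilde (F := F) K
  rw [sigma_cls_of_finite, ← cls_compactDual, eq_sub_of_add_eq h1]
  abel

end Finiteness

end Arakelov

end

theorem mainTheorem4 (K : Type v) (F : Type u) [Field K] [NumberField K] [Field F] [NumberField F]
    [Algebra K F] [FiniteDimensional K F] [IsGalois K F] :
    ∃ (_ : Module.Finite (MonoidAlgebra ℤ Gal(F/K)) (Arakelov.ArTilde K F))
      (_ : Module.Finite (MonoidAlgebra ℤ Gal(F/K)) (Arakelov.Ar K F)),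
      (Arakelov.G0.cls (MonoidAlgebra ℤ Gal(F/K)) (Arakelov.ArTilde K F) =
            Module.finrank ℚ K •
                Arakelov.G0.cls (MonoidAlgebra ℤ Gal(F/K)) (MonoidAlgebra ℤ Gal(F/K)) -
              Arakelov.G0.cls (MonoidAlgebra ℤ Gal(F/K)) (Arakelov.TrivialModule K F) ↔
          Arakelov.G0.cls (MonoidAlgebra ℤ Gal(F/K)) (Arakelov.Ar K F) =
            Arakelov.G0.cls (MonoidAlgebra ℤ Gal(F/K)) (Arakelov.PlacesModule K F) -
              Arakelov.G0.cls (MonoidAlgebra ℤ Gal(F/K)) (Arakelov.TrivialModule K F) -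
              Arakelov.sigma Gal(F/K)
                (Arakelov.G0.cls (MonoidAlgebra ℤ Gal(F/K)) (Arakelov.RootsOfUnityModule K F))) ∧
      Arakelov.G0.cls (MonoidAlgebra ℤ Gal(F/K)) (Arakelov.ArTilde K F) -
          (Module.finrank ℚ K •
              Arakelov.G0.cls (MonoidAlgebra ℤ Gal(F/K)) (MonoidAlgebra ℤ Gal(F/K)) -
            Arakelov.G0.cls (MonoidAlgebra ℤ Gal(F/K)) (Arakelov.TrivialModule K F)) ∈
        AddCommGroup.torsion (Arakelov.G0 (MonoidAlgebra ℤ Gal(F/K))) ∧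
      Arakelov.G0.cls (MonoidAlgebra ℤ Gal(F/K)) (Arakelov.Ar K F) -
          (Arakelov.G0.cls (MonoidAlgebra ℤ Gal(F/K)) (Arakelov.PlacesModule K F) -
            Arakelov.G0.cls (MonoidAlgebra ℤ Gal(F/K)) (Arakelov.TrivialModule K F) -
            Arakelov.sigma Gal(F/K)
              (Arakelov.G0.cls (MonoidAlgebra ℤ Gal(F/K)) (Arakelov.RootsOfUnityModule K F))) ∈
        AddCommGroup.torsion (Arakelov.G0 (MonoidAlgebra ℤ Gal(F/K))) := by
  refine ⟨Arakelov.finite_arTilde K, Arakelov.finite_ar, ?_, ?_, Arakelov.cls_ar_mem_torsion⟩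
  · rw [← sub_eq_zero, Arakelov.cls_arTilde_sub, sub_eq_zero]
  · rw [Arakelov.cls_arTilde_sub]
    exact Arakelov.cls_ar_mem_torsion
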